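/- There is a constant $c>0$ such that asymptotically almost all matroids on $n$ elements have (Tutte) connectivity at least $c\sqrt{\log_2 n}$. In particular, for every fixed $k\in\mathbb{N}$, asymptotically almost all matroids are $k$-connected. Here a property holds for asymptotically almost all matroids if, among all matroids on the fixed (labelled) ground set $\{1,\dots,n\}$, the fraction having the property tends to $1$ as $n\to\infty$. For an integer $k\ge 1$, a $k$-separation of a matroid $M$ on $E$ is a partition $\{A,B\}$ of $E$ with $r_M(A)+r_M(B)<r(M)+k$ and $|A|,|B|\ge k$. The connectivity of $M$ is the smallest $k$ such that $M$ has a $k$-separation ($\infty$ if there is none), and $M$ is $k$-connected if it has no $j$-separation with $j<k$. -/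

import Mathlib

open Filter Topology

/-- `(A, B)` is a `k`-separation of `M`: a partition of the ground set with
`r(A) + r(B) < r(M) + k` (the partition is `k`-separating) and `|A|, |B| ≥ k`,
where `k` is a positive integer. -/
def Matroid.IsKSeparation {α : Type*} (M : Matroid α) (k : ℕ) (A B : Set α) : Prop :=
  1 ≤ k ∧ A ∪ B = M.E ∧ Disjoint A B ∧
    M.eRk A + M.eRk B < M.eRank + k ∧ (k : ℕ∞) ≤ A.encard ∧ (k : ℕ∞) ≤ B.encard

/-- The (Tutte) connectivity of `M`: the smallest `k` such that `M` has a `k`-separation,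
and `∞` if `M` has no `k`-separation for any `k`. -/
noncomputable def Matroid.tutteConnectivity {α : Type*} (M : Matroid α) : ℕ∞ :=
  sInf ((fun k : ℕ => (k : ℕ∞)) '' {k : ℕ | ∃ A B : Set α, M.IsKSeparation k A B})

/-- `M` is `k`-connected if it has no `j`-separation with `j < k`. -/
def Matroid.IsKConnected {α : Type*} (M : Matroid α) (k : ℕ) : Prop :=
  ∀ j : ℕ, j < k → ∀ A B : Set α, ¬ M.IsKSeparation j A B

/-- The set of all (labelled) matroids whose ground set is a fixed set of `n` elements. -/
def matroidsOn (n : ℕ) : Set (Matroid (Fin n)) := {M | M.E = Set.univ}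

/-- Matroids are determined by their ground set and bases, so there are finitely many of them
on `n` elements; in particular `Set.ncard` below is an honest count. -/
theorem matroidsOn_finite (n : ℕ) : (matroidsOn n).Finite := by
  have : Finite (Matroid (Fin n)) :=
    Finite.of_injective
      (fun M : Matroid (Fin n) => (M.E, {B : Set (Fin n) | M.IsBase B})) (by
        intro M N h
        simp only [Prod.mk.injEq] at h
        exact Matroid.ext_isBase h.1 (fun B _ => Set.ext_iff.1 h.2 B))
  exact Set.toFinite _

/-- (Asymptotically) almost all matroids satisfy `P`: the fraction of the matroids on `n`
elements that satisfy `P` tends to `1` as `n → ∞`. -/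
def AlmostAllMatroids (P : (n : ℕ) → Matroid (Fin n) → Prop) : Prop :=
  Tendsto (fun n : ℕ =>
      (({M ∈ matroidsOn n | P n M}.ncard : ℝ) / ((matroidsOn n).ncard : ℝ)))
    atTop (𝓝 1)

/-! The number of matroids is compared with numbers of stable families in the Johnson graph, whose
vertices are the r-sets, adjacent when they differ by one exchange. From below, each stable family
is the set of circuit-hyperplanes of a sparse paving matroid (`numStable_le_ncard_matroidsOfRank`),
and the Graham–Sloane code is a stable family containing a 1/n fraction of the r-sets; so there are
at least 2^(binom(n, n/2)/n) matroids. From above, a matroid of rank r is determined by a few valid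
rank bounds, its small dependent and codependent sets, and a maximal stable family among the
dependent r-sets that these data leave unexplained (`dep_of_description`). With N = binom(n, r),
everything except the stable family costs only a factor exp(N n^(-9/8)) (`eventually_description`),
negligible on the scale exp(N/n). So a class of matroids is negligible as soon as its uncovered
r-sets are confined to a family U for which `numStable U` is clearly smaller than the number of all
matroids (`ncard_le_of_isGoodCover`).

This is applied to two kinds of classes. (a) A given nonempty A with |A| ≤ log n / 656 is dependent:
U consists of the r-sets not containing A, and an entropy argument shows that readmitting supersets
of A multiplies the number of stable families by at least 2^(N e^(-41|A|)/n)
(`numStable_avoiding_le`). Codependent sets follow by duality. (b) A given A and its complement have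
ranks at most a and b with a + b < r + k, where k ≤ √|A|/510 and |A| ≤ n/2: members of U meet A in
one of at most k consecutive sizes, hence in at most k 2^|A|/√|A| ways, and for each trace the
Kleitman–Winston bound limits the stable families on the complement
(`exists_log_numStable_separatedFamily_le`).

Each exceptional class is at most an e^(-3n) fraction of all matroids, and there are only (n+1)^3
2^n choices of (r, A, a, b), so almost every matroid avoids all of them. In such a matroid let A be
the smaller side of a j-separation with j < c√(log n). If |A| is small, A is independent and
coindependent, so the two ranks sum to |A| + r ≥ j + r; if |A| is large, (b) applies. Both are
contradictions (`le_of_isKSeparation`). -/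

/-! ### Stable sets in Johnson graphs -/

section Stable

variable {α : Type*} [DecidableEq α]

/-- A family of equicardinal sets is stable if no two of its members are adjacent in the
Johnson graph, i.e. differ by the exchange of a single element. -/
def StableFamily (I : Finset (Finset α)) : Prop := ∀ X ∈ I, ∀ Y ∈ I, (X \ Y).card ≠ 1

instance (I : Finset (Finset α)) : Decidable (StableFamily I) := by
  unfold StableFamily; infer_instance

/-- The stable subfamilies of `U`. -/
def stableSubfamilies (U : Finset (Finset α)) : Finset (Finset (Finset α)) :=
  U.powerset.filter StableFamily

/-- The number of stable subfamilies of `U`. -/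
def numStable (U : Finset (Finset α)) : ℕ := (stableSubfamilies U).card

/-- The members of `U` adjacent to `X`. -/
def johnsonNeighbors (U : Finset (Finset α)) (X : Finset α) : Finset (Finset α) :=
  U.filter fun Y => (X \ Y).card = 1

lemma mem_stableSubfamilies {U I : Finset (Finset α)} :
    I ∈ stableSubfamilies U ↔ I ⊆ U ∧ StableFamily I := by
  simp [stableSubfamilies]

lemma mem_johnsonNeighbors {U : Finset (Finset α)} {X Y : Finset α} :
    Y ∈ johnsonNeighbors U X ↔ Y ∈ U ∧ (X \ Y).card = 1 := by
  simp [johnsonNeighbors]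

lemma StableFamily.mono {I J : Finset (Finset α)} (hJ : StableFamily J) (h : I ⊆ J) :
    StableFamily I := fun X hX Y hY => hJ X (h hX) Y (h hY)

lemma stableFamily_empty : StableFamily (∅ : Finset (Finset α)) := by
  simp [StableFamily]

lemma numStable_pos (U : Finset (Finset α)) : 0 < numStable U :=
  Finset.card_pos.2 ⟨∅, mem_stableSubfamilies.2 ⟨by simp, stableFamily_empty⟩⟩

lemma numStable_mono {U V : Finset (Finset α)} (h : U ⊆ V) : numStable U ≤ numStable V :=
  Finset.card_le_card fun I hI => by
    rw [mem_stableSubfamilies] at *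
    exact ⟨hI.1.trans h, hI.2⟩

lemma numStable_le_two_pow (U : Finset (Finset α)) : numStable U ≤ 2 ^ U.card := by
  rw [← Finset.card_powerset]
  exact Finset.card_filter_le _ _

lemma numStable_eq_two_pow {U : Finset (Finset α)} (h : StableFamily U) :
    numStable U = 2 ^ U.card := by
  rw [← Finset.card_powerset, numStable, stableSubfamilies, Finset.filter_true_of_mem]
  intro I hI
  exact h.mono (Finset.mem_powerset.1 hI)

/-- A stable family in the union is recovered from its traces on the two parts, which are again
stable. -/
lemma numStable_union_le (U V : Finset (Finset α)) :
    numStable (U ∪ V) ≤ numStable U * numStable V := by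
  rw [numStable, numStable, numStable, ← Finset.card_product]
  refine Finset.card_le_card_of_injOn (fun I => (I ∩ U, I ∩ V)) ?_ ?_
  · intro I hI
    have hI := (mem_stableSubfamilies.1 hI)
    simp only [Finset.coe_product, Set.mem_prod, Finset.mem_coe, mem_stableSubfamilies]
    exact ⟨⟨Finset.inter_subset_right, hI.2.mono Finset.inter_subset_left⟩,
      ⟨Finset.inter_subset_right, hI.2.mono Finset.inter_subset_left⟩⟩
  · intro I hI J hJ h
    have hI := (mem_stableSubfamilies.1 hI).1
    have hJ := (mem_stableSubfamilies.1 hJ).1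
    simp only [Prod.mk.injEq] at h
    calc I = I ∩ U ∪ I ∩ V := by rw [← Finset.inter_union_distrib_left]; exact (Finset.inter_eq_left.2 hI).symm
      _ = J ∩ U ∪ J ∩ V := by rw [h.1, h.2]
      _ = J := by rw [← Finset.inter_union_distrib_left]; exact Finset.inter_eq_left.2 hJ

lemma numStable_biUnion_le {ι : Type*} [DecidableEq ι] (s : Finset ι)
    (f : ι → Finset (Finset α)) :
    numStable (s.biUnion f) ≤ ∏ i ∈ s, numStable (f i) := by
  induction s using Finset.induction_on with
  | empty => simpa using numStable_le_two_pow (∅ : Finset (Finset α))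
  | insert a s ha ih =>
    rw [Finset.biUnion_insert, Finset.prod_insert ha]
    exact (numStable_union_le _ _).trans (Nat.mul_le_mul_left _ ih)

lemma numStable_image_le {β : Type*} [DecidableEq β] (U : Finset (Finset β))
    (φ : Finset β → Finset α) (hφ : ∀ X ∈ U, ∀ Y ∈ U, (φ X \ φ Y).card = (X \ Y).card) :
    numStable (U.image φ) ≤ numStable U := by
  refine Finset.card_le_card_of_surjOn (fun I => I.image φ) ?_
  intro I hI
  obtain ⟨hIU, hI⟩ := mem_stableSubfamilies.1 hI
  refine ⟨U.filter (fun X => φ X ∈ I), ?_, ?_⟩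
  · refine mem_stableSubfamilies.2 ⟨Finset.filter_subset _ _, ?_⟩
    intro X hX Y hY
    rw [Finset.mem_filter] at hX hY
    rw [← hφ X hX.1 Y hY.1]
    exact hI _ hX.2 _ hY.2
  · ext Z
    simp only [Finset.mem_image, Finset.mem_filter]
    constructor
    · rintro ⟨X, ⟨_, h⟩, rfl⟩
      exact h
    · intro hZ
      obtain ⟨X, hX, rfl⟩ := Finset.mem_image.1 (hIU hZ)
      exact ⟨X, ⟨hX, hZ⟩, rfl⟩

/-- Adding a fixed set `Q` disjoint from the ground set does not increase the number of stable
families. -/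
lemma numStable_image_union_le (B Q : Finset α) (r : ℕ) (hQ : Disjoint Q B) :
    numStable ((Finset.powersetCard r B).image (Q ∪ ·)) ≤
      numStable (Finset.powersetCard r B) := by
  refine numStable_image_le _ _ ?_
  intro X hX Y hY
  rw [Finset.mem_powersetCard] at hX hY
  congr 1
  ext a
  simp only [Finset.mem_sdiff, Finset.mem_union, not_or]
  constructor
  · rintro ⟨h1, h2, h3⟩
    exact ⟨h1.resolve_left h2, h3⟩
  · rintro ⟨h1, h2⟩
    exact ⟨Or.inr h1, fun h => (Finset.disjoint_left.1 hQ h) (hX.1 h1), h2⟩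

/-! ### The Kleitman–Winston bound -/

/-- The numbers of stable families in `U \ {X}` and in `U` minus the closed neighborhood of `X`
together bound the number of stable families in `U`. -/
lemma numStable_le_add (U : Finset (Finset α)) (X : Finset α) :
    numStable U ≤ numStable (U.erase X) + numStable ((U.erase X) \ johnsonNeighbors U X) := by
  have : stableSubfamilies U ⊆ stableSubfamilies (U.erase X) ∪
      (stableSubfamilies ((U.erase X) \ johnsonNeighbors U X)).image (insert X) := by
    intro I hI
    obtain ⟨hIU, hI⟩ := mem_stableSubfamilies.1 hI
    rw [Finset.mem_union]
    by_cases hX : X ∈ I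
    · right
      refine Finset.mem_image.2 ⟨I.erase X, mem_stableSubfamilies.2
        ⟨?_, hI.mono (Finset.erase_subset _ _)⟩, Finset.insert_erase hX⟩
      intro Y hY
      rw [Finset.mem_erase] at hY
      refine Finset.mem_sdiff.2 ⟨Finset.mem_erase.2 ⟨hY.1, hIU hY.2⟩, fun h => ?_⟩
      exact hI X hX Y hY.2 (mem_johnsonNeighbors.1 h).2
    · left
      exact mem_stableSubfamilies.2 ⟨fun Y hY => Finset.mem_erase.2
        ⟨fun h => hX (h ▸ hY), hIU hY⟩, hI⟩
  refine (Finset.card_le_card this).trans ((Finset.card_union_le _ _).trans ?_)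
  exact Nat.add_le_add_left Finset.card_image_le _

lemma sum_choose_le_sum_choose {a b : ℕ} (h : a ≤ b) (q : ℕ) :
    ∑ j ∈ Finset.range q, a.choose j ≤ ∑ j ∈ Finset.range q, b.choose j :=
  Finset.sum_le_sum fun _ _ => Nat.choose_le_choose _ h

/-- This Pascal recursion mirrors the branching in `numStable_le_add`; the Kleitman–Winston
induction closes because of it. -/
lemma sum_range_choose_succ (u q : ℕ) :
    ∑ j ∈ Finset.range (q + 1), (u + 1).choose j =
      ∑ j ∈ Finset.range (q + 1), u.choose j + ∑ j ∈ Finset.range q, u.choose j := by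
  rw [Finset.sum_range_succ', Finset.sum_range_succ' (fun j => u.choose j)]
  simp only [Nat.choose_succ_succ, Finset.sum_add_distrib, Nat.choose_zero_right]
  ring

/-- The Kleitman–Winston bound: if every subfamily of `U` with more than `R` members has a member
adjacent to a `β`-fraction of it, then `U` has few stable subfamilies. -/
theorem numStable_le_of_degree {R β : ℝ} (hβ1 : β ≤ 1) :
    ∀ (U : Finset (Finset α)) (q : ℕ),
      (∀ W ⊆ U, R < W.card → ∃ X ∈ W, β * W.card ≤ (johnsonNeighbors W X).card) →
      U.card * (1 - β) ^ q ≤ R →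
      (numStable U : ℝ) ≤ 2 ^ R * ∑ j ∈ Finset.range (q + 1), (U.card.choose j : ℝ) := by
  intro U
  induction U using Finset.strongInduction with
  | H U ih =>
  intro q hdeg hq
  by_cases hU : (U.card : ℝ) ≤ R
  · have h1 : (numStable U : ℝ) ≤ 2 ^ R := by
      calc (numStable U : ℝ) ≤ 2 ^ U.card := by exact_mod_cast numStable_le_two_pow U
        _ = (2 : ℝ) ^ (U.card : ℝ) := (Real.rpow_natCast _ _).symm
        _ ≤ 2 ^ R := Real.rpow_le_rpow_of_exponent_le (by norm_num) hU
    have h2 : (1 : ℝ) ≤ ∑ j ∈ Finset.range (q + 1), (U.card.choose j : ℝ) := by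
      rw [Finset.sum_range_succ']
      simp only [Nat.choose_zero_right, Nat.cast_one]
      have : (0 : ℝ) ≤ ∑ j ∈ Finset.range q, (U.card.choose (j + 1) : ℝ) :=
        Finset.sum_nonneg fun _ _ => Nat.cast_nonneg _
      linarith
    nlinarith [Real.rpow_pos_of_pos (show (0 : ℝ) < 2 by norm_num) R]
  · push Not at hU
    obtain ⟨X, hX, hd⟩ := hdeg U subset_rfl hU
    -- Here q bounds the number of high-degree members that can still be chosen before at most R
    -- sets remain; more than R sets remain, so q is not 0.
    obtain ⟨p, rfl⟩ : ∃ p, q = p + 1 := by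
      refine Nat.exists_eq_succ_of_ne_zero ?_
      rintro rfl
      simp at hq
      linarith
    have hlt : U.erase X ⊂ U := Finset.erase_ssubset hX
    have hcard : U.card = (U.erase X).card + 1 := (Finset.card_erase_add_one hX).symm
    have h1 := ih _ hlt (p + 1) (fun W hW => hdeg W (hW.trans hlt.1)) (by
      refine le_trans ?_ hq
      have : ((U.erase X).card : ℝ) ≤ U.card := by exact_mod_cast Finset.card_le_card hlt.1
      exact mul_le_mul_of_nonneg_right this (pow_nonneg (by linarith) _))
    -- Choosing X removes its neighbors, which shrinks U by the factor 1 - β at the cost of one of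
    -- the q choices.
    set U' := (U.erase X) \ johnsonNeighbors U X with hU'
    have hsub : U' ⊆ U.erase X := Finset.sdiff_subset
    have hU'card : (U'.card : ℝ) ≤ (1 - β) * U.card := by
      have hdisj : Disjoint U' (johnsonNeighbors U X) := Finset.sdiff_disjoint
      have : U' ∪ johnsonNeighbors U X ⊆ U :=
        Finset.union_subset (hsub.trans hlt.1) (Finset.filter_subset _ _)
      have := Finset.card_le_card this
      rw [Finset.card_union_of_disjoint hdisj] at this
      have : (U'.card : ℝ) + (johnsonNeighbors U X).card ≤ U.card := by exact_mod_cast this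
      linarith
    have h2 := ih U' (lt_of_le_of_lt hsub hlt) p
      (fun W hW => hdeg W (hW.trans (hsub.trans hlt.1))) (by
        refine le_trans ?_ hq
        rw [pow_succ']
        calc (U'.card : ℝ) * (1 - β) ^ p ≤ ((1 - β) * U.card) * (1 - β) ^ p :=
              mul_le_mul_of_nonneg_right hU'card (pow_nonneg (by linarith) _)
          _ = _ := by ring)
    have h3 : (∑ j ∈ Finset.range (p + 1), (U'.card.choose j : ℝ)) ≤
        ∑ j ∈ Finset.range (p + 1), ((U.erase X).card.choose j : ℝ) := by
      exact_mod_cast sum_choose_le_sum_choose (Finset.card_le_card hsub) (p + 1)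
    have h4 : (∑ j ∈ Finset.range (p + 1 + 1), (U.card.choose j : ℝ)) =
        ∑ j ∈ Finset.range (p + 1 + 1), ((U.erase X).card.choose j : ℝ) +
        ∑ j ∈ Finset.range (p + 1), ((U.erase X).card.choose j : ℝ) := by
      rw [hcard]
      exact_mod_cast sum_range_choose_succ _ _
    have h5 : (numStable U : ℝ) ≤ numStable (U.erase X) + numStable U' := by
      exact_mod_cast numStable_le_add U X
    rw [h4, mul_add]
    have h6 : (2 : ℝ) ^ R * (∑ j ∈ Finset.range (p + 1), (U'.card.choose j : ℝ)) ≤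
      2 ^ R * ∑ j ∈ Finset.range (p + 1), ((U.erase X).card.choose j : ℝ) :=
      mul_le_mul_of_nonneg_left h3 (Real.rpow_nonneg (by norm_num) _)
    linarith

/-- The number of `(r + 1)`-sets containing two given `r`-sets. -/
lemma card_supersets_le (B X Y : Finset α) (r : ℕ) (hX : X ∈ Finset.powersetCard r B)
    (hY : Y ∈ Finset.powersetCard r B) :
    ((Finset.powersetCard (r + 1) B).filter (fun V => X ⊆ V ∧ Y ⊆ V)).card ≤
      (if X = Y then B.card - r else 0) + (if (X \ Y).card = 1 then 1 else 0) := by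
  rw [Finset.mem_powersetCard] at hX hY
  by_cases hXY : X = Y
  · subst hXY
    simp only [if_true, Finset.sdiff_self, Finset.card_empty]
    have : ((Finset.powersetCard (r + 1) B).filter (fun V => X ⊆ V ∧ X ⊆ V)) ⊆
        (B \ X).image (fun b => insert b X) := by
      intro V hV
      simp only [Finset.mem_filter, Finset.mem_powersetCard, and_self] at hV
      obtain ⟨⟨h1, h2⟩, h3⟩ := hV
      have : (V \ X).card = 1 := by
        rw [Finset.card_sdiff_of_subset h3]; omega
      obtain ⟨b, hb⟩ := Finset.card_eq_one.1 this
      have hb' : b ∈ V \ X := by rw [hb]; simp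
      rw [Finset.mem_sdiff] at hb'
      refine Finset.mem_image.2 ⟨b, Finset.mem_sdiff.2 ⟨h1 hb'.1, hb'.2⟩, ?_⟩
      rw [Finset.insert_eq, ← hb, Finset.sdiff_union_of_subset h3]
    refine (Finset.card_le_card this).trans (Finset.card_image_le.trans ?_)
    rw [Finset.card_sdiff_of_subset hX.1, hX.2]
    simp
  · simp only [hXY, if_false, zero_add]
    have hsub : ((Finset.powersetCard (r + 1) B).filter (fun V => X ⊆ V ∧ Y ⊆ V)) ⊆
        {X ∪ Y} ∧ (((Finset.powersetCard (r + 1) B).filter (fun V => X ⊆ V ∧ Y ⊆ V)).Nonempty →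
          (X \ Y).card = 1) := by
      have key : ∀ V ∈ ((Finset.powersetCard (r + 1) B).filter (fun V => X ⊆ V ∧ Y ⊆ V)),
          V = X ∪ Y ∧ (X \ Y).card = 1 := by
        intro V hV
        simp only [Finset.mem_filter, Finset.mem_powersetCard] at hV
        obtain ⟨⟨h1, h2⟩, h3, h4⟩ := hV
        have hu := Finset.union_subset h3 h4
        have h5 := Finset.card_le_card hu
        have h6 : (X \ Y).card + Y.card = (X ∪ Y).card := Finset.card_sdiff_add_card X Y
        have h7 : (X \ Y).card ≠ 0 := by
          intro h
          rw [Finset.card_eq_zero, Finset.sdiff_eq_empty_iff_subset] at h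
          exact hXY (Finset.eq_of_subset_of_card_le h (by omega))
        refine ⟨(Finset.eq_of_subset_of_card_le hu (by omega)).symm, by omega⟩
      refine ⟨fun V hV => by simp [(key V hV).1], ?_⟩
      rintro ⟨V, hV⟩
      exact (key V hV).2
    split_ifs with h
    · exact (Finset.card_le_card hsub.1).trans (by simp)
    · rw [Nat.le_zero, Finset.card_eq_zero, ← Finset.not_nonempty_iff_eq_empty]
      exact fun h' => h (hsub.2 h')

lemma card_supersets (B X : Finset α) (r : ℕ) (hX : X ∈ Finset.powersetCard r B) :
    ((Finset.powersetCard (r + 1) B).filter (fun V => X ⊆ V)).card = B.card - r := by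
  rw [Finset.mem_powersetCard] at hX
  have : ((Finset.powersetCard (r + 1) B).filter (fun V => X ⊆ V)) =
        (B \ X).image (fun b => insert b X) := by
    ext V
    simp only [Finset.mem_filter, Finset.mem_powersetCard, Finset.mem_image, Finset.mem_sdiff]
    constructor
    · rintro ⟨⟨h1, h2⟩, h3⟩
      have : (V \ X).card = 1 := by
        rw [Finset.card_sdiff_of_subset h3]; omega
      obtain ⟨b, hb⟩ := Finset.card_eq_one.1 this
      have hb' : b ∈ V \ X := by rw [hb]; simp
      rw [Finset.mem_sdiff] at hb'
      refine ⟨b, ⟨h1 hb'.1, hb'.2⟩, ?_⟩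
      rw [Finset.insert_eq, ← hb, Finset.sdiff_union_of_subset h3]
    · rintro ⟨b, ⟨hb, hbX⟩, rfl⟩
      refine ⟨⟨Finset.insert_subset hb hX.1, ?_⟩, Finset.subset_insert _ _⟩
      rw [Finset.card_insert_of_notMem hbX, hX.2]
  rw [this, Finset.card_image_of_injOn, Finset.card_sdiff_of_subset hX.1, hX.2]
  intro a ha b hb h
  have ha : a ∉ X := (Finset.mem_sdiff.1 ha).2
  have : a ∈ insert b X := by
    have h : insert a X = insert b X := h
    rw [← h]; simp
  exact (Finset.mem_insert.1 this).resolve_right ha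

/-- A large family of `r`-sets has a member with many neighbors inside the family. -/
lemma exists_degree_ge (B : Finset α) (r : ℕ) (U : Finset (Finset α))
    (hU : U ⊆ Finset.powersetCard r B) (hne : U.Nonempty) :
    ∃ X ∈ U, (B.card - r) * (r + 1) * U.card ≤
      ((johnsonNeighbors U X).card + (B.card - r)) * B.card.choose r := by
  obtain ⟨X, hX, hmax⟩ := Finset.exists_max_image U (fun X => (johnsonNeighbors U X).card) hne
  refine ⟨X, hX, ?_⟩
  set D := (johnsonNeighbors U X).card
  set S := Finset.powersetCard (r + 1) B with hS
  have hScard : S.card * (r + 1) = B.card.choose r * (B.card - r) := by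
    rw [hS, Finset.card_powersetCard, Nat.choose_succ_right_eq]
  -- Count pairs of members of U inside a common (r+1)-set. Distinct members have such a superset
  -- only if they are adjacent, and then just one, so the second moment is controlled by the maximum
  -- degree D; Cauchy–Schwarz compares it with the first moment.
  have h1 : ∑ V ∈ S, (U.filter (· ⊆ V)).card = U.card * (B.card - r) := by
    simp only [Finset.card_filter]
    rw [Finset.sum_comm, ← smul_eq_mul, ← Finset.sum_const]
    refine Finset.sum_congr rfl fun Y hY => ?_
    rw [← Finset.card_filter]
    exact card_supersets B Y r (hU hY)
  have h2 : ∑ V ∈ S, (U.filter (· ⊆ V)).card ^ 2 ≤ U.card * (D + (B.card - r)) := by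
    calc ∑ V ∈ S, (U.filter (· ⊆ V)).card ^ 2
        = ∑ V ∈ S, ∑ Y ∈ U, ∑ Z ∈ U, (if Y ⊆ V ∧ Z ⊆ V then 1 else 0) := by
          refine Finset.sum_congr rfl fun V _ => ?_
          rw [sq, Finset.card_filter, Finset.sum_mul_sum]
          refine Finset.sum_congr rfl fun Y _ => Finset.sum_congr rfl fun Z _ => ?_
          by_cases h : Y ⊆ V <;> by_cases h' : Z ⊆ V <;> simp [h, h']
      _ = ∑ Y ∈ U, ∑ Z ∈ U, (S.filter (fun V => Y ⊆ V ∧ Z ⊆ V)).card := by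
          rw [Finset.sum_comm]
          refine Finset.sum_congr rfl fun Y _ => ?_
          rw [Finset.sum_comm]
          refine Finset.sum_congr rfl fun Z _ => ?_
          rw [Finset.card_filter]
      _ ≤ ∑ Y ∈ U, ∑ Z ∈ U, ((if Y = Z then B.card - r else 0) +
            (if (Y \ Z).card = 1 then 1 else 0)) :=
          Finset.sum_le_sum fun Y hY => Finset.sum_le_sum fun Z hZ =>
            card_supersets_le B Y Z r (hU hY) (hU hZ)
      _ ≤ ∑ Y ∈ U, (D + (B.card - r)) := by
          refine Finset.sum_le_sum fun Y hY => ?_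
          rw [Finset.sum_add_distrib, Finset.sum_ite_eq, if_pos hY, ← Finset.card_filter,
            add_comm]
          exact Nat.add_le_add_right (hmax Y hY) _
      _ = _ := by rw [Finset.sum_const, smul_eq_mul]
  have h3 := sq_sum_le_card_mul_sum_sq (s := S) (f := fun V => (U.filter (· ⊆ V)).card)
  rw [h1] at h3
  have h4 : (U.card * (B.card - r)) ^ 2 * (r + 1) ≤
      B.card.choose r * (B.card - r) * (U.card * (D + (B.card - r))) := by
    calc (U.card * (B.card - r)) ^ 2 * (r + 1)
        ≤ (S.card * (U.card * (D + (B.card - r)))) * (r + 1) :=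
          Nat.mul_le_mul_right _ (h3.trans (Nat.mul_le_mul_left _ h2))
      _ = _ := by rw [← hScard]; ring
  have hUpos : 0 < U.card := Finset.card_pos.2 hne
  rcases Nat.eq_zero_or_pos (B.card - r) with h0 | hpos
  · simp [h0]
  · refine Nat.le_of_mul_le_mul_left ?_ (Nat.mul_pos hUpos hpos)
    calc _ = (U.card * (B.card - r)) ^ 2 * (r + 1) := by ring
      _ ≤ _ := h4
      _ = _ := by ring

/-! ### The Graham–Sloane code -/

/-- Every family of `r`-subsets of an `n`-element set contains a stable subfamily comprising at
least a `1 / n` fraction of it. -/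
lemma exists_stable_subfamily [Fintype α] [Nonempty α] (r : ℕ) (U : Finset (Finset α))
    (hU : U ⊆ Finset.powersetCard r Finset.univ) :
    ∃ T ⊆ U, StableFamily T ∧ U.card ≤ Fintype.card α * T.card := by
  classical
  set n := Fintype.card α
  have : NeZero n := ⟨Fintype.card_ne_zero⟩
  have hn : Fintype.card (ZMod n) = n := ZMod.card n
  let e : α ≃ ZMod n := Fintype.equivOfCardEq hn.symm
  -- Exchanging x for y changes the label sum by e y - e x, which is nonzero, so each fiber of f is
  -- stable; the largest fiber has at least average size.
  let f : Finset α → ZMod n := fun X => ∑ x ∈ X, e x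
  obtain ⟨c, -, hc⟩ := Finset.exists_max_image (Finset.univ : Finset (ZMod n))
    (fun c => (U.filter (fun X => f X = c)).card) ⟨0, Finset.mem_univ _⟩
  refine ⟨U.filter (fun X => f X = c), Finset.filter_subset _ _, ?_, ?_⟩
  · intro X hX Y hY h1
    rw [Finset.mem_filter] at hX hY
    have hXc := (Finset.mem_powersetCard.1 (hU hX.1)).2
    have hYc := (Finset.mem_powersetCard.1 (hU hY.1)).2
    have h2 : (Y \ X).card = 1 := by
      have h3 := Finset.card_sdiff_add_card X Y
      have h4 := Finset.card_sdiff_add_card Y X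
      rw [Finset.union_comm] at h4
      omega
    obtain ⟨x, hx⟩ := Finset.card_eq_one.1 h1
    obtain ⟨y, hy⟩ := Finset.card_eq_one.1 h2
    have hfX : f X = e x + ∑ z ∈ X ∩ Y, e z := by
      simp only [f]
      rw [← Finset.sum_sdiff (Finset.inter_subset_left : X ∩ Y ⊆ X), Finset.sdiff_inter_self_left,
        hx, Finset.sum_singleton]
    have hfY : f Y = e y + ∑ z ∈ X ∩ Y, e z := by
      simp only [f]
      rw [← Finset.sum_sdiff (Finset.inter_subset_right : X ∩ Y ⊆ Y),
        Finset.sdiff_inter_self_right, hy, Finset.sum_singleton]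
    have hxy : e x = e y := by
      have := hX.2.trans hY.2.symm
      rw [hfX, hfY] at this
      exact add_right_cancel this
    have hxy := e.injective hxy
    have hx' : x ∈ X \ Y := by rw [hx]; simp
    have hy' : y ∈ Y \ X := by rw [hy]; simp
    rw [Finset.mem_sdiff] at hx' hy'
    exact hx'.2 (hxy ▸ hy'.1)
  · calc U.card = ∑ d : ZMod n, (U.filter (fun X => f X = d)).card :=
          Finset.card_eq_sum_card_fiberwise fun _ _ => Finset.mem_coe.2 (Finset.mem_univ _)
      _ ≤ ∑ _d : ZMod n, (U.filter (fun X => f X = c)).card := Finset.sum_le_sum hc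
      _ = _ := by rw [Finset.sum_const, Finset.card_univ, hn, smul_eq_mul]

end Stable

/-! ### Describing matroids by covers and stable sets -/

section Describe

variable {α : Type*} [DecidableEq α]

/-- The predicate `P` is the independence predicate of a matroid of rank `r`. -/
structure IsRankIndep (r : ℕ) (P : Finset α → Prop) : Prop where
  mono : ∀ ⦃I J : Finset α⦄, P J → I ⊆ J → P I
  aug : ∀ ⦃I J : Finset α⦄, P I → P J → I.card < J.card → ∃ e ∈ J, e ∉ I ∧ P (insert e I)
  card_le : ∀ ⦃I : Finset α⦄, P I → I.card ≤ r
  exists_card : ∃ B, P B ∧ B.card = r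

namespace IsRankIndep

variable {r : ℕ} {P Q : Finset α → Prop}

lemma exists_extension (h : IsRankIndep r P) {I J : Finset α} (hI : P I) (hJ : P J)
    (hc : I.card ≤ J.card) : ∃ K, I ⊆ K ∧ K ⊆ I ∪ J ∧ P K ∧ K.card = J.card := by
  obtain ⟨k, hk⟩ := Nat.exists_eq_add_of_le hc
  induction k generalizing I with
  | zero => exact ⟨I, subset_rfl, Finset.subset_union_left, hI, by omega⟩
  | succ k ih =>
    obtain ⟨e, heJ, heI, he⟩ := h.aug hI hJ (by omega)
    have hcard := Finset.card_insert_of_notMem heI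
    obtain ⟨K, h1, h2, h3, h4⟩ := ih he (by omega) (by omega)
    refine ⟨K, (Finset.subset_insert _ _).trans h1, h2.trans ?_, h3, h4⟩
    intro x hx
    simp only [Finset.mem_union, Finset.mem_insert] at hx ⊢
    rcases hx with (rfl | hx) | hx
    · exact Or.inr heJ
    · exact Or.inl hx
    · exact Or.inr hx

lemma exists_superset_card (h : IsRankIndep r P) {I : Finset α} (hI : P I) :
    ∃ B, I ⊆ B ∧ P B ∧ B.card = r := by
  obtain ⟨B, hB, hBr⟩ := h.exists_card
  obtain ⟨K, h1, -, h3, h4⟩ := h.exists_extension hI hB (hBr ▸ h.card_le hI)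
  exact ⟨K, h1, h3, h4.trans hBr⟩

lemma eq_of_forall_card (hP : IsRankIndep r P) (hQ : IsRankIndep r Q)
    (h : ∀ X : Finset α, X.card = r → (P X ↔ Q X)) : P = Q := by
  ext X
  constructor
  · intro hX
    obtain ⟨B, h1, h2, h3⟩ := hP.exists_superset_card hX
    exact hQ.mono ((h B h3).1 h2) h1
  · intro hX
    obtain ⟨B, h1, h2, h3⟩ := hQ.exists_superset_card hX
    exact hP.mono ((h B h3).2 h2) h1

open scoped Classical in
/-- The fundamental circuit of a set of nullity one is dependent. -/
lemma not_circuit (h : IsRankIndep r P) {V : Finset α} (hV : ¬ P V) {x : α} (hx : x ∈ V)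
    (hVx : P (V.erase x)) : ¬ P (V.filter fun y => P (V.erase y)) := by
  intro hC
  set C := V.filter fun y => P (V.erase y) with hCdef
  have hCV : C ⊆ V := Finset.filter_subset _ _
  have hne : C ≠ V := fun h' => hV (h' ▸ hC)
  have hlt : C.card < V.card := Finset.card_lt_card (lt_of_le_of_ne hCV hne)
  have hcx := Finset.card_erase_of_mem hx
  -- K contains C and omits exactly one element z of V. Then V - z = K is independent, which puts z
  -- into C, a contradiction.
  obtain ⟨K, h1, h2, h3, h4⟩ := h.exists_extension hC hVx (by omega)
  have hKV : K ⊆ V := h2.trans (Finset.union_subset hCV (Finset.erase_subset _ _))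
  have h5 : (V \ K).card = 1 := by
    rw [Finset.card_sdiff_of_subset hKV]; omega
  obtain ⟨z, hz⟩ := Finset.card_eq_one.1 h5
  have hzV : z ∈ V \ K := by rw [hz]; simp
  rw [Finset.mem_sdiff] at hzV
  have hKz : V.erase z = K := by
    rw [Finset.erase_eq, ← hz, Finset.sdiff_sdiff_eq_self hKV]
  exact hzV.2 (h1 (Finset.mem_filter.2 ⟨hzV.1, by rw [hKz]; exact h3⟩))

end IsRankIndep

/-- The rank of `p.1` is at most `p.2`. -/
def RankPair (P : Finset α → Prop) (p : Finset α × ℕ) : Prop :=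
  ∀ I ⊆ p.1, P I → I.card ≤ p.2

/-- The pair `p`, regarded as a rank bound, shows that `X` is dependent. -/
def PairCovers (p : Finset α × ℕ) (X : Finset α) : Prop := p.2 < (X ∩ p.1).card

lemma RankPair.not_of_covers {r : ℕ} {P : Finset α → Prop} (h : IsRankIndep r P)
    {p : Finset α × ℕ} (hp : RankPair P p) {X : Finset α} (hX : PairCovers p X) : ¬ P X :=
  fun hPX => absurd (hp _ Finset.inter_subset_right (h.mono hPX Finset.inter_subset_left))
    (not_le.2 hX)

variable {r : ℕ} {P Q : Finset α → Prop}

/-- If `P (insert e J)` fails for all `e ∈ F \ J`, then `J` spans `F`. -/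
lemma rankPair_of_spanned (h : IsRankIndep r P) {J F : Finset α} (hJ : P J)
    (hF : ∀ e ∈ F, e ∉ J → ¬ P (insert e J)) : RankPair P (F, J.card) := by
  intro I hIF hI
  by_contra! hlt
  obtain ⟨e, he, heJ, hP⟩ := h.aug hJ hI hlt
  exact hF e (hIF he) heJ hP

lemma rankPair_of_not (P : Finset α → Prop) {X : Finset α} (hX : ¬ P X) :
    RankPair P (X, X.card - 1) := by
  intro I hIX hI
  have : I ≠ X := fun h => hX (h ▸ hI)
  have : I.card < X.card := Finset.card_lt_card (lt_of_le_of_ne hIX this)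
  change I.card ≤ X.card - 1
  omega

/-- All `r`-subsets of `V` are dependent. -/
def DownFull (P : Finset α → Prop) (r : ℕ) (V : Finset α) : Prop :=
  ∀ X ⊆ V, X.card = r → ¬ P X

/-- All `r`-supersets of `W` are dependent. -/
def UpFull (P : Finset α → Prop) (r : ℕ) (W : Finset α) : Prop :=
  ∀ X, W ⊆ X → X.card = r → ¬ P X

lemma DownFull.rankPair (h : IsRankIndep r P) {V : Finset α} (hr : 0 < r)
    (hV : DownFull P r V) : RankPair P (V, r - 1) := by
  intro I hIV hI
  change I.card ≤ r - 1
  have h1 : I.card ≠ r := fun h' => hV I hIV h' hI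
  have := h.card_le hI
  omega

lemma UpFull.rankPair (h : IsRankIndep r P) {W : Finset α} (hW : W.card = r - 1)
    (hF : UpFull P r W) : RankPair P (W, r - 2) := by
  have hP : ¬ P W := by
    intro hP
    obtain ⟨B, h1, h2, h3⟩ := h.exists_superset_card hP
    exact hF B h1 h3 h2
  have := rankPair_of_not P hP
  rwa [hW, Nat.sub_sub] at this

lemma card_inter_of_adj {X Y : Finset α} (hX : X.card = r) (h : (X \ Y).card = 1) :
    (X ∩ Y).card = r - 1 := by
  have := Finset.card_sdiff_add_card_inter X Y
  omega

lemma card_union_of_adj {X Y : Finset α} (hY : Y.card = r) (h : (X \ Y).card = 1) :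
    (X ∪ Y).card = r + 1 := by
  have := Finset.card_sdiff_add_card X Y
  omega

lemma card_sdiff_symm {X Y : Finset α} (hX : X.card = r) (hY : Y.card = r) :
    (Y \ X).card = (X \ Y).card := by
  have h3 := Finset.card_sdiff_add_card X Y
  have h4 := Finset.card_sdiff_add_card Y X
  rw [Finset.union_comm] at h4
  omega

/-- Adjacent `r`-sets arise from each other by exchanging an element. -/
lemma exists_exchange {X Y : Finset α} (hX : X.card = r) (hY : Y.card = r)
    (h : (X \ Y).card = 1) : ∃ x ∈ X, x ∉ Y ∧ ∃ y ∈ Y, y ∉ X ∧ Y = insert y (X.erase x) ∧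
      X ∩ Y = X.erase x ∧ X ∪ Y = insert y X := by
  obtain ⟨x, hx⟩ := Finset.card_eq_one.1 h
  obtain ⟨y, hy⟩ := Finset.card_eq_one.1 ((card_sdiff_symm hX hY).trans h)
  have hx' : x ∈ X \ Y := by rw [hx]; simp
  have hy' : y ∈ Y \ X := by rw [hy]; simp
  rw [Finset.mem_sdiff] at hx' hy'
  have h1 : X ∩ Y = X.erase x := by
    rw [Finset.erase_eq, ← hx, sdiff_sdiff_right_self]; rfl
  refine ⟨x, hx'.1, hx'.2, y, hy'.1, hy'.2, ?_, h1, ?_⟩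
  · rw [← h1, Finset.insert_eq, ← hy, Finset.inter_comm, Finset.sdiff_union_inter]
  · rw [Finset.insert_eq, ← hy, Finset.sdiff_union_self_eq_union, Finset.union_comm]

/-- Two adjacent dependent `r`-sets span a maximal clique of dependent `r`-sets. -/
lemma downFull_or_upFull (h : IsRankIndep r P) {X Y : Finset α} (hX : X.card = r)
    (hY : Y.card = r) (hPX : ¬ P X) (hPY : ¬ P Y) (hXY : (X \ Y).card = 1) :
    DownFull P r (X ∪ Y) ∨ UpFull P r (X ∩ Y) := by
  rw [or_iff_not_imp_right]
  intro hW
  simp only [UpFull, not_forall, not_not] at hW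
  obtain ⟨B, hWB, hB, hPB⟩ := hW
  have hPW := h.mono hPB hWB
  have hc := card_inter_of_adj hX hXY
  obtain ⟨x, hx, hxY, y, hy, hyX, hYe, hI, hU⟩ := exists_exchange hX hY hXY
  have hr : 0 < r := hX ▸ Finset.card_pos.2 ⟨x, hx⟩
  -- The independent set X ∩ Y becomes X or Y, both dependent, when any element of X ∪ Y is added;
  -- so it spans X ∪ Y, whose rank is therefore r - 1.
  have : RankPair P (X ∪ Y, (X ∩ Y).card) := by
    refine rankPair_of_spanned h hPW ?_
    intro e he heW hP
    rw [Finset.mem_union] at he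
    rw [hI] at hP heW
    rcases he with he | he
    · have : e = x := by
        by_contra hne
        exact heW (Finset.mem_erase.2 ⟨hne, he⟩)
      rw [this, Finset.insert_erase hx] at hP
      exact hPX hP
    · rw [hYe, Finset.mem_insert] at he
      rcases he with rfl | he
      · exact hPY (hYe ▸ hP)
      · exact heW he
  intro Z hZ hZr hPZ
  have := this Z hZ hPZ
  change Z.card ≤ (X ∩ Y).card at this
  omega

/-- Two rank bounds suffice to show that all dependent neighbors of a given dependent `r`-set
are dependent. -/
lemma exists_local_cover [Fintype α] (h : IsRankIndep r P) (hr : 2 ≤ r) {X : Finset α}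
    (hX : X.card = r) (hPX : ¬ P X) :
    ∃ p q : Finset α × ℕ, (RankPair P p ∧ p.2 ≤ r) ∧ (RankPair P q ∧ q.2 ≤ r) ∧
      ∀ Y : Finset α, Y.card = r → ¬ P Y → (X \ Y).card = 1 → PairCovers p Y ∨ PairCovers q Y := by
  classical
  by_cases hJ : ∃ x ∈ X, P (X.erase x)
  · obtain ⟨x, hx, hPx⟩ := hJ
    have hcx := Finset.card_erase_of_mem hx
    set J := X.erase x with hJdef
    -- F is the closure of J = X - x, of rank r - 1, and C is the circuit in X. A dependent neighbor
    -- Y = X - a + y lies in F if y does, and otherwise contains C.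
    set F : Finset α := Finset.univ.filter fun y => y ∈ J ∨ ¬ P (insert y J) with hF
    set C := X.filter fun y => P (X.erase y) with hC
    have hCcard : C.card ≤ r := hX ▸ Finset.card_le_card (Finset.filter_subset _ _)
    have hxC : x ∈ C := Finset.mem_filter.2 ⟨hx, hPx⟩
    refine ⟨(F, J.card), (C, C.card - 1), ⟨rankPair_of_spanned h hPx ?_, by simp only; omega⟩,
      ⟨rankPair_of_not P (h.not_circuit hPX hx hPx), by simp only; omega⟩, ?_⟩
    · intro e he heJ
      rw [hF, Finset.mem_filter] at he
      exact he.2.resolve_left heJ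
    · intro Y hY hPY hXY
      obtain ⟨a, ha, haY, y, hy, hyX, hYe, hI, -⟩ := exists_exchange hX hY hXY
      by_cases hyF : y ∈ F
      · left
        have : Y ⊆ F := by
          intro z hz
          rw [hYe, Finset.mem_insert] at hz
          rcases hz with rfl | hz
          · exact hyF
          · rw [hF, Finset.mem_filter]
            refine ⟨Finset.mem_univ _, ?_⟩
            by_cases hzx : z = x
            · right
              rw [hzx, hJdef, Finset.insert_erase hx]
              exact hPX
            · left
              exact Finset.mem_erase.2 ⟨hzx, Finset.mem_of_mem_erase hz⟩
        simp only [PairCovers, Finset.inter_eq_left.2 this]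
        omega
      · right
        -- If a were in C, then X - a would be independent, and augmenting it from the basis J + y
        -- would make Y or X independent.
        have haC : a ∉ C := by
          intro haC
          have hPa : P (X.erase a) := (Finset.mem_filter.1 haC).2
          simp only [hF, Finset.mem_filter, Finset.mem_univ, true_and, not_or, not_not] at hyF
          have hca := Finset.card_erase_of_mem ha
          have hcy := Finset.card_insert_of_notMem hyF.1
          obtain ⟨e, he, hea, hPe⟩ := h.aug hPa hyF.2 (by omega)
          rw [Finset.mem_insert] at he
          rcases he with rfl | he
          · exact hPY (hYe ▸ hPe)
          · have : e = a := by
              by_contra hne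
              exact hea (Finset.mem_erase.2 ⟨hne, Finset.mem_of_mem_erase he⟩)
            rw [this, Finset.insert_erase ha] at hPe
            exact hPX hPe
        have : C ⊆ Y := by
          intro z hz
          rw [hYe, Finset.mem_insert]
          right
          exact Finset.mem_erase.2 ⟨fun h' => haC (h' ▸ hz), (Finset.mem_filter.1 hz).1⟩
        have hpos : 0 < C.card := Finset.card_pos.2 ⟨x, hxC⟩
        simp only [PairCovers, Finset.inter_eq_right.2 this]
        omega
  · push Not at hJ
    -- Now X has rank at most r - 2 while every neighbor meets X in r - 1 elements, so one bound,
    -- listed twice, is enough.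
    have hp : RankPair P (X, r - 2) := by
      intro I hI hPI
      change I.card ≤ r - 2
      by_contra! hlt
      have hIX : I ≠ X := fun h' => hPX (h' ▸ hPI)
      have hlt' : I.card < X.card := Finset.card_lt_card (lt_of_le_of_ne hI hIX)
      have hs : (X \ I).card = 1 := by
        have := Finset.card_sdiff_of_subset (show I ⊆ X from hI)
        omega
      obtain ⟨z, hz⟩ := Finset.card_eq_one.1 hs
      have hzX : z ∈ X \ I := by rw [hz]; simp
      refine hJ z (Finset.mem_sdiff.1 hzX).1 ?_
      rwa [Finset.erase_eq, ← hz, Finset.sdiff_sdiff_eq_self hI]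
    refine ⟨(X, r - 2), (X, r - 2), ⟨hp, by simp only; omega⟩, ⟨hp, by simp only; omega⟩, ?_⟩
    intro Y hY _ hXY
    left
    have := card_inter_of_adj hX hXY
    rw [Finset.inter_comm] at this
    simp only [PairCovers]
    omega

/-- The greedy covering argument. -/
lemma exists_greedy_cover {ι β : Type*} [DecidableEq ι] (c : ι → β → Prop) (ok : ι → Prop) (d : ℕ)
    (U : Finset β) : ∃ Z : Finset ι, (∀ z ∈ Z, ok z) ∧ Z.card * d ≤ U.card ∧
      ∀ z, ok z → ∀ S ⊆ U, (∀ x ∈ S, c z x ∧ ∀ z' ∈ Z, ¬ c z' x) → S.card < d + 1 := by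
  classical
  induction U using Finset.strongInduction with
  | H U ih =>
  -- As long as an admissible z covers more than d of the remaining elements, pick it and discard
  -- what it covers.
  by_cases hU : ∃ z, ok z ∧ d + 1 ≤ (U.filter (c z)).card
  · obtain ⟨z, hz, hd⟩ := hU
    have hcard := Finset.card_filter_add_card_filter_not (s := U) (c z)
    obtain ⟨Z, h1, h2, h3⟩ := ih (U.filter fun x => ¬ c z x) (by
      refine lt_of_le_of_ne (Finset.filter_subset _ _) fun h => ?_
      rw [h] at hcard
      omega)
    refine ⟨insert z Z, ?_, ?_, ?_⟩
    · intro w hw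
      rcases Finset.mem_insert.1 hw with rfl | hw
      · exact hz
      · exact h1 w hw
    · have := Finset.card_insert_le z Z
      have := Nat.mul_le_mul_right d this
      rw [Nat.add_mul] at this
      omega
    · intro w hw S hS hSc
      refine h3 w hw S ?_ ?_
      · intro x hx
        exact Finset.mem_filter.2 ⟨hS hx, (hSc x hx).2 z (Finset.mem_insert_self _ _)⟩
      · intro x hx
        exact ⟨(hSc x hx).1, fun z' hz' => (hSc x hx).2 z' (Finset.mem_insert_of_mem hz')⟩
  · push Not at hU
    refine ⟨∅, by simp, by simp, ?_⟩
    intro z hz S hS hSc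
    refine lt_of_le_of_lt (Finset.card_le_card ?_) (hU z hz)
    intro x hx
    exact Finset.mem_filter.2 ⟨hS hx, (hSc x hx).1⟩

open scoped Classical in
/-- The dependent sets with at most `t` elements. -/
noncomputable def smallDep [Fintype α] (P : Finset α → Prop) (t : ℕ) : Finset (Finset α) :=
  Finset.univ.filter fun C => C.card ≤ t ∧ ¬ P C

open scoped Classical in
/-- The sets with at most `t` elements that meet all bases. -/
noncomputable def smallCodep [Fintype α] (P : Finset α → Prop) (r t : ℕ) :
    Finset (Finset α) :=
  Finset.univ.filter fun D => D.card ≤ t ∧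
    ∀ B : Finset α, B.card = r → P B → ¬ Disjoint D B

/-- The set `X` is seen to be dependent from the rank bounds `Z`, the dependent sets `S` or the
codependent sets `T`. -/
def DataCovers (Z : Finset (Finset α × ℕ)) (S T : Finset (Finset α)) (X : Finset α) : Prop :=
  (∃ p ∈ Z, PairCovers p X) ∨ (∃ C ∈ S, C ⊆ X) ∨ ∃ D ∈ T, Disjoint D X

open scoped Classical in
/-- The dependent `r`-sets that are not covered by the rank bounds `Z` or by small dependent or
codependent sets. -/
noncomputable def uncovered [Fintype α] (P : Finset α → Prop) (r t : ℕ)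
    (Z : Finset (Finset α × ℕ)) : Finset (Finset α) :=
  (Finset.powersetCard r Finset.univ).filter fun X =>
    ¬ P X ∧ ¬ DataCovers Z (smallDep P t) (smallCodep P r t) X

lemma mem_uncovered [Fintype α] {t : ℕ} {Z : Finset (Finset α × ℕ)} {X : Finset α} :
    X ∈ uncovered P r t Z ↔ X.card = r ∧ ¬ P X ∧
      ¬ DataCovers Z (smallDep P t) (smallCodep P r t) X := by
  classical
  simp [uncovered]

lemma mem_smallDep [Fintype α] {t : ℕ} {C : Finset α} :
    C ∈ smallDep P t ↔ C.card ≤ t ∧ ¬ P C := by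
  classical
  simp [smallDep]

lemma mem_smallCodep [Fintype α] {t : ℕ} {D : Finset α} :
    D ∈ smallCodep P r t ↔ D.card ≤ t ∧
      ∀ B : Finset α, B.card = r → P B → ¬ Disjoint D B := by
  classical
  simp [smallCodep]

/-- The rank bounds `Z` form a good cover: they are valid, and all cliques of dependent `r`-sets
have at most `t` uncovered members. -/
structure IsGoodCover [Fintype α] (P : Finset α → Prop) (r t : ℕ) (Z : Finset (Finset α × ℕ)) :
    Prop where
  valid : ∀ p ∈ Z, RankPair P p ∧ p.2 ≤ r
  down : ∀ V : Finset α, V.card = r + 1 → DownFull P r V →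
    ∀ S ⊆ uncovered P r t Z, (∀ X ∈ S, X ⊆ V) → S.card ≤ t
  up : ∀ W : Finset α, W.card = r - 1 → UpFull P r W →
    ∀ S ⊆ uncovered P r t Z, (∀ X ∈ S, W ⊆ X) → S.card ≤ t

/-- Used to append the two rank bounds of a prescribed separation: further valid bounds only shrink
the uncovered family. -/
lemma IsGoodCover.union [Fintype α] {t : ℕ} {Z Z' : Finset (Finset α × ℕ)}
    (hZ : IsGoodCover P r t Z) (hZ' : ∀ p ∈ Z', RankPair P p ∧ p.2 ≤ r) :
    IsGoodCover P r t (Z ∪ Z') := by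
  have hsub : uncovered P r t (Z ∪ Z') ⊆ uncovered P r t Z := by
    intro X hX
    rw [mem_uncovered] at hX ⊢
    refine ⟨hX.1, hX.2.1, fun h => hX.2.2 ?_⟩
    rcases h with ⟨p, hp, h⟩ | h
    · exact Or.inl ⟨p, Finset.mem_union_left _ hp, h⟩
    · exact Or.inr h
  refine ⟨?_, fun V h1 h2 S hS => hZ.down V h1 h2 S (hS.trans hsub),
    fun W h1 h2 S hS => hZ.up W h1 h2 S (hS.trans hsub)⟩
  intro p hp
  rcases Finset.mem_union.1 hp with hp | hp
  · exact hZ.valid p hp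
  · exact hZ' p hp

/-- The existence of small good covers. -/
theorem exists_isGoodCover [Fintype α] (h : IsRankIndep r P) (hr : 2 ≤ r)
    (d t : ℕ) (m : ℕ)
    (hm : ∀ z₁ z₂ u : ℕ, z₁ * d ≤ (Fintype.card α).choose r →
      (Fintype.card α - r) * (r + 1) * u ≤
        (d + (Fintype.card α - r)) * (Fintype.card α).choose r →
      z₂ * t ≤ u → 2 * z₁ + z₂ ≤ m) :
    ∃ Z : Finset (Finset α × ℕ), Z.card ≤ m ∧ IsGoodCover P r t Z := by
  classical
  set K : Finset (Finset α) := (Finset.powersetCard r Finset.univ).filter fun X => ¬ P X with hK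
  have memK : ∀ X, X ∈ K ↔ X.card = r ∧ ¬ P X := by simp [hK]
  -- First round, with pairs of rank bounds. By `exists_local_cover` one admissible pair covers all
  -- dependent neighbors of a given set, so afterwards the surviving family U has maximum degree at
  -- most d, and `exists_degree_ge` forces it to be small.
  obtain ⟨Z₁, hZ₁, hZ₁c, hZ₁d⟩ := exists_greedy_cover
    (fun (z : (Finset α × ℕ) × (Finset α × ℕ)) X => PairCovers z.1 X ∨ PairCovers z.2 X)
    (fun z => (RankPair P z.1 ∧ z.1.2 ≤ r) ∧ (RankPair P z.2 ∧ z.2.2 ≤ r)) d K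
  set U := K.filter fun X => ∀ z ∈ Z₁, ¬ (PairCovers z.1 X ∨ PairCovers z.2 X) with hU
  -- Second round, with single rank bounds on U. A full clique is covered by one bound, so at most t
  -- of its members survive.
  obtain ⟨Z₂, hZ₂, hZ₂c, hZ₂d⟩ := exists_greedy_cover
    (fun (z : Finset α × ℕ) X => PairCovers z X)
    (fun z => RankPair P z ∧ z.2 ≤ r) t U
  have hKcard : K.card ≤ (Fintype.card α).choose r := by
    refine (Finset.card_filter_le _ _).trans ?_
    rw [Finset.card_powersetCard, Finset.card_univ]
  have hUcard : (Fintype.card α - r) * (r + 1) * U.card ≤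
        (d + (Fintype.card α - r)) * (Fintype.card α).choose r := by
    rcases U.eq_empty_or_nonempty with h0 | hne
    · simp [h0]
    · obtain ⟨X, hX, hdeg⟩ := exists_degree_ge (Finset.univ : Finset α) r U
        ((Finset.filter_subset _ _).trans (Finset.filter_subset _ _)) hne
      rw [Finset.card_univ] at hdeg
      refine hdeg.trans (Nat.mul_le_mul_right _ (Nat.add_le_add_right ?_ _))
      have hXK := (memK X).1 (Finset.mem_filter.1 hX).1
      obtain ⟨p, q, hp, hq, hpq⟩ := exists_local_cover h hr hXK.1 hXK.2
      refine Nat.lt_succ_iff.1 (hZ₁d (p, q) ⟨hp, hq⟩ (johnsonNeighbors U X) ?_ ?_)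
      · exact (Finset.filter_subset _ _).trans (Finset.filter_subset _ _)
      · intro Y hY
        rw [mem_johnsonNeighbors] at hY
        have hYU := Finset.mem_filter.1 hY.1
        have hYK := (memK Y).1 hYU.1
        exact ⟨hpq Y hYK.1 hYK.2 hY.2, hYU.2⟩
  refine ⟨(Z₁.image Prod.fst ∪ Z₁.image Prod.snd) ∪ Z₂, ?_, ?_, ?_, ?_⟩
  · refine le_trans ?_ (hm Z₁.card Z₂.card U.card (hZ₁c.trans hKcard) hUcard hZ₂c)
    have h1 := Finset.card_union_le (Z₁.image Prod.fst ∪ Z₁.image Prod.snd) Z₂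
    have h2 := Finset.card_union_le (Z₁.image Prod.fst) (Z₁.image Prod.snd)
    have h3 : (Z₁.image Prod.fst).card ≤ Z₁.card := Finset.card_image_le
    have h4 : (Z₁.image Prod.snd).card ≤ Z₁.card := Finset.card_image_le
    omega
  · intro p hp
    simp only [Finset.mem_union, Finset.mem_image] at hp
    rcases hp with (⟨z, hz, rfl⟩ | ⟨z, hz, rfl⟩) | hp
    · exact (hZ₁ z hz).1
    · exact (hZ₁ z hz).2
    · exact hZ₂ p hp
  all_goals
    have hunc : ∀ X ∈ uncovered P r t ((Z₁.image Prod.fst ∪ Z₁.image Prod.snd) ∪ Z₂),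
        X ∈ U ∧ ∀ z ∈ Z₂, ¬ PairCovers z X := by
      intro X hX
      rw [mem_uncovered] at hX
      refine ⟨?_, fun z hz hc => hX.2.2 (Or.inl ⟨z, Finset.mem_union_right _ hz, hc⟩)⟩
      refine Finset.mem_filter.2 ⟨(memK X).2 ⟨hX.1, hX.2.1⟩, ?_⟩
      rintro z hz (hc | hc)
      · exact hX.2.2 (Or.inl ⟨z.1, Finset.mem_union_left _ (Finset.mem_union_left _
          (Finset.mem_image_of_mem _ hz)), hc⟩)
      · exact hX.2.2 (Or.inl ⟨z.2, Finset.mem_union_left _ (Finset.mem_union_right _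
          (Finset.mem_image_of_mem _ hz)), hc⟩)
  · intro V hV hfull S hS hSV
    refine Nat.lt_succ_iff.1 (hZ₂d (V, r - 1) ⟨hfull.rankPair h (by omega), by simp⟩ S
      (fun X hX => (hunc X (hS hX)).1) fun X hX => ⟨?_, (hunc X (hS hX)).2⟩)
    simp only [PairCovers, Finset.inter_eq_left.2 (hSV X hX), (mem_uncovered.1 (hS hX)).1]
    omega
  · intro W hW hfull S hS hSW
    refine Nat.lt_succ_iff.1 (hZ₂d (W, r - 2) ⟨hfull.rankPair h hW, by simp⟩ S
      (fun X hX => (hunc X (hS hX)).1) fun X hX => ⟨?_, (hunc X (hS hX)).2⟩)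
    simp only [PairCovers, Finset.inter_eq_right.2 (hSW X hX), hW]
    omega

/-- The family `I` is a maximal stable subfamily of `U`. -/
def IsMaxStable (U I : Finset (Finset α)) : Prop :=
  I ⊆ U ∧ StableFamily I ∧ ∀ X ∈ U, X ∉ I → ∃ Y ∈ I, (Y \ X).card = 1

/-- A stable family of maximum size works; the common cardinality makes adjacency symmetric. -/
lemma exists_isMaxStable (U : Finset (Finset α)) (hU : ∀ X ∈ U, X.card = r) :
    ∃ I, IsMaxStable U I := by
  obtain ⟨I, hI, hmax⟩ := (stableSubfamilies U).exists_max_image Finset.card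
    ⟨∅, mem_stableSubfamilies.2 ⟨by simp, stableFamily_empty⟩⟩
  obtain ⟨hIU, hIs⟩ := mem_stableSubfamilies.1 hI
  refine ⟨I, hIU, hIs, ?_⟩
  intro X hX hXI
  by_contra! hno
  have : insert X I ∈ stableSubfamilies U := by
    refine mem_stableSubfamilies.2 ⟨Finset.insert_subset hX hIU, ?_⟩
    intro A hA B hB
    rcases Finset.mem_insert.1 hA with rfl | hA' <;> rcases Finset.mem_insert.1 hB with rfl | hB'
    · simp
    · rw [card_sdiff_symm (hU B (hIU hB')) (hU A hX)]
      exact hno B hB'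
    · exact hno A hA'
    · exact hIs A hA' B hB'
  have := hmax _ this
  rw [Finset.card_insert_of_notMem hXI] at this
  omega

/-- The description determines the dependent `r`-sets. -/
lemma dep_of_description [Fintype α] {t : ℕ} (hP : IsRankIndep r P) (hQ : IsRankIndep r Q)
    {Z : Finset (Finset α × ℕ)} {I : Finset (Finset α)} (hZP : IsGoodCover P r t Z)
    (hZQ : ∀ p ∈ Z, RankPair Q p) (hS : smallDep P t = smallDep Q t)
    (hT : smallCodep P r t = smallCodep Q r t) (hIP : IsMaxStable (uncovered P r t Z) I)
    (hIQ : I ⊆ uncovered Q r t Z) {Y : Finset α} (hY : Y.card = r) (hPY : ¬ P Y) : ¬ Q Y := by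
  classical
  intro hQY
  -- The shared data are valid for Q as well, so no basis of Q is covered.
  have hcov : ∀ X, X.card = r → Q X → ¬ DataCovers Z (smallDep P t) (smallCodep P r t) X := by
    rintro X hXr hQX (⟨p, hp, hc⟩ | ⟨C, hC, hCX⟩ | ⟨D, hD, hDX⟩)
    · exact (hZQ p hp).not_of_covers hQ hc hQX
    · rw [hS, mem_smallDep] at hC
      exact hC.2 (hQ.mono hQX hCX)
    · rw [hT, mem_smallCodep] at hD
      exact hD.2 X hXr hQX hDX
  have hYU : Y ∈ uncovered P r t Z := mem_uncovered.2 ⟨hY, hPY, hcov Y hY hQY⟩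
  have hYI : Y ∉ I := fun h => (mem_uncovered.1 (hIQ h)).2.1 hQY
  -- Maximality of I supplies a neighbor X of Y that is uncovered and dependent in both matroids. In
  -- P, the sets X and Y then span a full clique of dependent sets.
  obtain ⟨X, hXI, hXY⟩ := hIP.2.2 Y hYU hYI
  obtain ⟨hX, hPX, hXcov⟩ := mem_uncovered.1 (hIP.1 hXI)
  have hQX := (mem_uncovered.1 (hIQ hXI)).2.1
  obtain ⟨x, hx, hxY, y, hy, hyX, hYe, hI, hU⟩ := exists_exchange hX hY hXY
  rcases downFull_or_upFull hP hX hY hPX hPY hXY with hfull | hfull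
  · set V := X ∪ Y with hV
    have hVc : V.card = r + 1 := card_union_of_adj hY hXY
    have hQV : ¬ Q V := fun h => by have := hQ.card_le h; omega
    have hVx : V.erase x = Y := by
      rw [hU, hYe, Finset.erase_insert_of_ne]
      rintro rfl
      exact hyX hx
    have hVy : V.erase y = X := by rw [hU, Finset.erase_insert hyX]
    have hxV : x ∈ V := Finset.mem_union_left _ hx
    -- C is the circuit of Q in V. For z in C, V - z is a basis of Q and so an uncovered member of
    -- the clique; hence C has at most t elements and belongs to the shared data. But C lies in X,
    -- which is uncovered.
    set C := V.filter fun z => Q (V.erase z) with hC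
    have hQC : ¬ Q C := hQ.not_circuit hQV hxV (hVx.symm ▸ hQY)
    have hCcard : C.card ≤ t := by
      have hinj : Set.InjOn (fun z => V.erase z) C := by
        intro a ha b hb hab
        by_contra hne
        have haV := (Finset.mem_filter.1 (Finset.mem_coe.1 ha)).1
        have : a ∈ V.erase b := Finset.mem_erase.2 ⟨hne, haV⟩
        have hab : V.erase a = V.erase b := hab
        rw [← hab] at this
        simp at this
      rw [← Finset.card_image_of_injOn hinj]
      refine hZP.down V hVc hfull _ ?_ ?_
      · intro A hA
        obtain ⟨z, hz, rfl⟩ := Finset.mem_image.1 hA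
        obtain ⟨hzV, hQz⟩ := Finset.mem_filter.1 hz
        have hc : (V.erase z).card = r := by rw [Finset.card_erase_of_mem hzV]; omega
        exact mem_uncovered.2 ⟨hc, hfull _ (Finset.erase_subset _ _) hc, hcov _ hc hQz⟩
      · intro A hA
        obtain ⟨z, hz, rfl⟩ := Finset.mem_image.1 hA
        exact Finset.erase_subset _ _
    refine hXcov (Or.inr (Or.inl ⟨C, ?_, ?_⟩))
    · rw [hS, mem_smallDep]
      exact ⟨hCcard, hQC⟩
    · rw [← hVy]
      intro z hz
      refine Finset.mem_erase.2 ⟨?_, (Finset.mem_filter.1 hz).1⟩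
      rintro rfl
      exact hQX (hVy ▸ (Finset.mem_filter.1 hz).2)
  · set W := X ∩ Y with hW
    have hWc : W.card = r - 1 := card_inter_of_adj hX hXY
    have hr : 0 < r := hX ▸ Finset.card_pos.2 ⟨x, hx⟩
    -- The dual argument: D is the complement of the hyperplane of Q spanned by W, that is, a
    -- cocircuit of Q, and it is disjoint from X.
    set D := Finset.univ.filter fun z => z ∉ W ∧ Q (insert z W) with hD
    have hDcard : D.card ≤ t := by
      have hinj : Set.InjOn (fun z => insert z W) D := by
        intro a ha b hb hab
        have haW := (Finset.mem_filter.1 (Finset.mem_coe.1 ha)).2.1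
        have : a ∈ insert b W := by
          have hab : insert a W = insert b W := hab
          rw [← hab]; simp
        exact (Finset.mem_insert.1 this).resolve_right haW
      rw [← Finset.card_image_of_injOn hinj]
      refine hZP.up W hWc hfull _ ?_ ?_
      · intro A hA
        obtain ⟨z, hz, rfl⟩ := Finset.mem_image.1 hA
        obtain ⟨-, hzW, hQz⟩ := Finset.mem_filter.1 hz
        have hc : (insert z W).card = r := by rw [Finset.card_insert_of_notMem hzW]; omega
        exact mem_uncovered.2 ⟨hc, hfull _ (Finset.subset_insert _ _) hc, hcov _ hc hQz⟩
      · intro A hA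
        obtain ⟨z, hz, rfl⟩ := Finset.mem_image.1 hA
        exact Finset.subset_insert _ _
    refine hXcov (Or.inr (Or.inr ⟨D, ?_, ?_⟩))
    · rw [hT, mem_smallCodep]
      refine ⟨hDcard, fun B hB hQB hdisj => ?_⟩
      have hQW : Q W := hQ.mono hQY Finset.inter_subset_right
      obtain ⟨e, heB, heW, hQe⟩ := hQ.aug hQW hQB (by omega)
      exact Finset.disjoint_left.1 hdisj
        (Finset.mem_filter.2 ⟨Finset.mem_univ _, heW, hQe⟩) heB
    · rw [Finset.disjoint_left]
      intro z hz hzX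
      obtain ⟨-, hzW, hQz⟩ := Finset.mem_filter.1 hz
      have hzx : z = x := by
        by_contra hne
        exact hzW (by rw [hI]; exact Finset.mem_erase.2 ⟨hne, hzX⟩)
      rw [hzx, hI, Finset.insert_erase hx] at hQz
      exact hQX hQz

end Describe

/-! ### Counting matroids -/

section Counting

variable {α : Type*} [DecidableEq α] [Fintype α]

/-- The independence predicate of a matroid on finsets. -/
def Matroid.FIndep {α : Type*} (M : Matroid α) (X : Finset α) : Prop := M.Indep (X : Set α)

/-- The matroids of rank `r` on a finite type. -/
def matroidsOfRank (α : Type*) (r : ℕ) : Set (Matroid α) :=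
  {M | M.E = Set.univ ∧ M.eRank = r}

lemma finite_setOf_ground_eq_univ : {M : Matroid α | M.E = Set.univ}.Finite := by
  refine Set.Finite.of_finite_image (f := fun M => {B | M.IsBase B}) (Set.toFinite _) ?_
  intro M hM N hN h
  refine Matroid.ext_isBase (hM.trans hN.symm) fun B _ => ?_
  exact Set.ext_iff.1 h B

lemma finite_matroidsOfRank (r : ℕ) : (matroidsOfRank α r).Finite :=
  finite_setOf_ground_eq_univ.subset fun _ h => h.1

lemma isRankIndep_of_mem {r : ℕ} {M : Matroid α} (hM : M ∈ matroidsOfRank α r) :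
    IsRankIndep r M.FIndep where
  mono I J hJ h := hJ.subset (by exact_mod_cast h)
  aug I J hI hJ h := by
    obtain ⟨e, he, hP⟩ := hI.augment hJ (by
      rw [Set.encard_coe_eq_coe_finsetCard, Set.encard_coe_eq_coe_finsetCard]
      exact_mod_cast h)
    refine ⟨e, he.1, he.2, ?_⟩
    simpa [Matroid.FIndep] using hP
  card_le I hI := by
    have := hI.encard_le_eRank
    rw [hM.2, Set.encard_coe_eq_coe_finsetCard] at this
    exact_mod_cast this
  exists_card := by
    obtain ⟨B, hB⟩ := M.exists_isBase
    have hfin := Set.toFinite B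
    refine ⟨hfin.toFinset, ?_, ?_⟩
    · simpa [Matroid.FIndep] using hB.indep
    · have := hB.encard_eq_eRank
      rw [hM.2, hfin.encard_eq_coe_toFinset_card] at this
      exact_mod_cast this

lemma eq_of_findep_eq {M N : Matroid α} (hM : M.E = Set.univ) (hN : N.E = Set.univ)
    (h : M.FIndep = N.FIndep) : M = N := by
  refine Matroid.ext_indep (hM.trans hN.symm) fun I _ => ?_
  have := congrFun h (Set.toFinite I).toFinset
  simp only [Matroid.FIndep, Set.Finite.coe_toFinset, eq_iff_iff] at this
  exact this

/-- The number of sets of at most `m` rank bounds. -/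
def numCovers (α : Type*) [Fintype α] [DecidableEq α] (r m : ℕ) : ℕ :=
  (((Finset.univ : Finset (Finset α)) ×ˢ Finset.range (r + 1)).powerset.filter
    fun Z => Z.card ≤ m).card

/-- The number of sets with at most `t` elements. -/
def numSmall (α : Type*) [Fintype α] [DecidableEq α] (t : ℕ) : ℕ :=
  ((Finset.univ : Finset (Finset α)).filter fun C => C.card ≤ t).card

/-- The number of matroids in a class with small good covers is bounded in terms of the number of
stable families among the uncovered sets. -/
theorem ncard_le_of_isGoodCover {r t m : ℕ} {U : Finset (Finset α)} {S : Set (Matroid α)}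
    (hS : S ⊆ matroidsOfRank α r)
    (h : ∀ M ∈ S, ∃ Z, Z.card ≤ m ∧ IsGoodCover M.FIndep r t Z ∧
      uncovered M.FIndep r t Z ⊆ U) :
    S.ncard ≤ numCovers α r m * (2 ^ numSmall α t * 2 ^ numSmall α t * numStable U) := by
  classical
  choose! Z hZm hZ hZU using h
  have hI : ∀ M : Matroid α, ∃ I, IsMaxStable (uncovered M.FIndep r t (Z M)) I := fun M =>
    exists_isMaxStable _ fun X hX => (mem_uncovered.1 hX).1
  choose I hI using hI
  let T : Finset ((Finset (Finset α × ℕ)) × ((Finset (Finset α) × Finset (Finset α)) ×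
      Finset (Finset α))) :=
    (((Finset.univ : Finset (Finset α)) ×ˢ Finset.range (r + 1)).powerset.filter
      fun Z => Z.card ≤ m) ×ˢ
    ((((Finset.univ : Finset (Finset α)).filter fun C => C.card ≤ t).powerset ×ˢ
      ((Finset.univ : Finset (Finset α)).filter fun C => C.card ≤ t).powerset) ×ˢ
      stableSubfamilies U)
  have hT : T.card = numCovers α r m * (2 ^ numSmall α t * 2 ^ numSmall α t * numStable U) := by
    simp only [T, Finset.card_product, Finset.card_powerset]
    rfl
  rw [← hT, ← Set.ncard_coe_finset]
  refine Set.ncard_le_ncard_of_injOn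
    (fun M => (Z M, ((smallDep M.FIndep t, smallCodep M.FIndep r t), I M))) ?_ ?_
    (Finset.finite_toSet _)
  · intro M hM
    simp only [T, Finset.mem_coe, Finset.mem_product, Finset.mem_filter, Finset.mem_powerset,
      mem_stableSubfamilies]
    refine ⟨⟨?_, hZm M hM⟩, ⟨?_, ?_⟩, (hI M).1.trans (hZU M hM), (hI M).2.1⟩
    · intro p hp
      have := ((hZ M hM).valid p hp).2
      simp only [Finset.mem_product, Finset.mem_univ, Finset.mem_range, true_and]
      omega
    · intro C hC
      rw [mem_smallDep] at hC
      simp [hC.1]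
    · intro C hC
      rw [mem_smallCodep] at hC
      simp [hC.1]
  -- Equal descriptions force the same dependent r-sets, by `dep_of_description` in both directions.
  · intro M hM N hN heq
    simp only [Prod.mk.injEq] at heq
    obtain ⟨h1, ⟨h2, h3⟩, h4⟩ := heq
    have hPM := isRankIndep_of_mem (hS hM)
    have hPN := isRankIndep_of_mem (hS hN)
    refine eq_of_findep_eq (hS hM).1 (hS hN).1 (hPM.eq_of_forall_card hPN fun X hX => ?_)
    rw [← not_iff_not]
    constructor
    · refine dep_of_description hPM hPN (hZ M hM) ?_ h2 h3 (hI M) ?_ hX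
      · rw [h1]; exact fun p hp => ((hZ N hN).valid p hp).1
      · rw [h1, h4]; exact (hI N).1
    · refine dep_of_description hPN hPM (hZ N hN) ?_ h2.symm h3.symm (hI N) ?_ hX
      · rw [← h1]; exact fun p hp => ((hZ M hM).valid p hp).1
      · rw [← h1, ← h4]; exact (hI M).1

/-- A matroid of rank `r` is determined by its bases. -/
lemma ncard_matroidsOfRank_le (r : ℕ) :
    (matroidsOfRank α r).ncard ≤ 2 ^ (Fintype.card α).choose r := by
  classical
  have : (Fintype.card α).choose r =
      (Finset.powersetCard r (Finset.univ : Finset α)).card := by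
    rw [Finset.card_powersetCard, Finset.card_univ]
  rw [this, ← Finset.card_powerset, ← Set.ncard_coe_finset]
  refine Set.ncard_le_ncard_of_injOn
    (fun M => (Finset.powersetCard r Finset.univ).filter fun X => M.FIndep X) ?_ ?_
    (Finset.finite_toSet _)
  · intro M _
    exact Finset.mem_coe.2 (Finset.mem_powerset.2 (Finset.filter_subset _ _))
  · intro M hM N hN heq
    refine eq_of_findep_eq hM.1 hN.1 ((isRankIndep_of_mem hM).eq_of_forall_card
      (isRankIndep_of_mem hN) fun X hX => ?_)
    have := Finset.ext_iff.1 heq X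
    simpa [hX] using this

/-! ### Lower bound: sparse paving matroids from stable families. -/

/-- The bases of the sparse paving matroid whose circuit-hyperplanes are the members of `I`. -/
def SparsePavingBase (r : ℕ) (I : Finset (Finset α)) (B : Set α) : Prop :=
  ∃ X : Finset α, (X : Set α) = B ∧ X.card = r ∧ X ∉ I

lemma exists_sparsePavingBase {r : ℕ} (hr : 0 < r) (hrn : r < Fintype.card α)
    {I : Finset (Finset α)} (hI : StableFamily I) : ∃ B, SparsePavingBase r I B := by
  obtain ⟨X, -, hX⟩ := Finset.exists_subset_card_eq (s := (Finset.univ : Finset α)) (n := r)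
    (by rw [Finset.card_univ]; omega)
  by_cases hXI : X ∈ I
  · obtain ⟨x, hx⟩ := Finset.card_pos.1 (hX ▸ hr)
    obtain ⟨y, hy⟩ : ∃ y, y ∉ X := by
      by_contra! h
      have := Finset.card_le_card (show Finset.univ ⊆ X from fun z _ => h z)
      rw [Finset.card_univ] at this
      omega
    have hyx : y ∉ X.erase x := fun h => hy (Finset.mem_of_mem_erase h)
    have hc : (insert y (X.erase x)).card = r := by
      rw [Finset.card_insert_of_notMem hyx, Finset.card_erase_of_mem hx]; omega
    refine ⟨_, insert y (X.erase x), rfl, hc, fun h => hI X hXI _ h ?_⟩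
    rw [Finset.card_eq_one]
    refine ⟨x, ?_⟩
    ext z
    simp only [Finset.mem_sdiff, Finset.mem_insert, Finset.mem_erase, Finset.mem_singleton]
    constructor
    · rintro ⟨h1, h2⟩
      by_contra hne
      exact h2 (Or.inr ⟨hne, h1⟩)
    · rintro rfl
      refine ⟨hx, ?_⟩
      rintro (rfl | h)
      · exact hy hx
      · exact h.1 rfl
  · exact ⟨X, X, rfl, hX, hXI⟩

lemma sparsePavingBase_exchange {r : ℕ} {I : Finset (Finset α)} (hI : StableFamily I) :
    Matroid.ExchangeProperty (SparsePavingBase r I) := by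
  rintro _ _ ⟨X, rfl, hX, hXI⟩ ⟨Y, rfl, hY, hYI⟩ a ⟨haX, haY⟩
  rw [Finset.mem_coe] at haX haY
  have hcard := card_sdiff_symm hX hY
  -- If X and Y are adjacent, the exchange produces Y itself. Otherwise two candidates X - a + b and
  -- X - a + c are adjacent to each other, so they cannot both lie in I.
  have key : ∃ b ∈ Y \ X, insert b (X.erase a) ∉ I := by
    by_contra! h
    by_cases h1 : (Y \ X).card = 1
    · obtain ⟨x, hx, hxY, y, hy, hyX, hYe, -, -⟩ := exists_exchange hX hY (hcard ▸ h1)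
      have hax : a = x := by
        by_contra hne
        apply haY
        rw [hYe]
        exact Finset.mem_insert_of_mem (Finset.mem_erase.2 ⟨hne, haX⟩)
      apply hYI
      rw [hYe, ← hax]
      exact h y (Finset.mem_sdiff.2 ⟨hy, hyX⟩)
    · have : 0 < (X \ Y).card := Finset.card_pos.2 ⟨a, Finset.mem_sdiff.2 ⟨haX, haY⟩⟩
      obtain ⟨b, hb, c, hc, hbc⟩ := Finset.one_lt_card.1 (show 1 < (Y \ X).card by omega)
      refine hI _ (h b hb) _ (h c hc) (Finset.card_eq_one.2 ⟨b, ?_⟩)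
      rw [Finset.mem_sdiff] at hb hc
      ext z
      simp only [Finset.mem_sdiff, Finset.mem_insert, Finset.mem_erase, Finset.mem_singleton,
        not_or]
      constructor
      · rintro ⟨h1 | h1, h2, h3⟩
        · exact h1
        · exact absurd h1 h3
      · rintro rfl
        exact ⟨Or.inl rfl, hbc, fun h' => hb.2 h'.2⟩
  obtain ⟨b, hb, hbI⟩ := key
  rw [Finset.mem_sdiff] at hb
  refine ⟨b, ⟨hb.1, hb.2⟩, insert b (X.erase a), by simp, ?_, hbI⟩
  have := Finset.card_pos.2 ⟨a, haX⟩
  rw [Finset.card_insert_of_notMem (fun h => hb.2 (Finset.mem_of_mem_erase h)),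
    Finset.card_erase_of_mem haX]
  omega

/-- Distinct stable families give distinct sparse paving matroids. -/
theorem numStable_le_ncard_matroidsOfRank {r : ℕ} (hr : 0 < r) (hrn : r < Fintype.card α) :
    numStable (Finset.powersetCard r (Finset.univ : Finset α)) ≤
      (matroidsOfRank α r).ncard := by
  classical
  have hM : ∀ I : Finset (Finset α), ∃ M : Matroid α, StableFamily I →
      M.E = Set.univ ∧ M.IsBase = SparsePavingBase r I := by
    intro I
    by_cases hI : StableFamily I
    · exact ⟨Matroid.ofIsBaseOfFinite (Set.toFinite Set.univ) (SparsePavingBase r I)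
        (exists_sparsePavingBase hr hrn hI) (sparsePavingBase_exchange hI)
        (fun _ _ => Set.subset_univ _), fun _ => ⟨rfl, rfl⟩⟩
    · exact ⟨Matroid.emptyOn α, fun h => absurd h hI⟩
  choose M hM using hM
  rw [numStable, ← Set.ncard_coe_finset]
  refine Set.ncard_le_ncard_of_injOn M ?_ ?_ (finite_matroidsOfRank r)
  · intro I hI
    obtain ⟨hE, hB⟩ := hM I (mem_stableSubfamilies.1 (Finset.mem_coe.1 hI)).2
    refine ⟨hE, ?_⟩
    obtain ⟨B, hB'⟩ := (M I).exists_isBase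
    rw [← hB'.encard_eq_eRank]
    rw [hB] at hB'
    obtain ⟨X, rfl, hX, -⟩ := hB'
    rw [Set.encard_coe_eq_coe_finsetCard, hX]
  · intro I hI J hJ heq
    obtain ⟨hIU, hIs⟩ := mem_stableSubfamilies.1 (Finset.mem_coe.1 hI)
    obtain ⟨hJU, hJs⟩ := mem_stableSubfamilies.1 (Finset.mem_coe.1 hJ)
    have h : SparsePavingBase r I = SparsePavingBase r J := by
      rw [← (hM I hIs).2, ← (hM J hJs).2, heq]
    have key : ∀ K : Finset (Finset α), ∀ X : Finset α, X.card = r →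
        (SparsePavingBase r K (X : Set α) ↔ X ∉ K) := by
      intro K X hX
      constructor
      · rintro ⟨Y, hY, -, hYK⟩
        rwa [← Finset.coe_injective hY]
      · exact fun h => ⟨X, rfl, hX, h⟩
    ext X
    constructor
    · intro hX
      have hXr := (Finset.mem_powersetCard.1 (hIU hX)).2
      by_contra hXJ
      exact (key I X hXr).1 (h ▸ (key J X hXr).2 hXJ) hX
    · intro hX
      have hXr := (Finset.mem_powersetCard.1 (hJU hX)).2
      by_contra hXI
      exact (key J X hXr).1 (h ▸ (key I X hXr).2 hXI) hX

end Counting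

/-! ### Down-closed families -/

section DownClosed

variable {β : Type*} [DecidableEq β]

/-- The number of members of `F` that agree with `I` outside of `S`. -/
def fiberCard (F : Finset (Finset β)) (S I : Finset β) : ℕ :=
  (F.filter fun J => J \ S = I \ S).card

lemma fiberCard_pos {F : Finset (Finset β)} {S I : Finset β} (hI : I ∈ F) :
    0 < fiberCard F S I :=
  Finset.card_pos.2 ⟨I, Finset.mem_filter.2 ⟨hI, rfl⟩⟩

lemma sdiff_eq_sdiff_mono {I J S T : Finset β} (hST : S ⊆ T) (h : J \ S = I \ S) :
    J \ T = I \ T := by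
  ext z
  have e : z ∈ J \ S ↔ z ∈ I \ S := by rw [h]
  have := @hST z
  simp only [Finset.mem_sdiff] at e ⊢
  tauto

lemma fiberCard_mono {F : Finset (Finset β)} {S T I : Finset β} (hST : S ⊆ T) :
    fiberCard F S I ≤ fiberCard F T I := by
  refine Finset.card_le_card fun J hJ => ?_
  rw [Finset.mem_filter] at hJ ⊢
  exact ⟨hJ.1, sdiff_eq_sdiff_mono hST hJ.2⟩

lemma fiberCard_congr {F : Finset (Finset β)} {S I J : Finset β} (h : J \ S = I \ S) :
    fiberCard F S J = fiberCard F S I := by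
  rw [fiberCard, fiberCard, h]

lemma fiberCard_le_card_image (F : Finset (Finset β)) (S I : Finset β) :
    fiberCard F S I ≤ (F.image (· ∩ S)).card := by
  refine Finset.card_le_card_of_injOn (· ∩ S) ?_ ?_
  · intro J hJ
    exact Finset.mem_coe.2 (Finset.mem_image_of_mem _ (Finset.mem_filter.1 hJ).1)
  · intro J hJ K hK h
    have hJ := (Finset.mem_filter.1 hJ).2
    have hK := (Finset.mem_filter.1 hK).2
    have h : J ∩ S = K ∩ S := h
    rw [← Finset.sdiff_union_inter J S, ← Finset.sdiff_union_inter K S, h, hJ, hK]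

/-- Changes inside T do not affect the trace on S, so J and K together determine I; this gives the
uniqueness needed for superadditivity. -/
lemma eq_of_sdiff_eq {S T I J K : Finset β} (hST : Disjoint S T) (h1 : J \ S = I \ S)
    (h2 : K \ T = I \ T) : I = (J \ S) ∪ (K ∩ S) := by
  have h3 : K ∩ S = I ∩ S := by
    ext z
    have e : z ∈ K \ T ↔ z ∈ I \ T := by rw [h2]
    have hz : z ∈ S → z ∉ T := fun h => Finset.disjoint_left.1 hST h
    simp only [Finset.mem_sdiff, Finset.mem_inter] at e ⊢
    tauto
  rw [h1, h3, Finset.sdiff_union_inter]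

/-- Superadditivity of conditional entropy for uniform distributions. -/
lemma sum_log_fiberCard_add_le (F : Finset (Finset β)) {S T : Finset β} (hST : Disjoint S T) :
    ∑ I ∈ F, (Real.log (fiberCard F S I) + Real.log (fiberCard F T I)) ≤
      ∑ I ∈ F, Real.log (fiberCard F (S ∪ T) I) := by
  -- By log x ≤ x - 1 it is enough to bound the sum of these ratios by |F|. Expanding gives triples
  -- (I, J, K) with J agreeing with I off S and K agreeing with I off T; such a triple is determined
  -- by (J, K), and then J and K agree off S ∪ T.
  have hsum : ∑ I ∈ F, ((fiberCard F S I : ℝ) * fiberCard F T I / fiberCard F (S ∪ T) I) ≤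
      ∑ I ∈ F, 1 := by
    calc ∑ I ∈ F, ((fiberCard F S I : ℝ) * fiberCard F T I / fiberCard F (S ∪ T) I)
        = ∑ I ∈ F, ∑ J ∈ F, ∑ K ∈ F, (if J \ S = I \ S ∧ K \ T = I \ T then
            ((fiberCard F (S ∪ T) I : ℝ))⁻¹ else 0) := by
          refine Finset.sum_congr rfl fun I _ => ?_
          rw [fiberCard, fiberCard, Finset.card_filter, Finset.card_filter, div_eq_mul_inv]
          push_cast
          rw [Finset.sum_mul_sum, Finset.sum_mul]
          refine Finset.sum_congr rfl fun J _ => ?_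
          rw [Finset.sum_mul]
          refine Finset.sum_congr rfl fun K _ => ?_
          by_cases h : J \ S = I \ S <;> by_cases h' : K \ T = I \ T <;> simp [h, h']
      _ = ∑ J ∈ F, ∑ K ∈ F, ∑ I ∈ F, (if J \ S = I \ S ∧ K \ T = I \ T then
            ((fiberCard F (S ∪ T) I : ℝ))⁻¹ else 0) := by
          rw [Finset.sum_comm]
          refine Finset.sum_congr rfl fun J _ => ?_
          rw [Finset.sum_comm]
      _ ≤ ∑ J ∈ F, ∑ K ∈ F, (if K \ (S ∪ T) = J \ (S ∪ T) then
            ((fiberCard F (S ∪ T) J : ℝ))⁻¹ else 0) := by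
          refine Finset.sum_le_sum fun J _ => Finset.sum_le_sum fun K _ => ?_
          rw [← Finset.sum_filter]
          rcases (F.filter fun I => J \ S = I \ S ∧ K \ T = I \ T).eq_empty_or_nonempty with
            h0 | ⟨I, hI⟩
          · rw [h0, Finset.sum_empty]
            split_ifs <;> positivity
          · have huniq : (F.filter fun I => J \ S = I \ S ∧ K \ T = I \ T) = {I} := by
              refine Finset.eq_singleton_iff_unique_mem.2 ⟨hI, fun I' hI' => ?_⟩
              obtain ⟨-, h1, h2⟩ := Finset.mem_filter.1 hI
              obtain ⟨-, h3, h4⟩ := Finset.mem_filter.1 hI'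
              rw [eq_of_sdiff_eq hST h1 h2, eq_of_sdiff_eq hST h3 h4]
            obtain ⟨-, h1, h2⟩ := Finset.mem_filter.1 hI
            have e1 := sdiff_eq_sdiff_mono (Finset.subset_union_left (s₂ := T)) h1
            have e2 := sdiff_eq_sdiff_mono (Finset.subset_union_right (s₁ := S)) h2
            rw [huniq, Finset.sum_singleton, if_pos (e2.trans e1.symm), fiberCard_congr e1]
      _ = ∑ J ∈ F, 1 := by
          refine Finset.sum_congr rfl fun J hJ => ?_
          rw [← Finset.sum_filter, Finset.sum_const, nsmul_eq_mul]
          exact mul_inv_cancel₀ (by exact_mod_cast (fiberCard_pos hJ).ne')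
  rw [← sub_nonneg, ← Finset.sum_sub_distrib]
  rw [← sub_nonneg, ← Finset.sum_sub_distrib] at hsum
  refine hsum.trans (Finset.sum_le_sum fun I hI => ?_)
  have h1 : (0 : ℝ) < fiberCard F S I := by exact_mod_cast fiberCard_pos hI
  have h2 : (0 : ℝ) < fiberCard F T I := by exact_mod_cast fiberCard_pos hI
  have h3 : (0 : ℝ) < fiberCard F (S ∪ T) I := by exact_mod_cast fiberCard_pos hI
  have := Real.log_le_sub_one_of_pos (div_pos (mul_pos h1 h2) h3)
  rw [Real.log_div (mul_pos h1 h2).ne' h3.ne', Real.log_mul h1.ne' h2.ne'] at this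
  linarith

/-- `fiberCard F S I` averages, after taking logarithms, to the entropy of the trace of a random
member on S given the rest; this iterates superadditivity over disjoint sets. -/
lemma sum_log_fiberCard_le {ι : Type*} [DecidableEq ι] (F : Finset (Finset β)) (T : Finset ι)
    (N : ι → Finset β) (hN : ∀ v ∈ T, ∀ w ∈ T, v ≠ w → Disjoint (N v) (N w)) :
    ∑ v ∈ T, ∑ I ∈ F, Real.log (fiberCard F (N v) I) ≤
      ∑ I ∈ F, Real.log (fiberCard F (T.biUnion N) I) := by
  induction T using Finset.induction_on with
  | empty =>
    rw [Finset.sum_empty]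
    exact Finset.sum_nonneg fun I hI => Real.log_natCast_nonneg _
  | insert a T ha ih =>
    have ih := ih fun v hv w hw => hN v (Finset.mem_insert_of_mem hv) w
      (Finset.mem_insert_of_mem hw)
    have hdisj : Disjoint (N a) (T.biUnion N) := by
      rw [Finset.disjoint_biUnion_right]
      intro v hv
      exact hN a (Finset.mem_insert_self _ _) v (Finset.mem_insert_of_mem hv)
        fun h => ha (h ▸ hv)
    have := sum_log_fiberCard_add_le F hdisj
    rw [Finset.sum_add_distrib] at this
    rw [Finset.sum_insert ha, Finset.biUnion_insert]
    linarith

/-- The sum counts the distinct sets I \ S, and down-closedness makes each of them a member of F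
disjoint from S. -/
lemma sum_inv_fiberCard_le (F : Finset (Finset β)) (hF : ∀ I ∈ F, ∀ J ⊆ I, J ∈ F)
    (S : Finset β) :
    ∑ I ∈ F, (fiberCard F S I : ℝ)⁻¹ ≤ (F.filter fun I => Disjoint I S).card := by
  have hmap : ∀ I ∈ F, I \ S ∈ F.filter fun I => Disjoint I S := fun I hI =>
    Finset.mem_filter.2 ⟨hF I hI _ Finset.sdiff_subset, Finset.sdiff_disjoint⟩
  rw [← Finset.sum_fiberwise_of_maps_to hmap, Finset.card_eq_sum_ones]
  push_cast
  refine Finset.sum_le_sum fun K hK => ?_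
  have hKS : K \ S = K := Finset.sdiff_eq_self_of_disjoint (Finset.mem_filter.1 hK).2
  calc ∑ I ∈ F with I \ S = K, (fiberCard F S I : ℝ)⁻¹
      = ∑ I ∈ F with I \ S = K, (fiberCard F S K : ℝ)⁻¹ := by
        refine Finset.sum_congr rfl fun I hI => ?_
        rw [fiberCard_congr ((Finset.mem_filter.1 hI).2.trans hKS.symm)]
    _ = 1 := by
        rw [Finset.sum_const, nsmul_eq_mul, fiberCard, hKS]
        refine mul_inv_cancel₀ ?_
        have : 0 < (F.filter fun J => J \ S = K).card :=
          Finset.card_pos.2 ⟨K, Finset.mem_filter.2 ⟨(Finset.mem_filter.1 hK).1, hKS⟩⟩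
        exact_mod_cast this.ne'
    _ ≤ 1 := le_rfl

/-- In a down-closed family with few traces on a set `L`, an average member avoids many of the
disjoint subsets `N v` of `L`. -/
theorem le_sum_card_disjoint {ι : Type*} [DecidableEq ι] (F : Finset (Finset β))
    (hF : ∀ I ∈ F, ∀ J ⊆ I, J ∈ F) (T : Finset ι) (hT : T.Nonempty) (N : ι → Finset β)
    (hN : ∀ v ∈ T, ∀ w ∈ T, v ≠ w → Disjoint (N v) (N w)) (L : Finset β)
    (hL : ∀ v ∈ T, N v ⊆ L) (B : ℕ) (hB : (F.image (· ∩ L)).card ≤ B) :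
    (T.card : ℝ) * F.card * Real.exp (-(Real.log B / T.card)) ≤
      ∑ v ∈ T, ((F.filter fun I => Disjoint I (N v)).card : ℝ) := by
  set a := Real.log B / T.card with ha
  have hTpos : (0 : ℝ) < T.card := by exact_mod_cast Finset.card_pos.2 hT
  have hlog : ∑ v ∈ T, ∑ I ∈ F, Real.log (fiberCard F (N v) I) ≤ F.card * Real.log B := by
    refine (sum_log_fiberCard_le F T N hN).trans ?_
    rw [← nsmul_eq_mul, ← Finset.sum_const]
    refine Finset.sum_le_sum fun I hI => ?_
    refine Real.log_le_log (by exact_mod_cast fiberCard_pos hI) ?_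
    exact_mod_cast (fiberCard_mono (Finset.biUnion_subset.2 hL)).trans
      ((fiberCard_le_card_image F L I).trans hB)
  -- A tangent line to exp takes the place of Jensen's inequality: an upper bound a for the average
  -- of log `fiberCard` becomes a lower bound for the average of its inverse.
  have hpt : ∀ v ∈ T, ∀ I ∈ F, Real.exp (-a) * (1 + a - Real.log (fiberCard F (N v) I)) ≤
      (fiberCard F (N v) I : ℝ)⁻¹ := by
    intro v _ I hI
    have hpos : (0 : ℝ) < fiberCard F (N v) I := by exact_mod_cast fiberCard_pos hI
    have h1 := Real.add_one_le_exp (a - Real.log (fiberCard F (N v) I))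
    calc Real.exp (-a) * (1 + a - Real.log (fiberCard F (N v) I))
        ≤ Real.exp (-a) * Real.exp (a - Real.log (fiberCard F (N v) I)) :=
          mul_le_mul_of_nonneg_left (by linarith) (Real.exp_pos _).le
      _ = (fiberCard F (N v) I : ℝ)⁻¹ := by
          rw [← Real.exp_add, show -a + (a - Real.log (fiberCard F (N v) I)) =
            -Real.log (fiberCard F (N v) I) by ring, Real.exp_neg, Real.exp_log hpos]
  calc (T.card : ℝ) * F.card * Real.exp (-a)
      ≤ Real.exp (-a) * (T.card * (F.card * (1 + a)) -
          ∑ v ∈ T, ∑ I ∈ F, Real.log (fiberCard F (N v) I)) := by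
        rw [mul_comm]
        refine mul_le_mul_of_nonneg_left ?_ (Real.exp_pos _).le
        have : (T.card : ℝ) * a = Real.log B := mul_div_cancel₀ _ hTpos.ne'
        nlinarith
    _ = ∑ v ∈ T, ∑ I ∈ F, Real.exp (-a) * (1 + a - Real.log (fiberCard F (N v) I)) := by
        simp only [← Finset.mul_sum, Finset.sum_sub_distrib, Finset.sum_const, nsmul_eq_mul]
        ring
    _ ≤ ∑ v ∈ T, ∑ I ∈ F, (fiberCard F (N v) I : ℝ)⁻¹ :=
        Finset.sum_le_sum fun v hv => Finset.sum_le_sum fun I hI => hpt v hv I hI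
    _ ≤ _ := Finset.sum_le_sum fun v _ => sum_inv_fiberCard_le F hF (N v)

end DownClosed

/-! ### Extending stable families -/

section Gain

variable {α : Type*} [DecidableEq α]

/-- Adjoining to `U` a stable family whose members have disjoint neighborhoods in `U` multiplies
the number of stable families by an exponential factor. -/
theorem numStable_mul_le_union {r : ℕ} {U T L : Finset (Finset α)} (hU : ∀ X ∈ U, X.card = r)
    (hTr : ∀ X ∈ T, X.card = r) (hT : StableFamily T) (hTne : T.Nonempty) (hTU : Disjoint T U)
    (hdisj : ∀ v ∈ T, ∀ w ∈ T, v ≠ w →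
      Disjoint (johnsonNeighbors U v) (johnsonNeighbors U w))
    (hL : ∀ v ∈ T, johnsonNeighbors U v ⊆ L) :
    (numStable U : ℝ) * 2 ^ (T.card * Real.exp (-(Real.log (numStable L) / T.card))) ≤
      numStable (U ∪ T) := by
  set F := stableSubfamilies U with hFdef
  -- Members of T with no neighbor in I can be added to I in any combination, since T is stable. So
  -- I extends in 2^|free I| ways, and the average of |free I| is at least b.
  set free : Finset (Finset α) → Finset (Finset α) := fun I =>
    T.filter fun v => Disjoint I (johnsonNeighbors U v) with hfree
  have hFpos : (0 : ℝ) < F.card := by exact_mod_cast numStable_pos U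
  have hB : (F.image (· ∩ L)).card ≤ numStable L := by
    refine Finset.card_le_card fun I hI => ?_
    obtain ⟨J, hJ, rfl⟩ := Finset.mem_image.1 hI
    exact mem_stableSubfamilies.2 ⟨Finset.inter_subset_right,
      (mem_stableSubfamilies.1 hJ).2.mono Finset.inter_subset_left⟩
  have h1 := le_sum_card_disjoint F (fun I hI J hJ => mem_stableSubfamilies.2
    ⟨hJ.trans (mem_stableSubfamilies.1 hI).1, (mem_stableSubfamilies.1 hI).2.mono hJ⟩) T hTne
    (johnsonNeighbors U) hdisj L hL _ hB
  have h2 : ∑ v ∈ T, ((F.filter fun I => Disjoint I (johnsonNeighbors U v)).card : ℝ) =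
      ∑ I ∈ F, ((free I).card : ℝ) := by
    simp only [hfree, Finset.card_filter]
    push_cast
    rw [Finset.sum_comm]
  rw [h2] at h1
  set b := T.card * Real.exp (-(Real.log (numStable L) / T.card)) with hb
  have h3 : (F.card : ℝ) * 2 ^ b ≤ ∑ I ∈ F, (2 : ℝ) ^ (free I).card := by
    -- Convexity of 2^x, through its tangent line at b.
    have hpt : ∀ I ∈ F, (2 : ℝ) ^ b * (1 + ((free I).card - b) * Real.log 2) ≤
        2 ^ (free I).card := by
      intro I _
      have e1 : (2 : ℝ) ^ (free I).card = 2 ^ b * Real.exp (((free I).card - b) * Real.log 2) := by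
        rw [Real.rpow_def_of_pos (by norm_num), ← Real.exp_add, ← Real.rpow_natCast,
          Real.rpow_def_of_pos (by norm_num)]
        congr 1
        ring
      rw [e1]
      refine mul_le_mul_of_nonneg_left ?_ (Real.rpow_nonneg (by norm_num) _)
      linarith [Real.add_one_le_exp (((free I).card - b) * Real.log 2)]
    refine le_trans ?_ (Finset.sum_le_sum hpt)
    rw [← Finset.mul_sum, Finset.sum_add_distrib, ← Finset.sum_mul, Finset.sum_sub_distrib,
      mul_comm]
    refine mul_le_mul_of_nonneg_left ?_ (Real.rpow_nonneg (by norm_num) _)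
    simp only [Finset.sum_const, nsmul_eq_mul, mul_one]
    have : (0 : ℝ) ≤ (∑ I ∈ F, ((free I).card : ℝ) - F.card * b) * Real.log 2 := by
      refine mul_nonneg ?_ (Real.log_nonneg (by norm_num))
      rw [hb]
      linarith
    linarith
  refine h3.trans ?_
  have h4 : ∑ I ∈ F, 2 ^ (free I).card ≤ numStable (U ∪ T) := by
    calc ∑ I ∈ F, 2 ^ (free I).card = (F.sigma fun I => (free I).powerset).card := by
          rw [Finset.card_sigma]
          simp only [Finset.card_powerset]
      _ ≤ numStable (U ∪ T) := by
          refine Finset.card_le_card_of_injOn (fun x => x.1 ∪ x.2) ?_ ?_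
          · rintro ⟨I, S⟩ hx
            obtain ⟨hI, hS⟩ := Finset.mem_sigma.1 (Finset.mem_coe.1 hx)
            obtain ⟨hIU, hIs⟩ := mem_stableSubfamilies.1 hI
            have hS : S ⊆ free I := Finset.mem_powerset.1 hS
            have hST : S ⊆ T := hS.trans (Finset.filter_subset _ _)
            have hcross : ∀ X ∈ I, ∀ Y ∈ S, (Y \ X).card ≠ 1 := by
              intro X hX Y hY h
              exact Finset.disjoint_left.1 (Finset.mem_filter.1 (hS hY)).2 hX
                (mem_johnsonNeighbors.2 ⟨hIU hX, h⟩)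
            refine Finset.mem_coe.2 (mem_stableSubfamilies.2
              ⟨Finset.union_subset_union hIU hST, ?_⟩)
            intro X hX Y hY
            rcases Finset.mem_union.1 hX with hX | hX <;> rcases Finset.mem_union.1 hY with hY | hY
            · exact hIs X hX Y hY
            · rw [← card_sdiff_symm (hU X (hIU hX)) (hTr Y (hST hY))]
              exact hcross X hX Y hY
            · exact hcross Y hY X hX
            · exact hT X (hST hX) Y (hST hY)
          · rintro ⟨I, S⟩ hx ⟨J, R⟩ hy h
            obtain ⟨hI, hS⟩ := Finset.mem_sigma.1 (Finset.mem_coe.1 hx)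
            obtain ⟨hJ, hR⟩ := Finset.mem_sigma.1 (Finset.mem_coe.1 hy)
            have hIU := (mem_stableSubfamilies.1 hI).1
            have hJU := (mem_stableSubfamilies.1 hJ).1
            have hST : S ⊆ T := (Finset.mem_powerset.1 hS).trans (Finset.filter_subset _ _)
            have hRT : R ⊆ T := (Finset.mem_powerset.1 hR).trans (Finset.filter_subset _ _)
            have h : I ∪ S = J ∪ R := h
            have key : ∀ z, (z ∈ I ↔ z ∈ J) ∧ (z ∈ S ↔ z ∈ R) := by
              intro z
              have e : z ∈ I ∪ S ↔ z ∈ J ∪ R := by rw [h]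
              simp only [Finset.mem_union] at e
              have d : ¬ (z ∈ T ∧ z ∈ U) := fun h' => Finset.disjoint_left.1 hTU h'.1 h'.2
              have a1 := @hIU z
              have a2 := @hJU z
              have a3 := @hST z
              have a4 := @hRT z
              tauto
            obtain rfl : I = J := Finset.ext fun z => (key z).1
            obtain rfl : S = R := Finset.ext fun z => (key z).2
            rfl
  exact_mod_cast h4

variable [Fintype α]

/-- The `r`-sets that do not contain `A`. -/
def avoiding (r : ℕ) (A : Finset α) : Finset (Finset α) :=
  (Finset.powersetCard r Finset.univ).filter fun X => ¬ A ⊆ X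

/-- Prohibiting the supersets of a given small set greatly reduces the number of stable
families. -/
theorem numStable_avoiding_mul_le {r s : ℕ} {A : Finset α} (hA : A.card = s) (hs : 0 < s)
    (hsr : s ≤ r) (hrn : r ≤ Fintype.card α) {H τ : ℝ}
    (hH : Real.log (numStable (Finset.powersetCard (r - s + 1) Aᶜ)) ≤ H)
    (hτ : τ = ((Fintype.card α - s).choose (r - s) : ℝ) / Fintype.card α) :
    (numStable (avoiding r A) : ℝ) * 2 ^ (τ * Real.exp (-(s * H / τ))) ≤
      numStable (Finset.powersetCard r (Finset.univ : Finset α)) := by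
  set n := Fintype.card α with hn
  have hnpos : 0 < n := by omega
  have : Nonempty α := Fintype.card_pos_iff.1 hnpos
  set R := (Finset.powersetCard (r - s) Aᶜ).image (A ∪ ·) with hR
  have memR : ∀ X, X ∈ R → A ⊆ X ∧ X.card = r := by
    intro X hX
    obtain ⟨Y, hY, rfl⟩ := Finset.mem_image.1 hX
    obtain ⟨hYA, hYc⟩ := Finset.mem_powersetCard.1 hY
    refine ⟨Finset.subset_union_left, ?_⟩
    rw [Finset.card_union_of_disjoint, hA, hYc]
    · omega
    · exact (disjoint_compl_right : Disjoint A Aᶜ).mono_right hYA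
  have hRcard : R.card = (n - s).choose (r - s) := by
    rw [hR, Finset.card_image_of_injOn, Finset.card_powersetCard, Finset.card_compl, hA]
    intro Y hY Z hZ h
    have hYA := (Finset.mem_powersetCard.1 (Finset.mem_coe.1 hY)).1
    have hZA := (Finset.mem_powersetCard.1 (Finset.mem_coe.1 hZ)).1
    have h : A ∪ Y = A ∪ Z := h
    ext z
    have e : z ∈ A ∪ Y ↔ z ∈ A ∪ Z := by rw [h]
    have a1 := @hYA z
    have a2 := @hZA z
    simp only [Finset.mem_union, Finset.mem_compl] at e a1 a2
    tauto
  obtain ⟨T, hTR, hTs, hTc⟩ := exists_stable_subfamily r R fun X hX =>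
    Finset.mem_powersetCard.2 ⟨Finset.subset_univ _, (memR X hX).2⟩
  rw [hRcard] at hTc
  have hch : 0 < (n - s).choose (r - s) := Nat.choose_pos (by omega)
  have hTpos : 0 < T.card := by
    rcases Nat.eq_zero_or_pos T.card with h0 | h0
    · rw [h0] at hTc; omega
    · exact h0
  have hτpos : 0 < τ := by rw [hτ]; positivity
  have hτT : τ ≤ T.card := by
    rw [hτ, div_le_iff₀ (by exact_mod_cast hnpos), mul_comm]
    exact_mod_cast hTc
  -- L consists of the r-sets that miss exactly one element of A. It splits into s copies of one
  -- Johnson graph on the complement of A, which gives the factor s in s * H.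
  set L := A.biUnion fun a => (Finset.powersetCard (r - s + 1) Aᶜ).image (A.erase a ∪ ·)
  have hnbr : ∀ v ∈ T, ∀ X ∈ johnsonNeighbors (avoiding r A) v, ∃ a ∈ A, ∃ y, y ∉ v ∧ a ∉ X ∧
      X = insert y (v.erase a) := by
    intro v hv X hX
    obtain ⟨hX, h1⟩ := mem_johnsonNeighbors.1 hX
    obtain ⟨hX, hAX⟩ := Finset.mem_filter.1 hX
    obtain ⟨x, hx, hxX, y, hy, hyv, hXe, -, -⟩ := exists_exchange (memR v (hTR hv)).2
      (Finset.mem_powersetCard.1 hX).2 h1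
    refine ⟨x, ?_, y, hyv, hxX, hXe⟩
    by_contra hxA
    apply hAX
    intro z hz
    rw [hXe]
    refine Finset.mem_insert_of_mem (Finset.mem_erase.2 ⟨?_, (memR v (hTR hv)).1 hz⟩)
    rintro rfl
    exact hxA hz
  have hmain := numStable_mul_le_union (r := r) (U := avoiding r A) (T := T) (L := L)
    (fun X hX => (Finset.mem_powersetCard.1 (Finset.mem_filter.1 hX).1).2)
    (fun X hX => (memR X (hTR hX)).2) hTs (Finset.card_pos.1 hTpos)
    (Finset.disjoint_left.2 fun X hX hXU => (Finset.mem_filter.1 hXU).2 (memR X (hTR hX)).1)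
    (by
      -- A common neighbor X of v and w misses one element a of A, the same for both. Then v and w
      -- both arise from X by inserting a and deleting one element, so they would be adjacent.
      intro v hv w hw hvw
      rw [Finset.disjoint_left]
      intro X hXv hXw
      obtain ⟨a, haA, y, hyv, haX, hX1⟩ := hnbr v hv X hXv
      obtain ⟨b, hbA, z, hzw, hbX, hX2⟩ := hnbr w hw X hXw
      have hAv := (memR v (hTR hv)).1
      have hAw := (memR w (hTR hw)).1
      have hab : a = b := by
        by_contra hne
        apply haX
        rw [hX2]
        exact Finset.mem_insert_of_mem (Finset.mem_erase.2 ⟨hne, hAw haA⟩)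
      subst hab
      have hyw : y ≠ z := by
        rintro rfl
        apply hvw
        have e1 : X.erase y = v.erase a := by
          rw [hX1, Finset.erase_insert fun h => hyv (Finset.mem_of_mem_erase h)]
        have e2 : X.erase y = w.erase a := by
          rw [hX2, Finset.erase_insert fun h => hzw (Finset.mem_of_mem_erase h)]
        rw [← Finset.insert_erase (hAv haA), ← Finset.insert_erase (hAw haA), ← e1, ← e2]
      have hya : y ≠ a := fun h => hyv (h ▸ hAv haA)
      have hza : z ≠ a := fun h => hzw (h ▸ hAw haA)
      refine hTs v hv w hw (Finset.card_eq_one.2 ⟨z, ?_⟩)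
      have heq := hX1.symm.trans hX2
      have key : ∀ x, (x = y ∨ x ≠ a ∧ x ∈ v) ↔ (x = z ∨ x ≠ a ∧ x ∈ w) := by
        intro x
        have : x ∈ insert y (v.erase a) ↔ x ∈ insert z (w.erase a) := by rw [heq]
        simpa using this
      ext x
      rw [Finset.mem_sdiff, Finset.mem_singleton]
      constructor
      · rintro ⟨hxv, hxw⟩
        have hxa : x ≠ a := fun h => hxw (h ▸ hAw haA)
        rcases (key x).1 (Or.inr ⟨hxa, hxv⟩) with h | h
        · exact h
        · exact absurd h.2 hxw
      · rintro rfl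
        refine ⟨?_, hzw⟩
        rcases (key x).2 (Or.inl rfl) with h | h
        · exact absurd h.symm hyw
        · exact h.2)
    (by
      intro v hv X hX
      obtain ⟨a, haA, y, hyv, haX, rfl⟩ := hnbr v hv X hX
      obtain ⟨Y, hY, rfl⟩ := Finset.mem_image.1 (hTR hv)
      obtain ⟨hYA, hYc⟩ := Finset.mem_powersetCard.1 hY
      simp only [Finset.mem_union, not_or] at hyv
      refine Finset.mem_biUnion.2 ⟨a, haA, Finset.mem_image.2 ⟨insert y Y, ?_, ?_⟩⟩
      · refine Finset.mem_powersetCard.2 ⟨Finset.insert_subset (by simpa using hyv.1) hYA, ?_⟩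
        rw [Finset.card_insert_of_notMem hyv.2, hYc]
      · have haY : a ∉ Y := fun h => by simpa [haA] using hYA h
        rw [Finset.erase_union_distrib, Finset.erase_eq_of_notMem haY, Finset.union_insert])
  have hLcard : (numStable L : ℝ) ≤
      (numStable (Finset.powersetCard (r - s + 1) Aᶜ) : ℝ) ^ s := by
    have : numStable L ≤ numStable (Finset.powersetCard (r - s + 1) Aᶜ) ^ s := by
      refine (numStable_biUnion_le _ _).trans ?_
      rw [← hA, ← Finset.prod_const]
      refine Finset.prod_le_prod' fun a ha => ?_
      rw [hA]
      exact numStable_image_union_le _ _ _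
        ((disjoint_compl_right : Disjoint A Aᶜ).mono_left (Finset.erase_subset _ _))
    exact_mod_cast this
  have hlogL : Real.log (numStable L) ≤ s * H := by
    calc Real.log (numStable L) ≤ Real.log ((numStable (Finset.powersetCard (r - s + 1) Aᶜ) : ℝ) ^ s) :=
          Real.log_le_log (by exact_mod_cast numStable_pos L) hLcard
      _ = s * Real.log (numStable (Finset.powersetCard (r - s + 1) Aᶜ)) := by
          rw [Real.log_pow]
      _ ≤ s * H := mul_le_mul_of_nonneg_left hH (Nat.cast_nonneg _)
  have hsH : 0 ≤ s * H := (Real.log_natCast_nonneg _).trans hlogL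
  have hTpos' : (0 : ℝ) < T.card := by exact_mod_cast hTpos
  have hexp : τ * Real.exp (-(s * H / τ)) ≤
      T.card * Real.exp (-(Real.log (numStable L) / T.card)) := by
    refine mul_le_mul hτT (Real.exp_le_exp.2 (neg_le_neg ?_)) (Real.exp_pos _).le hTpos'.le
    exact div_le_div₀ hsH hlogL hτpos hτT
  calc (numStable (avoiding r A) : ℝ) * 2 ^ (τ * Real.exp (-(s * H / τ)))
      ≤ numStable (avoiding r A) *
          2 ^ (T.card * Real.exp (-(Real.log (numStable L) / T.card))) :=
        mul_le_mul_of_nonneg_left (Real.rpow_le_rpow_of_exponent_le (by norm_num) hexp)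
          (Nat.cast_nonneg _)
    _ ≤ numStable (avoiding r A ∪ T) := hmain
    _ ≤ _ := by
        refine Nat.cast_le.2 (numStable_mono (Finset.union_subset (Finset.filter_subset _ _) ?_))
        intro X hX
        exact Finset.mem_powersetCard.2 ⟨Finset.subset_univ _, (memR X (hTR hX)).2⟩

end Gain

/-! ### Estimates for binomial coefficients -/

section Estimates

/-- The bound (eM/m)^m, obtained by comparing with the expansion of (1 + x)^M at x = m/M. -/
lemma sum_choose_le_exp {M m : ℕ} (hm : 1 ≤ m) (hmM : m ≤ M) :
    ∑ j ∈ Finset.range (m + 1), (M.choose j : ℝ) ≤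
      Real.exp (m * (1 + Real.log (M / m))) := by
  have hm0 : (0 : ℝ) < m := by exact_mod_cast hm
  have hM0 : (0 : ℝ) < M := by exact_mod_cast hm.trans hmM
  set x : ℝ := m / M with hx
  have hx0 : 0 < x := div_pos hm0 hM0
  have hx1 : x ≤ 1 := by
    rw [hx, div_le_one hM0]
    exact_mod_cast hmM
  have h1 : (∑ j ∈ Finset.range (m + 1), (M.choose j : ℝ)) * x ^ m ≤ Real.exp m := by
    calc (∑ j ∈ Finset.range (m + 1), (M.choose j : ℝ)) * x ^ m
        ≤ ∑ j ∈ Finset.range (m + 1), (M.choose j : ℝ) * x ^ j := by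
          rw [Finset.sum_mul]
          refine Finset.sum_le_sum fun j hj => mul_le_mul_of_nonneg_left ?_ (Nat.cast_nonneg _)
          exact pow_le_pow_of_le_one hx0.le hx1 (Nat.lt_succ_iff.1 (Finset.mem_range.1 hj))
      _ ≤ ∑ j ∈ Finset.range (M + 1), (M.choose j : ℝ) * x ^ j := by
          refine Finset.sum_le_sum_of_subset_of_nonneg ?_ fun _ _ _ => by positivity
          exact Finset.range_subset_range.2 (by omega)
      _ = (x + 1) ^ M := by
          rw [add_pow]
          refine Finset.sum_congr rfl fun j _ => ?_
          rw [one_pow, mul_one, mul_comm]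
      _ ≤ Real.exp x ^ M := by
          gcongr
          exact Real.add_one_le_exp x
      _ = Real.exp m := by
          rw [← Real.exp_nat_mul, hx, mul_div_cancel₀ _ hM0.ne']
  have h2 : Real.exp (m * (1 + Real.log (M / m))) * x ^ m = Real.exp m := by
    have : x ^ m = Real.exp (-(m * Real.log (M / m))) := by
      rw [show (M : ℝ) / m = x⁻¹ by rw [hx, inv_div], Real.log_inv, mul_neg, neg_neg,
        Real.exp_nat_mul, Real.exp_log hx0]
    rw [this, ← Real.exp_add]
    congr 1
    ring
  rw [← h2] at h1
  exact le_of_mul_le_mul_right h1 (pow_pos hx0 m)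

lemma numCovers_le {α : Type*} [Fintype α] [DecidableEq α] (r m : ℕ) :
    numCovers α r m ≤
      ∑ j ∈ Finset.range (m + 1), (2 ^ Fintype.card α * (r + 1)).choose j := by
  set G := (Finset.univ : Finset (Finset α)) ×ˢ Finset.range (r + 1) with hG
  have hGc : G.card = 2 ^ Fintype.card α * (r + 1) := by
    rw [hG, Finset.card_product, Finset.card_univ, Fintype.card_finset, Finset.card_range]
  have : (G.powerset.filter fun Z => Z.card ≤ m) ⊆
      (Finset.range (m + 1)).biUnion fun j => Finset.powersetCard j G := by
    intro Z hZ
    rw [Finset.mem_filter, Finset.mem_powerset] at hZ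
    refine Finset.mem_biUnion.2 ⟨Z.card, by rw [Finset.mem_range]; omega, ?_⟩
    exact Finset.mem_powersetCard.2 ⟨hZ.1, rfl⟩
  refine (Finset.card_le_card this).trans (Finset.card_biUnion_le.trans ?_)
  simp only [Finset.card_powersetCard, hGc, le_refl]

lemma numSmall_le {α : Type*} [Fintype α] [DecidableEq α] (t : ℕ) :
    numSmall α t ≤ (Fintype.card α + 1) ^ t := by
  have : ((Finset.univ : Finset (Finset α)).filter fun C => C.card ≤ t) ⊆
      (Finset.range (t + 1)).biUnion fun j => Finset.powersetCard j Finset.univ := by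
    intro Z hZ
    rw [Finset.mem_filter] at hZ
    refine Finset.mem_biUnion.2 ⟨Z.card, by rw [Finset.mem_range]; omega, ?_⟩
    exact Finset.mem_powersetCard.2 ⟨Finset.subset_univ _, rfl⟩
  refine (Finset.card_le_card this).trans (Finset.card_biUnion_le.trans ?_)
  rw [add_pow]
  refine Finset.sum_le_sum fun j hj => ?_
  rw [Finset.card_powersetCard, Finset.card_univ, one_pow, mul_one]
  have h1 : 0 < t.choose j := Nat.choose_pos (Nat.lt_succ_iff.1 (Finset.mem_range.1 hj))
  exact (Nat.choose_le_pow _ _).trans (Nat.le_mul_of_pos_right _ h1)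

lemma two_pow_le_choose {k : ℕ} : ∀ {n r : ℕ}, k ≤ r → r + k ≤ n → 2 ^ k ≤ n.choose r := by
  induction k with
  | zero => intro n r _ h; exact Nat.choose_pos (by omega)
  | succ k ih =>
    intro n r h1 h2
    obtain ⟨n, rfl⟩ := Nat.exists_eq_add_of_le' (show 1 ≤ n by omega)
    obtain ⟨r, rfl⟩ := Nat.exists_eq_add_of_le' (show 1 ≤ r by omega)
    rw [Nat.choose_succ_succ, pow_succ, mul_two]
    exact Nat.add_le_add (ih (by omega) (by omega)) (ih (by omega) (by omega))

/-- A Chernoff bound with weight 1/3: the base is 4/3 times 3^(1/4), and 3 ≤ (27/20)^4. -/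
lemma choose_le_of_four_mul_le {n r : ℕ} (h : 4 * r ≤ n) :
    (n.choose r : ℝ) ≤ (9 / 5) ^ n := by
  have h1 : (n.choose r : ℝ) * (1 / 3) ^ r ≤ (4 / 3) ^ n := by
    calc (n.choose r : ℝ) * (1 / 3) ^ r
        ≤ ∑ j ∈ Finset.range (n + 1), (n.choose j : ℝ) * (1 / 3) ^ j :=
          Finset.single_le_sum (f := fun j => (n.choose j : ℝ) * (1 / 3) ^ j)
            (fun _ _ => by positivity) (Finset.mem_range.2 (by omega))
      _ = (1 / 3 + 1) ^ n := by
          rw [add_pow]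
          refine Finset.sum_congr rfl fun j _ => ?_
          rw [one_pow, mul_one, mul_comm]
      _ = _ := by norm_num
  have h2 : (3 : ℝ) ^ r ≤ (27 / 20) ^ n := by
    calc (3 : ℝ) ^ r ≤ ((27 / 20) ^ 4) ^ r := by gcongr; norm_num
      _ = (27 / 20) ^ (4 * r) := by rw [← pow_mul]
      _ ≤ _ := pow_le_pow_right₀ (by norm_num) h
  calc (n.choose r : ℝ) = (n.choose r * (1 / 3) ^ r) * 3 ^ r := by
        rw [mul_assoc, ← mul_pow]; norm_num
    _ ≤ (4 / 3) ^ n * (27 / 20) ^ n := by gcongr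
    _ = _ := by rw [← mul_pow]; norm_num

/-- The induction step amounts to (2k+1)(2k+3) ≤ 4(k+1)^2. The companion lower bound rests on
4k(k+1) ≤ (2k+1)^2. Together they give the order 2^m/√m of the middle binomial coefficient. -/
lemma centralBinom_sq_mul_le (k : ℕ) : k.centralBinom ^ 2 * (2 * k + 1) ≤ 16 ^ k := by
  induction k with
  | zero => simp
  | succ k ih =>
    have h := Nat.succ_mul_centralBinom_succ k
    refine Nat.le_of_mul_le_mul_left ?_ (show 0 < (k + 1) ^ 2 by positivity)
    calc (k + 1) ^ 2 * ((k + 1).centralBinom ^ 2 * (2 * (k + 1) + 1))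
        = ((k + 1) * (k + 1).centralBinom) ^ 2 * (2 * k + 3) := by ring
      _ = (k.centralBinom ^ 2 * (2 * k + 1)) * (4 * ((2 * k + 1) * (2 * k + 3))) := by
          rw [h]; ring
      _ ≤ 16 ^ k * (4 * (4 * (k + 1) ^ 2)) := by
          refine Nat.mul_le_mul ih (Nat.mul_le_mul_left _ ?_)
          nlinarith
      _ = _ := by ring

lemma le_centralBinom_sq_mul {k : ℕ} (hk : 1 ≤ k) : 16 ^ k ≤ k.centralBinom ^ 2 * (4 * k) := by
  induction k, hk using Nat.le_induction with
  | base => simp [Nat.centralBinom]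
  | succ k hk ih =>
    have h := Nat.succ_mul_centralBinom_succ k
    refine Nat.le_of_mul_le_mul_left ?_ (show 0 < (k + 1) * k by positivity)
    calc (k + 1) * k * 16 ^ (k + 1) = 16 * (k + 1) * k * 16 ^ k := by ring
      _ ≤ 16 * (k + 1) * k * (k.centralBinom ^ 2 * (4 * k)) := Nat.mul_le_mul_left _ ih
      _ ≤ 4 * 4 * (2 * k + 1) ^ 2 * (k.centralBinom ^ 2 * k) := by
          have : 4 * ((k + 1) * k) ≤ (2 * k + 1) ^ 2 := by nlinarith
          nlinarith [Nat.mul_le_mul_right (16 * (k.centralBinom ^ 2 * k)) this]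
      _ = ((k + 1) * (k + 1).centralBinom) ^ 2 * (4 * k) := by rw [h]; ring
      _ = _ := by ring

lemma two_mul_choose_half_odd (k : ℕ) :
    2 * (2 * k + 1).choose ((2 * k + 1) / 2) = (k + 1).centralBinom := by
  have h1 : (2 * k + 1) / 2 = k := by omega
  rw [h1, Nat.centralBinom, show 2 * (k + 1) = (2 * k + 1) + 1 by ring, Nat.choose_succ_succ,
    ← Nat.choose_symm_half k]
  ring

lemma choose_half_sq_mul_le (m : ℕ) : m.choose (m / 2) ^ 2 * (m + 1) ≤ 4 ^ m := by
  rcases Nat.even_or_odd' m with ⟨k, rfl | rfl⟩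
  · have := centralBinom_sq_mul_le k
    rw [Nat.centralBinom] at this
    rw [Nat.mul_div_cancel_left k (by norm_num), pow_mul]
    exact this
  · have := centralBinom_sq_mul_le (k + 1)
    rw [← two_mul_choose_half_odd] at this
    have h4 : 4 ^ (2 * k + 1) = 4 * 16 ^ k := by
      rw [pow_succ, pow_mul]; norm_num [mul_comm]
    rw [pow_succ 16] at this
    rw [h4]
    nlinarith [Nat.zero_le ((2 * k + 1).choose ((2 * k + 1) / 2) ^ 2)]

lemma le_choose_half_sq_mul {m : ℕ} (hm : 1 ≤ m) :
    4 ^ m ≤ m.choose (m / 2) ^ 2 * (2 * m + 2) := by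
  rcases Nat.even_or_odd' m with ⟨k, rfl | rfl⟩
  · have := le_centralBinom_sq_mul (show 1 ≤ k by omega)
    rw [Nat.centralBinom] at this
    rw [Nat.mul_div_cancel_left k (by norm_num), pow_mul]
    refine this.trans (Nat.mul_le_mul_left _ (by omega))
  · have := le_centralBinom_sq_mul (show 1 ≤ k + 1 by omega)
    rw [← two_mul_choose_half_odd] at this
    have h4 : 4 ^ (2 * k + 1) = 4 * 16 ^ k := by
      rw [pow_succ, pow_mul]; norm_num [mul_comm]
    rw [pow_succ 16] at this
    rw [h4]
    nlinarith

/-- Each step multiplies by a ratio (a+1)/(b+1), which the last hypothesis keeps at most 5. -/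
lemma le_five_pow_mul_choose {n r : ℕ} : ∀ s : ℕ, s ≤ r → r ≤ n → n + 5 * s ≤ 5 * r →
    n.choose r ≤ 5 ^ s * (n - s).choose (r - s) := by
  intro s
  induction s with
  | zero => simp
  | succ s ih =>
    intro h1 h2 h3
    refine (ih (by omega) h2 (by omega)).trans ?_
    obtain ⟨a, ha⟩ := Nat.exists_eq_add_of_le' (show 1 ≤ n - s by omega)
    obtain ⟨b, hb⟩ := Nat.exists_eq_add_of_le' (show 1 ≤ r - s by omega)
    rw [show n - (s + 1) = a by omega, show r - (s + 1) = b by omega, ha, hb, pow_succ,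
      mul_assoc]
    refine Nat.mul_le_mul_left _ ?_
    have := Nat.add_one_mul_choose_eq a b
    refine Nat.le_of_mul_le_mul_right ?_ (show 0 < b + 1 by omega)
    rw [← this]
    nlinarith [Nat.zero_le (a.choose b), Nat.mul_le_mul_right (a.choose b)
      (show a + 1 ≤ 5 * (b + 1) by omega)]

end Estimates

/-! ### The number of stable families in a Johnson graph -/

section JohnsonBound

variable {α : Type*} [DecidableEq α]

/-- The number of stable families of `r`-sets of an `n`-element set, for `r` in the middle range. -/
theorem log_numStable_le {n r : ℕ} {B : Finset α} (hB : B.card = n) (h1 : n ≤ 5 * r)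
    (h2 : 5 * r ≤ 4 * n) (hn : 20 ≤ n)
    (hlog : 51 * Real.log (n + 1) * (1 + 2 * Real.log n) ≤ n) (hN : n ^ 2 ≤ n.choose r) :
    Real.log (numStable (Finset.powersetCard r B)) ≤ 9 * n.choose r / n := by
  obtain ⟨N, hNdef⟩ : ∃ N : ℝ, N = ((n.choose r : ℕ) : ℝ) := ⟨_, rfl⟩
  rw [← hNdef]
  have hn0 : (0 : ℝ) < n := by exact_mod_cast (show 0 < n by omega)
  have hrn : r ≤ n := by omega
  have hN' : (n : ℝ) ^ 2 ≤ N := by rw [hNdef]; exact_mod_cast hN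
  have hN0 : 0 < N := lt_of_lt_of_le (by positivity) hN'
  have hr1 : (n : ℝ) / 5 ≤ r + 1 := by
    have : (n : ℝ) ≤ 5 * r := by exact_mod_cast h1
    linarith
  have hr2 : (n : ℝ) / 5 ≤ n - r := by
    have : (5 : ℝ) * r ≤ 4 * n := by exact_mod_cast h2
    linarith
  -- Beyond R members, the error term n - r in `exists_degree_ge` is at most half of the main term;
  -- β is the half that is left.
  obtain ⟨R, hR⟩ : ∃ R : ℝ, R = 2 * N / (r + 1) := ⟨_, rfl⟩
  obtain ⟨β, hβ⟩ : ∃ β : ℝ, β = (n - r) * (r + 1) / (2 * N) := ⟨_, rfl⟩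
  have hr0 : (0 : ℝ) < r + 1 := by positivity
  have hnr0 : (0 : ℝ) < n - r := by linarith [div_pos hn0 (show (0 : ℝ) < 5 by norm_num)]
  have hβ0 : 0 < β := by rw [hβ]; positivity
  have hdeg : ∀ W ⊆ Finset.powersetCard r B, R < W.card →
      ∃ X ∈ W, β * W.card ≤ (johnsonNeighbors W X).card := by
    intro W hW hRW
    have hWne : W.Nonempty := by
      rw [← Finset.card_pos]
      have : (0 : ℝ) < W.card := lt_of_le_of_lt (by rw [hR]; positivity) hRW
      exact_mod_cast this
    obtain ⟨X, hX, hd⟩ := exists_degree_ge B r W hW hWne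
    refine ⟨X, hX, ?_⟩
    rw [hB] at hd
    have hd' : ((n : ℝ) - r) * (r + 1) * W.card ≤
        ((johnsonNeighbors W X).card + (n - r)) * N := by
      rw [hNdef, ← Nat.cast_sub hrn]
      exact_mod_cast hd
    rw [hR, div_lt_iff₀ hr0] at hRW
    rw [hβ, div_mul_eq_mul_div, div_le_iff₀ (by positivity)]
    nlinarith [mul_le_mul_of_nonneg_left hRW.le hnr0.le]
  have hcard : (Finset.powersetCard r B).card = n.choose r := by
    rw [Finset.card_powersetCard, hB]
  have hβ1 : β ≤ 1 := by
    obtain ⟨X, hX, hd⟩ := hdeg _ subset_rfl (by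
      rw [hcard, ← hNdef, hR, div_lt_iff₀ hr0, mul_comm 2 N]
      have : (20 : ℝ) ≤ n := by exact_mod_cast hn
      exact mul_lt_mul_of_pos_left (by linarith) hN0)
    have hle : (johnsonNeighbors (Finset.powersetCard r B) X).card ≤
        (Finset.powersetCard r B).card := Finset.card_filter_le _ _
    rw [hcard, ← hNdef] at hd
    rw [hcard] at hle
    have : ((johnsonNeighbors (Finset.powersetCard r B) X).card : ℝ) ≤ N := by
      rw [hNdef]; exact_mod_cast hle
    refine le_of_mul_le_mul_right (hd.trans this |>.trans_eq (one_mul N).symm) hN0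
  have hlogr : 1 ≤ Real.log (r + 1) := by
    rw [Real.le_log_iff_exp_le hr0]
    have := Real.exp_one_lt_d9
    have : (20 : ℝ) ≤ n := by exact_mod_cast hn
    linarith
  -- This makes (1 - β)^q at most 1/(r+1), enough to bring N below R.
  set q := ⌈Real.log (r + 1) / β⌉₊ with hq
  have hq1 : Real.log (r + 1) / β ≤ q := Nat.le_ceil _
  have hq2 : (q : ℝ) < Real.log (r + 1) / β + 1 := Nat.ceil_lt_add_one (by positivity)
  have hqpos : 1 ≤ q := Nat.one_le_iff_ne_zero.2 (by
    rw [hq]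
    exact (Nat.ceil_pos.2 (by positivity)).ne')
  have hqβ : Real.log (r + 1) ≤ β * q := by
    rw [div_le_iff₀ hβ0] at hq1
    linarith
  have hpow : N * (1 - β) ^ q ≤ R := by
    have e1 : (1 - β) ^ q ≤ 1 / (r + 1) := by
      calc (1 - β) ^ q ≤ Real.exp (-β) ^ q := by
            refine pow_le_pow_left₀ (by linarith) ?_ q
            linarith [Real.add_one_le_exp (-β)]
        _ = Real.exp (-(β * q)) := by
            rw [← Real.exp_nat_mul]; congr 1; ring
        _ ≤ Real.exp (-Real.log (r + 1)) := Real.exp_le_exp.2 (neg_le_neg hqβ)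
        _ = 1 / (r + 1) := by rw [Real.exp_neg, Real.exp_log hr0, one_div]
    calc N * (1 - β) ^ q ≤ N * (1 / (r + 1)) := by gcongr
      _ ≤ R := by
        rw [hR, mul_one_div]
        gcongr
        linarith
  have hβinv : 1 / β ≤ 50 * N / n ^ 2 := by
    rw [hβ, one_div_div, div_le_div_iff₀ (by positivity) (by positivity)]
    have : (n : ℝ) / 5 * (n / 5) ≤ (n - r) * (r + 1) := mul_le_mul hr2 hr1 (by positivity) hnr0.le
    calc 2 * N * n ^ 2 = 50 * N * (n / 5 * (n / 5)) := by ring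
      _ ≤ _ := mul_le_mul_of_nonneg_left this (by positivity)
  have hlogle : Real.log (r + 1) ≤ Real.log (n + 1) := by
    refine Real.log_le_log hr0 ?_
    have : (r : ℝ) ≤ n := by exact_mod_cast hrn
    linarith
  have hqle : (q : ℝ) ≤ 51 * N * Real.log (n + 1) / n ^ 2 := by
    have e1 : Real.log (r + 1) / β ≤ 50 * N / n ^ 2 * Real.log (n + 1) := by
      rw [div_eq_mul_one_div, mul_comm]
      exact mul_le_mul hβinv hlogle (by linarith) (by positivity)
    have e2 : 1 ≤ N * Real.log (n + 1) / n ^ 2 := by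
      rw [le_div_iff₀ (by positivity), one_mul]
      exact hN'.trans (le_mul_of_one_le_right hN0.le (hlogr.trans hlogle))
    calc (q : ℝ) ≤ 50 * N / n ^ 2 * Real.log (n + 1) + N * Real.log (n + 1) / n ^ 2 := by linarith
      _ = _ := by ring
  have hlogn : 0 ≤ Real.log n := Real.log_nonneg (by exact_mod_cast (show 1 ≤ n by omega))
  have hqN : q ≤ n.choose r := by
    have : (q : ℝ) ≤ N := by
      refine hqle.trans ?_
      rw [div_le_iff₀ (by positivity)]
      have : (20 : ℝ) ≤ n := by exact_mod_cast hn
      have e3 : 51 * Real.log (n + 1) ≤ n := by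
        nlinarith [Real.log_nonneg (show (1 : ℝ) ≤ n + 1 by linarith)]
      rw [show 51 * N * Real.log (n + 1) = 51 * Real.log (n + 1) * N by ring, mul_comm N]
      refine mul_le_mul_of_nonneg_right ?_ hN0.le
      nlinarith
    rw [hNdef] at this
    exact_mod_cast this
  have hNq : Real.log (N / q) ≤ 2 * Real.log n := by
    have hq0 : (0 : ℝ) < q := by exact_mod_cast hqpos
    have : N / q ≤ (n : ℝ) ^ 2 := by
      rw [div_le_iff₀ hq0]
      have e1 : 1 ≤ β * q := hlogr.trans hqβ
      rw [hβ, div_mul_eq_mul_div, le_div_iff₀ (by positivity)] at e1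
      have e2 : ((n : ℝ) - r) * (r + 1) ≤ n ^ 2 * 2 := by
        have : (r : ℝ) ≤ n := by exact_mod_cast hrn
        have h20 : (20 : ℝ) ≤ n := by exact_mod_cast hn
        nlinarith [Nat.cast_nonneg (α := ℝ) r]
      nlinarith [mul_le_mul_of_nonneg_right e2 hq0.le]
    calc Real.log (N / q) ≤ Real.log ((n : ℝ) ^ 2) := Real.log_le_log (by positivity) this
      _ = _ := by rw [Real.log_pow]; norm_num
  have hmain := numStable_le_of_degree (R := R) hβ1 (Finset.powersetCard r B) q hdeg
    (by rw [hcard, ← hNdef]; exact hpow)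
  rw [hcard] at hmain
  have hbound : (numStable (Finset.powersetCard r B) : ℝ) ≤
      Real.exp (R * Real.log 2 + q * (1 + Real.log (N / q))) := by
    refine hmain.trans ?_
    rw [Real.exp_add, Real.rpow_def_of_pos (by norm_num), mul_comm (Real.log 2)]
    rw [hNdef]
    exact mul_le_mul_of_nonneg_left (sum_choose_le_exp hqpos hqN) (Real.exp_pos _).le
  have hnum : (0 : ℝ) < numStable (Finset.powersetCard r B) := by exact_mod_cast numStable_pos _
  refine ((Real.log_le_iff_le_exp hnum).2 hbound).trans ?_
  -- The constant 9 splits as 7 from the factor 2^R, 1 from the sum of binomials, and 1 to spare.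
  have hRle : R * Real.log 2 ≤ 7 * N / n := by
    have e1 : R ≤ 10 * N / n := by
      rw [hR, div_le_div_iff₀ hr0 hn0]
      calc 2 * N * n ≤ 2 * N * (5 * (r + 1)) :=
            mul_le_mul_of_nonneg_left (by linarith) (by positivity)
        _ = _ := by ring
    have e2 := Real.log_two_lt_d9
    calc R * Real.log 2 ≤ 10 * N / n * Real.log 2 := by gcongr
      _ ≤ 10 * N / n * 0.7 := by gcongr; linarith
      _ = 7 * N / n := by ring
  have hqpart : q * (1 + Real.log (N / q)) ≤ N / n := by
    have hq0 : (0 : ℝ) ≤ q := Nat.cast_nonneg _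
    calc q * (1 + Real.log (N / q)) ≤ q * (1 + 2 * Real.log n) :=
          mul_le_mul_of_nonneg_left (by linarith) hq0
      _ ≤ 51 * N * Real.log (n + 1) / n ^ 2 * (1 + 2 * Real.log n) :=
          mul_le_mul_of_nonneg_right hqle (by linarith)
      _ = (51 * Real.log (n + 1) * (1 + 2 * Real.log n)) * (N / n ^ 2) := by ring
      _ ≤ n * (N / n ^ 2) := mul_le_mul_of_nonneg_right hlog (by positivity)
      _ = N / n := by field_simp
  have : 9 * N / n = 7 * N / n + N / n + N / n := by ring
  rw [this]
  have : 0 ≤ N / n := by positivity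
  linarith

end JohnsonBound

/-! ### Asymptotic estimates -/

section Asymptotics

lemma eventually_log_add_one_mul_le :
    ∀ᶠ n : ℕ in atTop, 51 * Real.log (n + 1) * (1 + 2 * Real.log n) ≤ n := by
  have h : ∀ᶠ x : ℝ in atTop, Real.log x ≤ (1 / 30) * x ^ (1 / 2 : ℝ) := by
    have := (isLittleO_log_rpow_atTop (show (0 : ℝ) < 1 / 2 by norm_num)).bound
      (show (0 : ℝ) < 1 / 30 by norm_num)
    filter_upwards [this, eventually_ge_atTop 1] with x hx h1
    rw [Real.norm_of_nonneg (Real.log_nonneg h1),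
      Real.norm_of_nonneg (Real.rpow_nonneg (by linarith) _)] at hx
    exact hx
  have h2 := (tendsto_natCast_atTop_atTop (R := ℝ)).eventually h
  filter_upwards [h2, eventually_ge_atTop 10000] with n hn hn1
  have hn0 : (10000 : ℝ) ≤ n := by exact_mod_cast hn1
  set y : ℝ := (n : ℝ) ^ (1 / 2 : ℝ) with hy
  have hyy : y * y = n := by
    rw [hy, ← Real.rpow_add (by linarith)]
    norm_num
  have hy0 : 0 ≤ y := Real.rpow_nonneg (by linarith) _
  have hy1 : 100 ≤ y := by nlinarith
  have hlog : Real.log (n + 1) ≤ Real.log n + 1 := by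
    calc Real.log (n + 1) ≤ Real.log (n * Real.exp 1) := by
          refine Real.log_le_log (by linarith) ?_
          nlinarith [Real.exp_one_gt_d9]
      _ = Real.log n + 1 := by rw [Real.log_mul (by linarith) (Real.exp_ne_zero _), Real.log_exp]
  have h0 : 0 ≤ Real.log n := Real.log_nonneg (by linarith)
  have h3 : 51 * Real.log (n + 1) ≤ 51 * (1 / 30 * y + 1) := by linarith
  have h4 : 1 + 2 * Real.log n ≤ 1 + 2 * (1 / 30 * y) := by linarith
  calc 51 * Real.log (n + 1) * (1 + 2 * Real.log n)
      ≤ 51 * (1 / 30 * y + 1) * (1 + 2 * (1 / 30 * y)) :=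
        mul_le_mul h3 h4 (by linarith) (by linarith)
    _ ≤ y * y := by nlinarith
    _ = n := hyy

lemma eventually_pow_mul_le_pow (k : ℕ) {a : ℝ} (C : ℝ) (ha : 1 < a) :
    ∀ᶠ n : ℕ in atTop, C * (n : ℝ) ^ k ≤ a ^ n := by
  have := (isLittleO_pow_const_const_pow_of_one_lt (R := ℝ) k ha).bound
    (show (0 : ℝ) < 1 / (|C| + 1) by positivity)
  filter_upwards [this] with n hn
  rw [Real.norm_of_nonneg (by positivity), Real.norm_of_nonneg (by positivity), one_div,
    inv_mul_eq_div, le_div_iff₀ (by positivity)] at hn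
  calc C * (n : ℝ) ^ k ≤ (|C| + 1) * (n : ℝ) ^ k := by
        gcongr
        linarith [le_abs_self C]
    _ ≤ a ^ n := by linarith

/-- The bound of `log_numStable_le` holds for all large ground sets. -/
theorem exists_log_numStable_le : ∃ n₁ : ℕ, ∀ (α : Type) [DecidableEq α] (B : Finset α) (r : ℕ),
    n₁ ≤ B.card → B.card ≤ 5 * r → 5 * r ≤ 4 * B.card →
    Real.log (numStable (Finset.powersetCard r B)) ≤ 9 * B.card.choose r / B.card := by
  have h1 : ∀ᶠ n : ℕ in atTop, n ^ 2 ≤ 2 ^ (n / 5) := by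
    have h2 := eventually_pow_mul_le_pow 2 36 (show (1 : ℝ) < 2 by norm_num)
    have h3 : Tendsto (fun n : ℕ => n / 5) atTop atTop :=
      Nat.tendsto_div_const_atTop (by norm_num)
    filter_upwards [h3.eventually h2, eventually_ge_atTop 25] with n hn hn5
    have h4 : 36 * (n / 5) ^ 2 ≤ 2 ^ (n / 5) := by exact_mod_cast hn
    refine le_trans ?_ h4
    calc n ^ 2 ≤ (6 * (n / 5)) ^ 2 := Nat.pow_le_pow_left (by omega) 2
      _ = _ := by ring
  obtain ⟨n₁, hn₁⟩ := eventually_atTop.1 (eventually_log_add_one_mul_le.and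
    (h1.and (eventually_ge_atTop 20)))
  refine ⟨n₁, fun α _ B r hB h2 h3 => ?_⟩
  obtain ⟨h4, h5, h6⟩ := hn₁ B.card hB
  refine log_numStable_le rfl h2 h3 h6 h4 (h5.trans (two_pow_le_choose ?_ ?_)) <;> omega

/-- A bound on the number of stable families of `r`-sets that holds for all `r`. -/
theorem exists_log_numStable_le' : ∃ n₁ : ℕ, ∀ (α : Type) [DecidableEq α] (B : Finset α) (r : ℕ),
    n₁ ≤ B.card → Real.log (numStable (Finset.powersetCard r B)) ≤
      9 * B.card.choose (B.card / 2) / B.card + (9 / 5) ^ B.card := by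
  obtain ⟨n₁, hn₁⟩ := exists_log_numStable_le
  refine ⟨n₁, fun α _ B r hB => ?_⟩
  have hnn : (0 : ℝ) ≤ 9 * B.card.choose (B.card / 2) / B.card := by positivity
  by_cases hr : B.card ≤ 5 * r ∧ 5 * r ≤ 4 * B.card
  · refine (hn₁ α B r hB hr.1 hr.2).trans ?_
    have : (0 : ℝ) ≤ (9 / 5) ^ B.card := by positivity
    have h2 : (B.card.choose r : ℝ) ≤ B.card.choose (B.card / 2) := by
      exact_mod_cast Nat.choose_le_middle r B.card
    have : (9 * B.card.choose r / B.card : ℝ) ≤ 9 * B.card.choose (B.card / 2) / B.card := by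
      gcongr
    linarith
  -- Outside the middle range there are so few r-sets that counting all families of them suffices.
  · have h1 : (B.card.choose r : ℝ) ≤ (9 / 5) ^ B.card := by
      by_cases h : 4 * r ≤ B.card
      · exact choose_le_of_four_mul_le h
      · by_cases h2 : r ≤ B.card
        · rw [← Nat.choose_symm h2]
          exact choose_le_of_four_mul_le (by omega)
        · rw [Nat.choose_eq_zero_of_lt (by omega)]
          simp only [Nat.cast_zero]
          positivity
    have h2 : (numStable (Finset.powersetCard r B) : ℝ) ≤ 2 ^ B.card.choose r := by
      have := numStable_le_two_pow (Finset.powersetCard r B)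
      rw [Finset.card_powersetCard] at this
      exact_mod_cast this
    have h3 : Real.log (numStable (Finset.powersetCard r B)) ≤ B.card.choose r * Real.log 2 := by
      rw [← Real.log_pow]
      exact Real.log_le_log (by exact_mod_cast numStable_pos _) h2
    have h4 : B.card.choose r * Real.log 2 ≤ (B.card.choose r : ℝ) * 1 := by
      gcongr
      linarith [Real.log_two_lt_d9]
    linarith

/-- The rank `r` is close enough to `n / 2` for the matroids of rank `r` to matter. -/
def GoodRank (n r : ℕ) : Prop := r ≤ n ∧ n.choose (n / 2) ≤ n ^ 2 * n.choose r

lemma two_pow_le_choose_half (n : ℕ) : 2 ^ n ≤ n.choose (n / 2) * (2 * n + 2) := by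
  rcases Nat.eq_zero_or_pos n with rfl | hn
  · simp
  refine (Nat.pow_le_pow_iff_left two_ne_zero).1 ?_
  calc (2 ^ n) ^ 2 = 4 ^ n := by rw [← pow_mul, mul_comm, pow_mul]; norm_num
    _ ≤ n.choose (n / 2) ^ 2 * (2 * n + 2) := le_choose_half_sq_mul hn
    _ ≤ n.choose (n / 2) ^ 2 * (2 * n + 2) ^ 2 := Nat.mul_le_mul_left _ (by nlinarith)
    _ = _ := by ring

/-- Outside the middle half binom(n, r) is at most (9/5)^n, whereas a good rank is only polynomially
short of 2^n. -/
lemma eventually_goodRank :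
    ∀ᶠ n : ℕ in atTop, ∀ r, GoodRank n r → n ≤ 4 * r ∧ 4 * r ≤ 3 * n := by
  filter_upwards [eventually_pow_mul_le_pow 3 5 (show (1 : ℝ) < 10 / 9 by norm_num),
    eventually_gt_atTop 2] with n hn hn2 r ⟨hrn, hr⟩
  by_contra hcon
  have h1 : (n.choose r : ℝ) ≤ (9 / 5) ^ n := by
    by_cases h : 4 * r ≤ n
    · exact choose_le_of_four_mul_le h
    · rw [← Nat.choose_symm hrn]
      exact choose_le_of_four_mul_le (by omega)
  have h2 : (2 : ℝ) ^ n ≤ n.choose (n / 2) * (2 * n + 2) := by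
    exact_mod_cast two_pow_le_choose_half n
  have h3 : (n.choose (n / 2) : ℝ) ≤ n ^ 2 * n.choose r := by exact_mod_cast hr
  have hn2' : (2 : ℝ) < n := by exact_mod_cast hn2
  have h4 : (2 : ℝ) ^ n ≤ (n ^ 2 * (9 / 5) ^ n) * (2 * n + 2) := by
    calc (2 : ℝ) ^ n ≤ n.choose (n / 2) * (2 * n + 2) := h2
      _ ≤ (n ^ 2 * (9 / 5) ^ n) * (2 * n + 2) := by
          gcongr
          exact h3.trans (by gcongr)
  have h5 : (2 : ℝ) ^ n = (10 / 9) ^ n * (9 / 5) ^ n := by rw [← mul_pow]; norm_num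
  have hp : (0 : ℝ) < (9 / 5) ^ n := by positivity
  have h6 : (10 / 9 : ℝ) ^ n ≤ n ^ 2 * (2 * n + 2) := by
    refine le_of_mul_le_mul_right ?_ hp
    rw [← h5]
    linarith
  nlinarith [pow_pos (show (0 : ℝ) < n by linarith) 2]

/-- The quantities that are negligible compared to `2 ^ n`. -/
lemma eventually_exp_sqrt_le : ∀ᶠ n : ℕ in atTop,
    100 * Real.exp (√n * Real.log (n + 1)) * (2 * n + 2) * n ^ 6 ≤ 2 ^ n := by
  have h : ∀ᶠ x : ℝ in atTop, Real.log x ≤ (1 / 8) * x ^ (1 / 2 : ℝ) := by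
    have := (isLittleO_log_rpow_atTop (show (0 : ℝ) < 1 / 2 by norm_num)).bound
      (show (0 : ℝ) < 1 / 8 by norm_num)
    filter_upwards [this, eventually_ge_atTop 1] with x hx h1
    rw [Real.norm_of_nonneg (Real.log_nonneg h1),
      Real.norm_of_nonneg (Real.rpow_nonneg (by linarith) _)] at hx
    exact hx
  have h2 := (tendsto_natCast_atTop_atTop (R := ℝ)).eventually h
  have he : (1 : ℝ) < Real.exp (1 / 4) := Real.one_lt_exp_iff.2 (by norm_num)
  filter_upwards [h2, eventually_ge_atTop 100, eventually_pow_mul_le_pow 7 400 he] with n hn hn1 hp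
  have hn0 : (100 : ℝ) ≤ n := by exact_mod_cast hn1
  rw [← Real.sqrt_eq_rpow] at hn
  have hsq : √(n : ℝ) * √n = n := Real.mul_self_sqrt (by linarith)
  have hs10 : 10 ≤ √(n : ℝ) := Real.le_sqrt_of_sq_le (by linarith)
  have hlog : Real.log (n + 1) ≤ Real.log n + 1 := by
    calc Real.log (n + 1) ≤ Real.log (n * Real.exp 1) := by
          refine Real.log_le_log (by linarith) ?_
          nlinarith [Real.exp_one_gt_d9]
      _ = Real.log n + 1 := by rw [Real.log_mul (by linarith) (Real.exp_ne_zero _), Real.log_exp]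
  have h3 : √(n : ℝ) * Real.log (n + 1) ≤ n * (1 / 4) := by
    have : Real.log (n + 1) ≤ 1 / 4 * √n := by linarith
    nlinarith
  have h4 : (100 : ℝ) * (2 * n + 2) * n ^ 6 ≤ Real.exp (1 / 4) ^ n := by
    refine le_trans ?_ hp
    have : (100 : ℝ) * (2 * n + 2) ≤ 400 * n := by linarith
    calc (100 : ℝ) * (2 * n + 2) * n ^ 6 ≤ 400 * n * n ^ 6 := by gcongr
      _ = _ := by ring
  calc 100 * Real.exp (√n * Real.log (n + 1)) * (2 * n + 2) * n ^ 6
      = Real.exp (√n * Real.log (n + 1)) * (100 * (2 * n + 2) * n ^ 6) := by ring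
    _ ≤ Real.exp (n * (1 / 4)) * Real.exp (1 / 4) ^ n :=
        mul_le_mul (Real.exp_le_exp.2 h3) h4 (by positivity) (Real.exp_pos _).le
    _ = Real.exp (1 / 2) ^ n := by
        rw [← Real.exp_nat_mul, ← Real.exp_nat_mul, ← Real.exp_add]
        congr 1
        ring
    _ ≤ 2 ^ n := by
        gcongr
        rw [← Real.le_log_iff_exp_le (by norm_num)]
        linarith [Real.log_two_gt_d9]

end Asymptotics

/-! ### The cost of describing a matroid up to its stable family. -/

section Description

lemma eventually_log_le {c a : ℝ} (hc : 0 < c) (ha : 0 < a) :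
    ∀ᶠ n : ℕ in atTop, Real.log n ≤ c * (n : ℝ) ^ a := by
  have h : ∀ᶠ x : ℝ in atTop, Real.log x ≤ c * x ^ a := by
    have := (isLittleO_log_rpow_atTop ha).bound hc
    filter_upwards [this, eventually_ge_atTop 1] with x hx h1
    rw [Real.norm_of_nonneg (Real.log_nonneg h1),
      Real.norm_of_nonneg (Real.rpow_nonneg (by linarith) _)] at hx
    exact hx
  exact (tendsto_natCast_atTop_atTop (R := ℝ)).eventually h

lemma eventually_le_rpow (C : ℝ) {a : ℝ} (ha : 0 < a) :
    ∀ᶠ n : ℕ in atTop, C ≤ (n : ℝ) ^ a :=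
  ((tendsto_rpow_atTop ha).comp (tendsto_natCast_atTop_atTop (R := ℝ))).eventually_ge_atTop C

lemma GoodRank.two_pow_le {n r : ℕ} (h : GoodRank n r) :
    (2 : ℝ) ^ n ≤ n.choose r * (n ^ 2 * (2 * n + 2)) := by
  have h1 := (two_pow_le_choose_half n).trans (Nat.mul_le_mul_right _ h.2)
  have : (2 : ℝ) ^ n ≤ n ^ 2 * n.choose r * (2 * n + 2) := by exact_mod_cast h1
  linarith

lemma GoodRank.mul_le_choose {n r : ℕ} (h : GoodRank n r) (hn : 0 < n)
    (hE : 100 * Real.exp (√n * Real.log (n + 1)) * (2 * n + 2) * n ^ 6 ≤ 2 ^ n) :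
    100 * Real.exp (√n * Real.log (n + 1)) * n ^ 4 ≤ n.choose r := by
  have h1 := hE.trans h.two_pow_le
  have hn0 : (0 : ℝ) < n := by exact_mod_cast hn
  refine le_of_mul_le_mul_right ?_ (show (0 : ℝ) < n ^ 2 * (2 * n + 2) by positivity)
  calc _ = 100 * Real.exp (√n * Real.log (n + 1)) * (2 * n + 2) * n ^ 6 := by ring
    _ ≤ _ := h1

/-- The arithmetic of `exists_isGoodCover` with d = n q^2 and t = q^4. The first round uses at most
x = N/(n q^2) pairs; the degree bound leaves at most 32 q^2 N/n sets, so the second round uses at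
most 32x bounds. -/
lemma add_le_of_double_count {n r q z₁ z₂ u : ℕ} {N x : ℝ} (hn : 0 < n) (hq : 1 ≤ q)
    (hr1 : n ≤ 4 * r) (hr2 : 4 * r ≤ 3 * n) (hx : 0 < x) (hxN : x * (n * q ^ 2) = N)
    (h1 : (z₁ : ℝ) * (n * q ^ 2) ≤ N)
    (h2 : ((n : ℝ) - r) * (r + 1) * u ≤ (n * q ^ 2 + (n - r)) * N)
    (h3 : (z₂ : ℝ) * q ^ 4 ≤ u) : 2 * (z₁ : ℝ) + z₂ ≤ 34 * x := by
  have hn0 : (0 : ℝ) < n := by exact_mod_cast hn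
  have hq1 : (1 : ℝ) ≤ q := by exact_mod_cast hq
  have hq0 : (0 : ℝ) < q := by linarith
  have hNpos : 0 < N := by rw [← hxN]; positivity
  have e1 : (z₁ : ℝ) ≤ x := by
    rw [← hxN] at h1
    exact le_of_mul_le_mul_right h1 (by positivity)
  have hr1' : (n : ℝ) / 4 ≤ r := by
    have : (n : ℝ) ≤ 4 * r := by exact_mod_cast hr1
    linarith
  have hr2' : (n : ℝ) / 4 ≤ n - r := by
    have : (4 : ℝ) * r ≤ 3 * n := by exact_mod_cast hr2
    linarith
  have e2 : (n : ℝ) / 4 * ((n : ℝ) / 4) * (u : ℝ) ≤ 2 * ((n : ℝ) * (q : ℝ) ^ 2) * N := by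
    have h4 : (n : ℝ) / 4 * ((n : ℝ) / 4) ≤ (n - r) * (r + 1) :=
      mul_le_mul hr2' (by linarith) (by positivity) (by linarith)
    have h5 : ((n : ℝ) * (q : ℝ) ^ 2 + (n - r)) * N ≤ 2 * ((n : ℝ) * (q : ℝ) ^ 2) * N := by
      refine mul_le_mul_of_nonneg_right ?_ hNpos.le
      have h6 : (n : ℝ) * 1 ≤ n * (q : ℝ) ^ 2 :=
        mul_le_mul_of_nonneg_left (one_le_pow₀ hq1) hn0.le
      have : (0 : ℝ) ≤ r := Nat.cast_nonneg _
      linarith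
    exact (mul_le_mul_of_nonneg_right h4 (Nat.cast_nonneg _)).trans (h2.trans h5)
  have e3 : (n : ℝ) ^ 2 * (q : ℝ) ^ 4 * (z₂ : ℝ) ≤ (n : ℝ) ^ 2 * (q : ℝ) ^ 4 * (32 * x) := by
    have h4 := mul_le_mul_of_nonneg_left h3 (sq_nonneg (n : ℝ))
    have h5 : 16 * (2 * ((n : ℝ) * (q : ℝ) ^ 2) * N) = (n : ℝ) ^ 2 * (q : ℝ) ^ 4 * (32 * x) := by
      rw [← hxN]; ring
    have h6 : (n : ℝ) ^ 2 * (u : ℝ) = 16 * ((n : ℝ) / 4 * ((n : ℝ) / 4) * (u : ℝ)) := by ring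
    have h7 : (n : ℝ) ^ 2 * (q : ℝ) ^ 4 * (z₂ : ℝ) = (n : ℝ) ^ 2 * ((z₂ : ℝ) * (q : ℝ) ^ 4) := by
      ring
    linarith
  have := le_of_mul_le_mul_left e3 (by positivity)
  linarith

lemma two_pow_numSmall_sq_le {n t : ℕ} {x : ℝ} (ht : (t : ℝ) ≤ √n) (hn : 1 ≤ n)
    (hx : 100 * Real.exp (√n * Real.log (n + 1)) * (n : ℝ) ^ 2 ≤ x) :
    (2 : ℝ) ^ numSmall (Fin n) t * 2 ^ numSmall (Fin n) t ≤ Real.exp x := by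
  have hn0 : (1 : ℝ) ≤ n := by exact_mod_cast hn
  have h1 : (numSmall (Fin n) t : ℝ) ≤ Real.exp (√n * Real.log (n + 1)) := by
    have := numSmall_le (α := Fin n) t
    rw [Fintype.card_fin] at this
    calc (numSmall (Fin n) t : ℝ) ≤ ((n : ℝ) + 1) ^ t := by exact_mod_cast this
      _ = Real.exp ((t : ℝ) * Real.log (n + 1)) := by
          rw [Real.exp_nat_mul, Real.exp_log (by linarith)]
      _ ≤ _ := by
          refine Real.exp_le_exp.2 (mul_le_mul_of_nonneg_right ht
            (Real.log_nonneg (by linarith)))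
  have e3 : 100 * Real.exp (√n * Real.log (n + 1)) * 1 ≤
      100 * Real.exp (√n * Real.log (n + 1)) * (n : ℝ) ^ 2 :=
    mul_le_mul_of_nonneg_left (one_le_pow₀ hn0) (by positivity)
  obtain ⟨k, hk⟩ : ∃ k, k = numSmall (Fin n) t := ⟨_, rfl⟩
  rw [← hk] at h1 ⊢
  have e1 : Real.log 2 ≤ 1 := by linarith [Real.log_two_lt_d9]
  have e2 : (0 : ℝ) ≤ k := Nat.cast_nonneg _
  have e4 : (2 : ℝ) ^ k = Real.exp (k * Real.log 2) := by
    rw [Real.exp_nat_mul, Real.exp_log two_pos]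
  rw [e4, ← Real.exp_add]
  refine Real.exp_le_exp.2 ?_
  have e5 : (k : ℝ) * Real.log 2 ≤ k * 1 := mul_le_mul_of_nonneg_left e1 e2
  have := Real.exp_pos (√n * Real.log (n + 1))
  linarith

/-- There are 2^n (r+1) potential rank bounds, at most n^6 times the number m + 2 to be chosen, so
each chosen bound costs only O(log n). The extra 2 leaves room for the bounds of a prescribed
separation. -/
lemma numCovers_le_exp {n r m : ℕ} {N x : ℝ} (hn : 1 ≤ n) (hrn : r ≤ n) (hx : 2 ≤ x)
    (hm1 : (m : ℝ) ≤ 34 * x) (hm2 : 34 * x ≤ m + 1) (hN2 : N ≤ 2 ^ n) (hxN : 35 * x ≤ N)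
    (h2N : (2 : ℝ) ^ n ≤ N * (n ^ 2 * (2 * n + 2))) (hNx : N ≤ x * n ^ 2) :
    (numCovers (Fin n) r (m + 2) : ℝ) ≤ Real.exp (35 * x * (1 + 6 * Real.log n)) := by
  have hn0 : (1 : ℝ) ≤ n := by exact_mod_cast hn
  have h1 := numCovers_le (α := Fin n) r (m + 2)
  rw [Fintype.card_fin] at h1
  have hm35 : ((m + 2 : ℕ) : ℝ) ≤ 35 * x := by push_cast; linarith
  have hmM : m + 2 ≤ 2 ^ n * (r + 1) := by
    have : ((m + 2 : ℕ) : ℝ) ≤ 2 ^ n * (r + 1) :=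
      (hm35.trans (hxN.trans hN2)).trans (le_mul_of_one_le_right (by positivity)
        (by linarith [Nat.cast_nonneg (α := ℝ) r]))
    exact_mod_cast this
  have h2 := sum_choose_le_exp (show 1 ≤ m + 2 by omega) hmM
  have h3 : (numCovers (Fin n) r (m + 2) : ℝ) ≤
      ∑ j ∈ Finset.range (m + 2 + 1), ((2 ^ n * (r + 1)).choose j : ℝ) := by
    exact_mod_cast h1
  refine (h3.trans h2).trans (Real.exp_le_exp.2 ?_)
  have hlog0 : 0 ≤ Real.log n := Real.log_nonneg (by linarith)
  have hlogM : Real.log (((2 ^ n * (r + 1) : ℕ) : ℝ) / ((m + 2 : ℕ) : ℝ)) ≤ 6 * Real.log n := by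
    rw [show (6 : ℝ) * Real.log n = Real.log ((n : ℝ) ^ 6) by rw [Real.log_pow]; norm_num]
    refine Real.log_le_log (by positivity) ?_
    rw [div_le_iff₀ (by positivity)]
    push_cast
    have hrn' : (r : ℝ) + 1 ≤ n + 1 := by
      have : (r : ℝ) ≤ n := by exact_mod_cast hrn
      linarith
    have hn2 : (2 : ℝ) * (n + 1) ^ 2 ≤ 34 * n ^ 2 := by nlinarith
    calc (2 : ℝ) ^ n * ((r : ℝ) + 1) ≤ (N * ((n : ℝ) ^ 2 * (2 * n + 2))) * ((n : ℝ) + 1) :=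
          mul_le_mul h2N hrn' (by positivity) ((by positivity : (0 : ℝ) ≤ 2 ^ n).trans h2N)
      _ ≤ (x * (n : ℝ) ^ 2 * ((n : ℝ) ^ 2 * (2 * n + 2))) * ((n : ℝ) + 1) := by gcongr
      _ = (n : ℝ) ^ 4 * x * (2 * ((n : ℝ) + 1) ^ 2) := by ring
      _ ≤ (n : ℝ) ^ 4 * x * (34 * (n : ℝ) ^ 2) :=
          mul_le_mul_of_nonneg_left hn2 (by positivity)
      _ = (n : ℝ) ^ 6 * (34 * x) := by ring
      _ ≤ (n : ℝ) ^ 6 * ((m : ℝ) + 2) :=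
          mul_le_mul_of_nonneg_left (by linarith) (by positivity)
  have h0 : 0 ≤ Real.log (((2 ^ n * (r + 1) : ℕ) : ℝ) / ((m + 2 : ℕ) : ℝ)) := by
    refine Real.log_nonneg ?_
    rw [one_le_div (by positivity)]
    exact_mod_cast hmM
  exact mul_le_mul hm35 (by linarith) (by linarith) (by positivity)

/-- Almost all of the information in a matroid is contained in a stable family. -/
theorem eventually_description : ∀ᶠ n : ℕ in atTop, ∀ r, GoodRank n r → ∃ t m : ℕ,
    Real.log n ≤ t ∧
    (∀ M ∈ matroidsOfRank (Fin n) r, ∃ Z, Z.card ≤ m ∧ IsGoodCover M.FIndep r t Z) ∧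
    (numCovers (Fin n) r (m + 2) : ℝ) * (2 ^ numSmall (Fin n) t * 2 ^ numSmall (Fin n) t) ≤
      Real.exp (n.choose r * (n : ℝ) ^ (-(9 / 8) : ℝ)) := by
  filter_upwards [eventually_goodRank, eventually_exp_sqrt_le, eventually_ge_atTop 40,
    eventually_log_le (show (0 : ℝ) < 1 / 2000 by norm_num) (show (0 : ℝ) < 1 / 8 by norm_num),
    eventually_le_rpow 2000 (show (0 : ℝ) < 1 / 8 by norm_num)] with n hgood hE hn40 hlog hy2000 r hr
  obtain ⟨hr1, hr2⟩ := hgood r hr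
  have hrn := hr.1
  have hn0 : (40 : ℝ) ≤ n := by exact_mod_cast hn40
  have hNE := hr.mul_le_choose (by omega) hE
  have h2N := hr.two_pow_le
  obtain ⟨N, hN⟩ : ∃ N : ℝ, N = ((n.choose r : ℕ) : ℝ) := ⟨_, rfl⟩
  rw [← hN] at hNE h2N ⊢
  -- With q the floor of y = n^(1/8), the threshold t = q^4 is at most √n, so small sets are cheap.
  -- The number of rank bounds is of order x = N/(n q^2), about N n^(-5/4), which even with a factor
  -- log n stays below N/(n y) = N n^(-9/8).
  obtain ⟨y, hy⟩ : ∃ y : ℝ, y = (n : ℝ) ^ (1 / 8 : ℝ) := ⟨_, rfl⟩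
  rw [← hy] at hlog hy2000
  have hy8 : y ^ 8 = n := by
    rw [hy, ← Real.rpow_natCast, ← Real.rpow_mul (by linarith)]
    norm_num
  have hpow : (n : ℝ) ^ (-(9 / 8) : ℝ) = 1 / (n * y) := by
    rw [Real.rpow_neg (by linarith), one_div, hy, ← Real.rpow_one_add' (by linarith) (by norm_num)]
    norm_num
  obtain ⟨q, hq⟩ : ∃ q : ℕ, q = ⌊y⌋₊ := ⟨_, rfl⟩
  have hqy : (q : ℝ) ≤ y := hq ▸ Nat.floor_le (by linarith)
  have hqy2 : y / 2 ≤ q := by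
    have : y < q + 1 := hq ▸ Nat.lt_floor_add_one y
    linarith
  have hq0 : (0 : ℝ) < q := by linarith
  have hq1 : 1 ≤ q := by exact_mod_cast hq0
  have hsqrt : √(n : ℝ) = y ^ 4 := by
    rw [← hy8, show y ^ 8 = (y ^ 4) ^ 2 by ring]
    exact Real.sqrt_sq (by positivity)
  have hq4 : (q : ℝ) ^ 4 ≤ √n := by
    rw [hsqrt]
    gcongr
  have hq2 : (q : ℝ) ^ 2 ≤ n := by
    calc (q : ℝ) ^ 2 ≤ y ^ 2 := by gcongr
      _ ≤ y ^ 8 := pow_le_pow_right₀ (by linarith) (by norm_num)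
      _ = n := hy8
  have hNpos : 0 < N := lt_of_lt_of_le (by positivity) hNE
  obtain ⟨x, hx⟩ : ∃ x : ℝ, x = N / (n * q ^ 2) := ⟨_, rfl⟩
  have hxN : x * (n * q ^ 2) = N := by
    rw [hx]; field_simp
  have hxpos : 0 < x := by rw [hx]; positivity
  have hxlow : 100 * Real.exp (√n * Real.log (n + 1)) * n ^ 2 ≤ x := by
    rw [hx, le_div_iff₀ (by positivity)]
    refine le_trans ?_ hNE
    calc 100 * Real.exp (√n * Real.log (n + 1)) * (n : ℝ) ^ 2 * (n * q ^ 2)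
        ≤ 100 * Real.exp (√n * Real.log (n + 1)) * (n : ℝ) ^ 2 * (n * n) := by gcongr
      _ = _ := by ring
  have hexp1 : 1 ≤ Real.exp (√n * Real.log (n + 1)) :=
    Real.one_le_exp (mul_nonneg (Real.sqrt_nonneg _) (Real.log_nonneg (by linarith)))
  have hx2 : 2 ≤ x := by
    refine le_trans ?_ hxlow
    nlinarith
  obtain ⟨m, hm⟩ : ∃ m : ℕ, m = ⌊34 * x⌋₊ := ⟨_, rfl⟩
  have hm1 : (m : ℝ) ≤ 34 * x := hm ▸ Nat.floor_le (by positivity)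
  have hm2 : 34 * x ≤ m + 1 := hm ▸ (Nat.lt_floor_add_one _).le
  have hqn : (35 : ℝ) ≤ n * (q : ℝ) ^ 2 := by
    have : (n : ℝ) * 1 ≤ n * (q : ℝ) ^ 2 :=
      mul_le_mul_of_nonneg_left (one_le_pow₀ (by exact_mod_cast hq1)) (by linarith)
    linarith
  refine ⟨q ^ 4, m, ?_, ?_, ?_⟩
  · push_cast
    calc Real.log n ≤ 1 / 2000 * y := hlog
      _ ≤ y / 2 := by linarith
      _ ≤ q := hqy2
      _ ≤ (q : ℝ) ^ 4 := le_self_pow₀ (by exact_mod_cast hq1) (by norm_num)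
  · intro M hM
    refine exists_isGoodCover (isRankIndep_of_mem hM) (by omega) (n * q ^ 2) (q ^ 4) m ?_
    intro z₁ z₂ u h1 h2 h3
    rw [Fintype.card_fin] at h1 h2
    have h1' : (z₁ : ℝ) * (n * q ^ 2) ≤ N := by rw [hN]; exact_mod_cast h1
    have h2' : ((n : ℝ) - r) * (r + 1) * u ≤ (n * q ^ 2 + (n - r)) * N := by
      rw [hN, ← Nat.cast_sub hrn]
      exact_mod_cast h2
    have h3' : (z₂ : ℝ) * q ^ 4 ≤ u := by exact_mod_cast h3
    have := add_le_of_double_count (by omega) hq1 hr1 hr2 hxpos hxN h1' h2' h3'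
    rw [hm]
    refine Nat.le_floor ?_
    push_cast
    linarith
  · have hsmall : (2 : ℝ) ^ numSmall (Fin n) (q ^ 4) * 2 ^ numSmall (Fin n) (q ^ 4) ≤
        Real.exp x :=
      two_pow_numSmall_sq_le (by exact_mod_cast hq4) (by omega) hxlow
    have hN2 : N ≤ 2 ^ n := by
      rw [hN]; exact_mod_cast Nat.choose_le_two_pow n r
    have hxN' : 35 * x ≤ N := by
      rw [← hxN, mul_comm]
      exact mul_le_mul_of_nonneg_left hqn hxpos.le
    have hNx : N ≤ x * n ^ 2 := by
      rw [← hxN, sq (n : ℝ)]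
      gcongr
    have hcov := numCovers_le_exp (by omega) hrn hx2 hm1 hm2 hN2 hxN' h2N hNx
    calc (numCovers (Fin n) r (m + 2) : ℝ) *
          (2 ^ numSmall (Fin n) (q ^ 4) * 2 ^ numSmall (Fin n) (q ^ 4))
        ≤ Real.exp (35 * x * (1 + 6 * Real.log n)) * Real.exp x :=
          mul_le_mul hcov hsmall (by positivity) (Real.exp_pos _).le
      _ ≤ Real.exp (N * (n : ℝ) ^ (-(9 / 8) : ℝ)) := by
          rw [← Real.exp_add]
          refine Real.exp_le_exp.2 ?_
          have h1 : 35 * x * (1 + 6 * Real.log n) + x ≤ x * (y / 4) := by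
            have : 36 + 210 * Real.log n ≤ y / 4 := by linarith
            have := mul_le_mul_of_nonneg_left this hxpos.le
            linarith
          refine h1.trans ?_
          rw [hpow, mul_one_div, hx, div_mul_eq_mul_div, div_le_div_iff₀ (by positivity)
            (by positivity)]
          have h2 : y ^ 2 / 4 ≤ (q : ℝ) ^ 2 := by
            have := pow_le_pow_left₀ (by linarith) hqy2 2
            linarith
          have h3 := mul_le_mul_of_nonneg_left h2 (mul_nonneg hNpos.le (Nat.cast_nonneg n))
          linarith

end Description

/-! ### The lower bound on all matroids, and ranks that do not matter. -/

section Ranks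

lemma matroidsOfRank_subset (n r : ℕ) : matroidsOfRank (Fin n) r ⊆ matroidsOn n := fun _ h => h.1

lemma ncard_matroidsOfRank_le_ncard (n r : ℕ) :
    (matroidsOfRank (Fin n) r).ncard ≤ (matroidsOn n).ncard :=
  Set.ncard_le_ncard (matroidsOfRank_subset n r) (matroidsOn_finite n)

/-- Every subfamily of the Graham–Sloane code of (n/2)-sets gives a sparse paving matroid. -/
lemma exp_le_ncard_matroidsOn {n : ℕ} (hn : 2 ≤ n) :
    Real.exp (Real.log 2 * (n.choose (n / 2) / n)) ≤ (matroidsOn n).ncard := by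
  have : Nonempty (Fin n) := ⟨⟨0, by omega⟩⟩
  obtain ⟨T, hTU, hT, hc⟩ := exists_stable_subfamily (α := Fin n) (n / 2)
    (Finset.powersetCard (n / 2) Finset.univ) (Finset.Subset.refl _)
  rw [Finset.card_powersetCard, Finset.card_univ, Fintype.card_fin] at hc
  have h1 : 2 ^ T.card ≤ (matroidsOn n).ncard := by
    rw [← numStable_eq_two_pow hT]
    refine (numStable_mono hTU).trans ?_
    refine (numStable_le_ncard_matroidsOfRank (by omega) ?_).trans
      (ncard_matroidsOfRank_le_ncard n (n / 2))
    rw [Fintype.card_fin]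
    omega
  have hn0 : (0 : ℝ) < n := by exact_mod_cast (by omega : 0 < n)
  have h2 : (n.choose (n / 2) : ℝ) / n ≤ T.card := by
    rw [div_le_iff₀ hn0, mul_comm]
    exact_mod_cast hc
  calc Real.exp (Real.log 2 * (n.choose (n / 2) / n)) ≤ Real.exp (T.card * Real.log 2) := by
        rw [mul_comm]
        exact Real.exp_le_exp.2 (mul_le_mul_of_nonneg_right h2 (Real.log_nonneg one_le_two))
    _ = 2 ^ T.card := by rw [Real.exp_nat_mul, Real.exp_log two_pos]
    _ ≤ _ := by exact_mod_cast h1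

lemma eventually_mul_sq_le_choose_half :
    ∀ᶠ n : ℕ in atTop, 1000 * (n : ℝ) ^ 2 ≤ n.choose (n / 2) := by
  filter_upwards [eventually_pow_mul_le_pow 3 4000 (show (1 : ℝ) < 2 by norm_num),
    eventually_ge_atTop 1] with n h hn
  have h1 : (2 : ℝ) ^ n ≤ n.choose (n / 2) * (2 * n + 2) := by
    exact_mod_cast two_pow_le_choose_half n
  have hn0 : (1 : ℝ) ≤ n := by exact_mod_cast hn
  refine le_of_mul_le_mul_right (le_trans ?_ (h.trans h1)) (show (0 : ℝ) < 2 * n + 2 by positivity)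
  have : (n : ℝ) ^ 2 * 1 ≤ n ^ 2 * n := mul_le_mul_of_nonneg_left hn0 (by positivity)
  linarith

/-- Few matroids have a rank with few sets of that size. -/
lemma eventually_ncard_le_of_not_goodRank : ∀ᶠ n : ℕ in atTop, ∀ r ≤ n, ¬ GoodRank n r →
    ((matroidsOfRank (Fin n) r).ncard : ℝ) ≤ Real.exp (-(3 * n)) * (matroidsOn n).ncard := by
  filter_upwards [eventually_mul_sq_le_choose_half, eventually_ge_atTop 2] with n hN hn r hrn hr
  have hn0 : (2 : ℝ) ≤ n := by exact_mod_cast hn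
  have h1 : n ^ 2 * n.choose r < n.choose (n / 2) := by
    by_contra! h
    exact hr ⟨hrn, h⟩
  have h1' : (n : ℝ) ^ 2 * n.choose r ≤ n.choose (n / 2) := by exact_mod_cast h1.le
  obtain ⟨N, hNd⟩ : ∃ N : ℝ, N = n.choose (n / 2) := ⟨_, rfl⟩
  have h3 := exp_le_ncard_matroidsOn hn
  rw [← hNd] at hN h1' h3
  have h2 : ((matroidsOfRank (Fin n) r).ncard : ℝ) ≤ Real.exp (n.choose r * Real.log 2) := by
    rw [Real.exp_nat_mul, Real.exp_log two_pos]
    have := ncard_matroidsOfRank_le (α := Fin n) r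
    rw [Fintype.card_fin] at this
    exact_mod_cast this
  refine h2.trans (le_trans ?_ (mul_le_mul_of_nonneg_left h3 (Real.exp_pos _).le))
  rw [← Real.exp_add]
  refine Real.exp_le_exp.2 ?_
  obtain ⟨y, hy⟩ : ∃ y, y = N / n := ⟨_, rfl⟩
  have hyN : N = y * n := by rw [hy]; field_simp
  rw [← hy]
  rw [hyN] at hN h1'
  have e1 : 1000 * (n : ℝ) ≤ y := by
    refine le_of_mul_le_mul_right ?_ (show (0 : ℝ) < n by linarith)
    linarith
  have e2 : 2 * (n.choose r : ℝ) ≤ y := by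
    have : (n : ℝ) * n.choose r ≤ y := by
      refine le_of_mul_le_mul_right ?_ (show (0 : ℝ) < n by linarith)
      linarith
    have := mul_le_mul_of_nonneg_right hn0 (Nat.cast_nonneg (α := ℝ) (n.choose r))
    linarith
  have e3 := Real.log_two_gt_d9
  have e4 : (n.choose r : ℝ) * Real.log 2 ≤ y / 2 * Real.log 2 :=
    mul_le_mul_of_nonneg_right (by linarith) (by linarith)
  have e5 : y * (1 / 2) ≤ y * Real.log 2 := mul_le_mul_of_nonneg_left (by linarith) (by linarith)
  linarith

end Ranks

/-! ### Very small sets are almost always independent. -/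

section SmallDependent

/-- A is small enough to be recorded in the description, where it covers all r-sets containing it.
This is the reason for requiring log n ≤ t in `eventually_description`. -/
lemma uncovered_subset_avoiding {α : Type*} [Fintype α] [DecidableEq α] {P : Finset α → Prop}
    {r t : ℕ} {Z : Finset (Finset α × ℕ)} {A : Finset α} (hA : ¬ P A) (ht : A.card ≤ t) :
    uncovered P r t Z ⊆ avoiding r A := by
  intro X hX
  obtain ⟨h1, -, h3⟩ := mem_uncovered.1 hX
  refine Finset.mem_filter.2 ⟨Finset.mem_powersetCard.2 ⟨Finset.subset_univ _, h1⟩, fun h => ?_⟩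
  exact h3 (Or.inr (Or.inl ⟨A, mem_smallDep.2 ⟨ht, hA⟩, h⟩))

/-- The 41 is 39 + 2: the exponent s H / τ of the entropy argument is at most 39s, and replacing
binom(n-s, r-s) by binom(n, r) loses at most 5^s ≤ e^(2s). -/
lemma numStable_avoiding_le {n r s : ℕ} {A : Finset (Fin n)} (hA : A.card = s) (hs : 0 < s)
    (hn : 20 ≤ n) (hsn : 20 * s ≤ n) (hr1 : n ≤ 4 * r) (hr2 : 4 * r ≤ 3 * n)
    (hH : Real.log (numStable (Finset.powersetCard (r - s + 1) Aᶜ)) ≤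
      9 * (n - s).choose (r - s + 1) / (n - s : ℕ)) :
    (numStable (avoiding r A) : ℝ) * 2 ^ (n.choose r / n * Real.exp (-(41 * s))) ≤
      numStable (Finset.powersetCard r (Finset.univ : Finset (Fin n))) := by
  have h := numStable_avoiding_mul_le hA hs (by omega) (by rw [Fintype.card_fin]; omega) hH rfl
  rw [Fintype.card_fin] at h
  refine le_trans (mul_le_mul_of_nonneg_left ?_ (Nat.cast_nonneg _)) h
  refine Real.rpow_le_rpow_of_exponent_le one_le_two ?_
  have hn0 : (20 : ℝ) ≤ n := by exact_mod_cast hn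
  obtain ⟨c, hc⟩ : ∃ c, c = (n - s).choose (r - s) := ⟨_, rfl⟩
  obtain ⟨d, hd⟩ : ∃ d, d = (n - s).choose (r - s + 1) := ⟨_, rfl⟩
  have hcd : d * (r - s + 1) = c * (n - r) := by
    rw [hc, hd, Nat.choose_succ_right_eq]
    congr 1
    omega
  have hc0 : 0 < c := hc ▸ Nat.choose_pos (by omega)
  have hN : n.choose r ≤ 5 ^ s * c := hc ▸ le_five_pow_mul_choose s (by omega) (by omega) (by omega)
  rw [← hc, ← hd]
  have hc0' : (0 : ℝ) < c := by exact_mod_cast hc0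
  have hs0 : (0 : ℝ) < s := by exact_mod_cast hs
  have hsn' : 20 * (s : ℝ) ≤ n := by exact_mod_cast hsn
  have hr1' : (n : ℝ) ≤ 4 * r := by exact_mod_cast hr1
  have hr2' : 4 * (r : ℝ) ≤ 3 * n := by exact_mod_cast hr2
  have hns : ((n - s : ℕ) : ℝ) = n - s := Nat.cast_sub (by omega)
  have hcd' : (d : ℝ) * (r - s + 1) = c * (n - r) := by
    rw [← Nat.cast_sub (show s ≤ r by omega), ← Nat.cast_sub (show r ≤ n by omega)]
    exact_mod_cast hcd
  -- The ratio d/c is (n-r)/(r-s+1), with numerator at most 3n/4 and denominator at least n/5.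
  have hdc : (d : ℝ) ≤ 15 / 4 * c := by
    have h1 : (d : ℝ) * (n / 5) ≤ d * (r - s + 1) :=
      mul_le_mul_of_nonneg_left (by linarith) (Nat.cast_nonneg _)
    have h2 : (c : ℝ) * (n - r) ≤ c * (3 / 4 * n) :=
      mul_le_mul_of_nonneg_left (by linarith) hc0'.le
    refine le_of_mul_le_mul_right ?_ (show (0 : ℝ) < n by linarith)
    linarith
  have hquot : s * (9 * (d : ℝ) / (n - s : ℕ)) / (c / n) ≤ 39 * s := by
    rw [hns, div_le_iff₀ (by positivity), mul_assoc]
    rw [show (39 : ℝ) * (s * (c / n)) = s * (39 * c / n) by ring]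
    refine mul_le_mul_of_nonneg_left ?_ hs0.le
    rw [div_le_div_iff₀ (by linarith) (by linarith)]
    have h1 : (d : ℝ) * n ≤ 15 / 4 * c * n := mul_le_mul_of_nonneg_right hdc (by linarith)
    have h2 : (c : ℝ) * (19 / 20 * n) ≤ c * (n - s) :=
      mul_le_mul_of_nonneg_left (by linarith) hc0'.le
    have h3 : 0 ≤ (c : ℝ) * n := by positivity
    linarith
  have h5 : (5 : ℝ) ^ s ≤ Real.exp (2 * s) := by
    have h6 : (5 : ℝ) ≤ Real.exp 2 := by
      have := Real.quadratic_le_exp_of_nonneg (show (0 : ℝ) ≤ 2 by norm_num)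
      linarith
    rw [mul_comm, Real.exp_nat_mul]
    exact pow_le_pow_left₀ (by norm_num) h6 s
  have hN' : (n.choose r : ℝ) ≤ Real.exp (2 * s) * c := by
    have : (n.choose r : ℝ) ≤ 5 ^ s * c := by exact_mod_cast hN
    exact this.trans (mul_le_mul_of_nonneg_right h5 hc0'.le)
  calc (n.choose r : ℝ) / n * Real.exp (-(41 * s))
      ≤ Real.exp (2 * s) * c / n * Real.exp (-(41 * s)) := by gcongr
    _ = c / n * Real.exp (-(39 * s)) := by
        rw [show -(39 * (s : ℝ)) = 2 * s + -(41 * s) by ring, Real.exp_add]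
        ring
    _ ≤ _ := by gcongr

/-- Almost no matroid has a given very small dependent set. -/
theorem eventually_ncard_dep_le : ∀ᶠ n : ℕ in atTop, ∀ r, GoodRank n r → ∀ A : Finset (Fin n),
    0 < A.card → 656 * (A.card : ℝ) ≤ Real.log n →
    ({M ∈ matroidsOfRank (Fin n) r | ¬ M.FIndep A}.ncard : ℝ) ≤
      Real.exp (-(3 * n)) * (matroidsOn n).ncard := by
  obtain ⟨n₁, hn₁⟩ := exists_log_numStable_le
  filter_upwards [eventually_goodRank, eventually_exp_sqrt_le, eventually_description,
    eventually_ge_atTop 20, eventually_ge_atTop (2 * n₁),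
    eventually_le_rpow 10 (show (0 : ℝ) < 1 / 16 by norm_num)]
    with n hgood hE hdesc hn20 hnn₁ hw10 r hr A hA0 hAlog
  obtain ⟨hr1, hr2⟩ := hgood r hr
  obtain ⟨t, m, ht, hZ, hcov⟩ := hdesc r hr
  obtain ⟨s, hs⟩ : ∃ s, s = A.card := ⟨_, rfl⟩
  rw [← hs] at hA0 hAlog
  have hn0 : (20 : ℝ) ≤ n := by exact_mod_cast hn20
  have hlogn : Real.log n ≤ n := (Real.log_le_sub_one_of_pos (by linarith)).trans (by linarith)
  have hs0 : (0 : ℝ) < s := by exact_mod_cast hA0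
  have hsn : 20 * s ≤ n := by
    have : 20 * (s : ℝ) ≤ n := by linarith
    exact_mod_cast this
  have hst : A.card ≤ t := by
    rw [← hs]
    have : (s : ℝ) ≤ t := by linarith
    exact_mod_cast this
  have hAc : Aᶜ.card = n - s := by rw [Finset.card_compl, Fintype.card_fin, hs]
  have hH := hn₁ (Fin n) Aᶜ (r - s + 1) (by omega) (by omega) (by omega)
  rw [hAc] at hH
  have havoid := numStable_avoiding_le hs.symm hA0 hn20 hsn hr1 hr2 hH
  have hJ : (numStable (Finset.powersetCard r (Finset.univ : Finset (Fin n))) : ℝ) ≤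
      (matroidsOn n).ncard := by
    exact_mod_cast (numStable_le_ncard_matroidsOfRank (by omega)
      (by rw [Fintype.card_fin]; omega)).trans (ncard_matroidsOfRank_le_ncard n r)
  have hcount := ncard_le_of_isGoodCover (r := r) (t := t) (m := m + 2) (U := avoiding r A)
    (S := {M ∈ matroidsOfRank (Fin n) r | ¬ M.FIndep A}) (Set.sep_subset _ _)
    (fun M hM => by
      obtain ⟨Z, hZc, hZg⟩ := hZ M hM.1
      exact ⟨Z, by omega, hZg, uncovered_subset_avoiding hM.2 hst⟩)
  have hcount' : ({M ∈ matroidsOfRank (Fin n) r | ¬ M.FIndep A}.ncard : ℝ) ≤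
      (numCovers (Fin n) r (m + 2) : ℝ) * (2 ^ numSmall (Fin n) t * 2 ^ numSmall (Fin n) t) *
        numStable (avoiding r A) := by
    rw [mul_assoc]
    exact_mod_cast hcount
  have hNE := hr.mul_le_choose (by omega) hE
  obtain ⟨N, hN⟩ : ∃ N : ℝ, N = ((n.choose r : ℕ) : ℝ) := ⟨_, rfl⟩
  rw [← hN] at hNE hcov havoid
  have hexp1 : 1 ≤ Real.exp (√n * Real.log (n + 1)) :=
    Real.one_le_exp (mul_nonneg (Real.sqrt_nonneg _) (Real.log_nonneg (by linarith)))
  have hN4 : 100 * (n : ℝ) ^ 4 ≤ N := by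
    refine le_trans ?_ hNE
    gcongr
    linarith
  have hN0 : 0 < N := lt_of_lt_of_le (by positivity) hN4
  -- Since 656 = 16 * 41, the bound on |A| gives e^(-41s) ≥ 1/w. The gain is thus of order z = N/(n
  -- w), while the description costs N n^(-9/8) = z/w.
  obtain ⟨w, hw⟩ : ∃ w : ℝ, w = (n : ℝ) ^ (1 / 16 : ℝ) := ⟨_, rfl⟩
  rw [← hw] at hw10
  have hwn : w ≤ n := by
    rw [hw]
    calc (n : ℝ) ^ (1 / 16 : ℝ) ≤ (n : ℝ) ^ (1 : ℝ) :=
          Real.rpow_le_rpow_of_exponent_le (by linarith) (by norm_num)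
      _ = n := Real.rpow_one _
  have hw98 : (n : ℝ) ^ (-(9 / 8) : ℝ) = 1 / (n * w ^ 2) := by
    rw [Real.rpow_neg (by linarith), one_div, hw, ← Real.rpow_natCast, ← Real.rpow_mul (by linarith),
      ← Real.rpow_one_add' (by linarith) (by norm_num)]
    norm_num
  have hexpw : 1 / w ≤ Real.exp (-(41 * s)) := by
    rw [Real.exp_neg, ← one_div]
    refine one_div_le_one_div_of_le (Real.exp_pos _) ?_
    rw [hw, Real.rpow_def_of_pos (by linarith)]
    refine Real.exp_le_exp.2 ?_
    linarith
  obtain ⟨z, hz⟩ : ∃ z : ℝ, z = N / (n * w) := ⟨_, rfl⟩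
  have hz3 : 100 * (n : ℝ) ≤ z := by
    rw [hz, le_div_iff₀ (by positivity)]
    refine le_trans ?_ hN4
    calc 100 * (n : ℝ) * (n * w) ≤ 100 * n * (n * n) := by gcongr
      _ ≤ 100 * n * (n * n) * n := le_mul_of_one_le_right (by positivity) (by linarith)
      _ = _ := by ring
  have hloss : N * (n : ℝ) ^ (-(9 / 8) : ℝ) ≤ z / 10 := by
    have : N * (n : ℝ) ^ (-(9 / 8) : ℝ) = z / w := by
      rw [hw98, hz]
      field_simp
    rw [this]
    exact div_le_div_of_nonneg_left (by linarith) (by norm_num) hw10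
  have hgain : Real.exp (z / 2) ≤ 2 ^ (N / n * Real.exp (-(41 * s))) := by
    rw [Real.rpow_def_of_pos two_pos]
    refine Real.exp_le_exp.2 ?_
    have h1 : z ≤ N / n * Real.exp (-(41 * s)) := by
      calc z = N / n * (1 / w) := by rw [hz]; field_simp
        _ ≤ _ := by gcongr
    have h2 := Real.log_two_gt_d9
    have h3 : (1 / 2 : ℝ) * z ≤ Real.log 2 * (N / n * Real.exp (-(41 * s))) :=
      mul_le_mul (by linarith) h1 (by linarith) (by linarith)
    linarith
  have hav : (numStable (avoiding r A) : ℝ) ≤ Real.exp (-(z / 2)) * (matroidsOn n).ncard := by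
    have h1 := (mul_le_mul_of_nonneg_left hgain
      (Nat.cast_nonneg (numStable (avoiding r A)))).trans (havoid.trans hJ)
    calc (numStable (avoiding r A) : ℝ) =
          Real.exp (-(z / 2)) * (numStable (avoiding r A) * Real.exp (z / 2)) := by
          rw [Real.exp_neg]
          field_simp
      _ ≤ _ := mul_le_mul_of_nonneg_left h1 (Real.exp_pos _).le
  calc ({M ∈ matroidsOfRank (Fin n) r | ¬ M.FIndep A}.ncard : ℝ)
      ≤ Real.exp (N * (n : ℝ) ^ (-(9 / 8) : ℝ)) *
        (Real.exp (-(z / 2)) * (matroidsOn n).ncard) :=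
        hcount'.trans (mul_le_mul hcov hav (Nat.cast_nonneg _) (Real.exp_pos _).le)
    _ = Real.exp (N * (n : ℝ) ^ (-(9 / 8) : ℝ) + -(z / 2)) * (matroidsOn n).ncard := by
        rw [Real.exp_add, mul_assoc]
    _ ≤ _ := by
        refine mul_le_mul_of_nonneg_right (Real.exp_le_exp.2 ?_) (Nat.cast_nonneg _)
        linarith

end SmallDependent

/-! ### Duality: very small sets are almost always coindependent. -/

section SmallCodependent

lemma GoodRank.symm {n r : ℕ} (h : GoodRank n r) : GoodRank n (n - r) :=
  ⟨Nat.sub_le _ _, by rw [Nat.choose_symm h.1]; exact h.2⟩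

lemma dual_mem_matroidsOfRank {n r : ℕ} {M : Matroid (Fin n)} (hM : M ∈ matroidsOfRank (Fin n) r) :
    M✶ ∈ matroidsOfRank (Fin n) (n - r) := by
  refine ⟨hM.1, ?_⟩
  have h := M.eRank_add_eRank_dual
  rw [hM.1, hM.2, Set.encard_univ, ENat.card_eq_coe_fintype_card, Fintype.card_fin] at h
  have hfin : M✶.eRank ≠ ⊤ := by
    intro h1
    rw [h1] at h
    simp at h
  lift M✶.eRank to ℕ using hfin with k
  have h2 : r + k = n := by exact_mod_cast h
  have : k = n - r := by omega
  exact_mod_cast this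

/-- Almost no matroid has a given very small codependent set. -/
theorem eventually_ncard_codep_le : ∀ᶠ n : ℕ in atTop, ∀ r, GoodRank n r →
    ∀ A : Finset (Fin n), 0 < A.card → 656 * (A.card : ℝ) ≤ Real.log n →
    ({M ∈ matroidsOfRank (Fin n) r | ¬ M✶.FIndep A}.ncard : ℝ) ≤
      Real.exp (-(3 * n)) * (matroidsOn n).ncard := by
  filter_upwards [eventually_ncard_dep_le] with n h r hr A hA hlog
  refine le_trans ?_ (h (n - r) hr.symm A hA hlog)
  refine Nat.cast_le.2 (Set.ncard_le_ncard_of_injOn Matroid.dual ?_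
    (Matroid.dual_injective.injOn) ((finite_matroidsOfRank _).subset (Set.sep_subset _ _)))
  intro M hM
  exact ⟨dual_mem_matroidsOfRank hM.1, hM.2⟩

end SmallCodependent

/-! ### Separations with two large sides. -/

section Separations

/-- The `r`-sets with at most `a` elements in `A` and at most `b` elements outside `A`. -/
def separatedFamily {α : Type*} [Fintype α] [DecidableEq α] (r : ℕ) (A : Finset α) (a b : ℕ) :
    Finset (Finset α) :=
  (Finset.powersetCard r Finset.univ).filter fun X => (X ∩ A).card ≤ a ∧ (X ∩ Aᶜ).card ≤ b

lemma uncovered_subset_separatedFamily {α : Type*} [Fintype α] [DecidableEq α]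
    {P : Finset α → Prop} {r t a b : ℕ} {Z : Finset (Finset α × ℕ)} {A : Finset α}
    (ha : (A, a) ∈ Z) (hb : (Aᶜ, b) ∈ Z) : uncovered P r t Z ⊆ separatedFamily r A a b := by
  intro X hX
  obtain ⟨h1, -, h3⟩ := mem_uncovered.1 hX
  refine Finset.mem_filter.2 ⟨Finset.mem_powersetCard.2 ⟨Finset.subset_univ _, h1⟩, ?_, ?_⟩
  · by_contra! h
    exact h3 (Or.inl ⟨_, ha, h⟩)
  · by_contra! h
    exact h3 (Or.inl ⟨_, hb, h⟩)

/-- The possible intersections of members of `separatedFamily r A a b` with `A`. -/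
def separatedTraces {α : Type*} [DecidableEq α] (r : ℕ) (A : Finset α) (a b : ℕ) :
    Finset (Finset α) :=
  A.powerset.filter fun Q => r ≤ Q.card + b ∧ Q.card ≤ a

/-- The size of a trace lies between r - b and a, an interval of at most k integers. -/
lemma card_separatedTraces_le {α : Type*} [DecidableEq α] {r : ℕ} {A : Finset α} {a b k : ℕ}
    (hb : b ≤ r) (hk : a + b < r + k) :
    (separatedTraces r A a b).card ≤ k * A.card.choose (A.card / 2) := by
  have h1 : separatedTraces r A a b ⊆
      (Finset.Icc (r - b) a).biUnion fun q => Finset.powersetCard q A := by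
    intro Q hQ
    obtain ⟨h1, h2, h3⟩ := Finset.mem_filter.1 hQ
    rw [Finset.mem_biUnion]
    refine ⟨Q.card, Finset.mem_Icc.2 ⟨by omega, h3⟩, ?_⟩
    exact Finset.mem_powersetCard.2 ⟨Finset.mem_powerset.1 h1, rfl⟩
  refine (Finset.card_le_card h1).trans ((Finset.card_biUnion_le_card_mul _ _
    (A.card.choose (A.card / 2)) ?_).trans ?_)
  · intro q _
    rw [Finset.card_powersetCard]
    exact Nat.choose_le_middle _ _
  · refine Nat.mul_le_mul_right _ ?_
    rw [Nat.card_Icc]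
    omega

/-- Group the members by their trace on A; each group embeds into a Johnson graph on the complement,
and the counts multiply. -/
lemma log_numStable_separatedFamily_le {α : Type*} [Fintype α] [DecidableEq α] {r : ℕ}
    {A : Finset α} {a b : ℕ} {H : ℝ}
    (hH : ∀ q, Real.log (numStable (Finset.powersetCard q Aᶜ)) ≤ H) :
    Real.log (numStable (separatedFamily r A a b)) ≤ (separatedTraces r A a b).card * H := by
  have h1 : separatedFamily r A a b ⊆ (separatedTraces r A a b).biUnion fun Q =>
      (Finset.powersetCard (r - Q.card) Aᶜ).image (Q ∪ ·) := by
    intro X hX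
    obtain ⟨h1, h2, h3⟩ := Finset.mem_filter.1 hX
    have hXr := (Finset.mem_powersetCard.1 h1).2
    have hXc : (X ∩ A).card + (X ∩ Aᶜ).card = r := by
      rw [← hXr, ← Finset.sdiff_eq_inter_compl, Finset.card_inter_add_card_sdiff]
    rw [Finset.mem_biUnion]
    refine ⟨X ∩ A, Finset.mem_filter.2 ⟨Finset.mem_powerset.2 Finset.inter_subset_right,
      by omega, h2⟩, Finset.mem_image.2 ⟨X ∩ Aᶜ, ?_, ?_⟩⟩
    · exact Finset.mem_powersetCard.2 ⟨Finset.inter_subset_right, by omega⟩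
    · rw [← Finset.inter_union_distrib_left, Finset.union_compl, Finset.inter_univ]
  have h2 : numStable (separatedFamily r A a b) ≤
      ∏ Q ∈ separatedTraces r A a b, numStable (Finset.powersetCard (r - Q.card) Aᶜ) := by
    refine (numStable_mono h1).trans ((numStable_biUnion_le _ _).trans ?_)
    refine Finset.prod_le_prod' fun Q hQ => numStable_image_union_le _ _ _ ?_
    have := Finset.mem_powerset.1 (Finset.mem_filter.1 hQ).1
    exact (disjoint_compl_right (a := A)).mono_left this
  have h3 : (numStable (separatedFamily r A a b) : ℝ) ≤
      ∏ Q ∈ separatedTraces r A a b, (numStable (Finset.powersetCard (r - Q.card) Aᶜ) : ℝ) := by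
    exact_mod_cast h2
  refine (Real.log_le_log (by exact_mod_cast numStable_pos _) h3).trans ?_
  rw [Real.log_prod (fun Q _ => by exact_mod_cast (numStable_pos _).ne'), ← nsmul_eq_mul]
  exact Finset.sum_le_card_nsmul _ _ _ fun Q _ => hH _

lemma choose_half_mul_sqrt_le (m : ℕ) : (m.choose (m / 2) : ℝ) * √m ≤ 2 ^ m := by
  have h : (m.choose (m / 2) : ℝ) ^ 2 * (m + 1) ≤ 4 ^ m := by
    exact_mod_cast choose_half_sq_mul_le m
  refine abs_le_of_sq_le_sq' ?_ (by positivity) |>.2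
  rw [mul_pow, Real.sq_sqrt (Nat.cast_nonneg _), ← pow_mul, mul_comm m 2, pow_mul]
  norm_num
  nlinarith [sq_nonneg (m.choose (m / 2) : ℝ)]

lemma two_pow_le_choose_half_mul_sqrt {m : ℕ} (hm : 1 ≤ m) :
    (2 : ℝ) ^ m ≤ m.choose (m / 2) * (2 * √m) := by
  have h : (4 : ℝ) ^ m ≤ (m.choose (m / 2) : ℝ) ^ 2 * (2 * m + 2) := by
    exact_mod_cast le_choose_half_sq_mul hm
  have hm1 : (1 : ℝ) ≤ m := by exact_mod_cast hm
  refine abs_le_of_sq_le_sq' ?_ (by positivity) |>.2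
  rw [mul_pow, mul_pow, Real.sq_sqrt (Nat.cast_nonneg _), ← pow_mul, mul_comm m 2, pow_mul]
  norm_num
  nlinarith [sq_nonneg (m.choose (m / 2) : ℝ)]

/-- With s = |A| and p = n - s ≥ n/2, there are at most k 2^s/√s ≤ 2^s/510 traces, each contributing
about 9 * 2^p/p^(3/2) at most. The product is a small multiple of 2^n/n^(3/2), hence of binom(n,
n/2)/n. The factor 1/5 stays below log 2 with room for the description cost. -/
lemma exists_log_numStable_separatedFamily_le : ∃ n₂ : ℕ, ∀ n r : ℕ, n₂ ≤ n →
    ∀ A : Finset (Fin n), 2 * A.card ≤ n → ∀ k a b : ℕ, 510 * (k : ℝ) ≤ √A.card → b ≤ r →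
    a + b < r + k →
    Real.log (numStable (separatedFamily r A a b)) ≤ (n.choose (n / 2) : ℝ) / n / 5 := by
  obtain ⟨n₁, hn₁⟩ := exists_log_numStable_le'
  obtain ⟨n₃, hn₃⟩ := eventually_atTop.1
    (eventually_pow_mul_le_pow 2 100 (show (1 : ℝ) < 10 / 9 by norm_num))
  refine ⟨2 * n₁ + 2 * n₃ + 1, fun n r hn A hA k a b hk hb hab => ?_⟩
  obtain ⟨s, hs⟩ : ∃ s, s = A.card := ⟨_, rfl⟩
  obtain ⟨p, hp⟩ : ∃ p, p = n - s := ⟨_, rfl⟩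
  have hAc : Aᶜ.card = p := by rw [Finset.card_compl, Fintype.card_fin, ← hs, hp]
  rw [← hs] at hA hk
  have hH := log_numStable_separatedFamily_le (r := r) (A := A) (a := a) (b := b)
    fun q => hn₁ (Fin n) Aᶜ q (by omega)
  rw [hAc] at hH
  refine hH.trans ?_
  have hcard := card_separatedTraces_le (A := A) hb hab
  rw [← hs] at hcard
  have hn0 : (1 : ℝ) ≤ n := by exact_mod_cast (by omega : 1 ≤ n)
  have hnp : (n : ℝ) ≤ 2 * p := by exact_mod_cast (by omega : n ≤ 2 * p)
  have hp0 : (0 : ℝ) < p := by linarith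
  obtain ⟨c, hc⟩ : ∃ c : ℝ, c = (separatedTraces r A a b).card := ⟨_, rfl⟩
  have hc0 : 0 ≤ c := hc ▸ Nat.cast_nonneg _
  rw [← hc]
  have h1 : 510 * c ≤ 2 ^ s := by
    have h2 : c ≤ k * s.choose (s / 2) := by rw [hc]; exact_mod_cast hcard
    have h3 := choose_half_mul_sqrt_le s
    have h4 := mul_le_mul_of_nonneg_left hk (Nat.cast_nonneg (α := ℝ) (s.choose (s / 2)))
    linarith
  have h2n : (2 : ℝ) ^ n = 2 ^ s * 2 ^ p := by rw [← pow_add]; congr 1; omega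
  have hmid := two_pow_le_choose_half_mul_sqrt (show 1 ≤ n by omega)
  obtain ⟨x, hx⟩ : ∃ x : ℝ, x = √n := ⟨_, rfl⟩
  obtain ⟨y, hy⟩ : ∃ y : ℝ, y = √p := ⟨_, rfl⟩
  have hx2 : x * x = n := by rw [hx]; exact Real.mul_self_sqrt (by linarith)
  have hy2 : y * y = p := by rw [hy]; exact Real.mul_self_sqrt (by linarith)
  have hx1 : 1 ≤ x := by rw [hx]; exact Real.one_le_sqrt.2 hn0
  have hy0 : 0 ≤ y := hy ▸ Real.sqrt_nonneg _
  have hxy : x ≤ 3 / 2 * y := by nlinarith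
  have hypos : 0 < y := by linarith
  rw [← hx] at hmid
  have hpc := choose_half_mul_sqrt_le p
  rw [← hy] at hpc
  obtain ⟨T, hT⟩ : ∃ T : ℝ, T = 2 ^ n / (x * x * x) := ⟨_, rfl⟩
  have hT0 : 0 ≤ T := by rw [hT]; positivity
  have hTN : T ≤ 2 * ((n.choose (n / 2) : ℝ) / n) := by
    rw [hT, ← hx2, div_le_iff₀ (by positivity)]
    refine hmid.trans (le_of_eq ?_)
    field_simp
  have e1 : c * (9 * p.choose (p / 2) / p) ≤ 60 / 510 * T / 2 := by
    have h3 : (p.choose (p / 2) : ℝ) / p ≤ 2 ^ p / (y * y * y) := by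
      rw [← hy2, div_le_div_iff₀ (by positivity) (by positivity)]
      have := mul_le_mul_of_nonneg_right hpc (mul_nonneg hy0 hy0)
      linarith
    have h4 : 510 * (c * ((p.choose (p / 2) : ℝ) / p)) ≤ 2 ^ n / (y * y * y) := by
      rw [h2n, mul_div_assoc, ← mul_assoc]
      exact mul_le_mul h1 h3 (by positivity) (by positivity)
    have h5 : (2 : ℝ) ^ n / (y * y * y) ≤ 10 / 3 * T := by
      have h8 : 10 / 3 * T = 2 ^ n / (3 / 10 * (x * x * x)) := by
        rw [hT]
        field_simp
      rw [h8]
      refine div_le_div_of_nonneg_left (by positivity) (by positivity) ?_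
      rw [hx2]
      have h6 : (n : ℝ) * x ≤ (2 * (y * y)) * (3 / 2 * y) :=
        mul_le_mul (by linarith) hxy (by linarith) (by positivity)
      have h7 : 0 ≤ y * y * y := by positivity
      linarith
    have : 9 * (c * ((p.choose (p / 2) : ℝ) / p)) ≤ 9 / 510 * (10 / 3 * T) := by linarith
    calc c * (9 * p.choose (p / 2) / p) = 9 * (c * ((p.choose (p / 2) : ℝ) / p)) := by ring
      _ ≤ _ := by linarith
  have e2 : c * (9 / 5) ^ p ≤ T / 510 := by
    have h3 := hn₃ p (by omega)
    have h4 : 100 * ((p : ℝ) ^ 2 * (9 / 5) ^ p) ≤ 2 ^ p := by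
      have : (2 : ℝ) ^ p = (10 / 9) ^ p * (9 / 5) ^ p := by rw [← mul_pow]; norm_num
      rw [this, ← mul_assoc]
      exact mul_le_mul_of_nonneg_right h3 (by positivity)
    have h5 : 510 * (c * (100 * ((p : ℝ) ^ 2 * (9 / 5) ^ p))) ≤ 2 ^ n := by
      rw [h2n, ← mul_assoc]
      exact mul_le_mul h1 h4 (by positivity) (by positivity)
    rw [hT, div_div, le_div_iff₀ (by positivity)]
    refine le_trans ?_ h5
    have h6 : x * x * x ≤ 100 * (p : ℝ) ^ 2 := by
      have h7 : x * x * x ≤ (2 * (p : ℝ)) * (2 * p) := by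
        refine mul_le_mul (by linarith) ?_ (by linarith) (by positivity)
        nlinarith
      nlinarith
    have h8 := mul_le_mul_of_nonneg_left h6 (show 0 ≤ c * (9 / 5) ^ p by positivity)
    linarith
  have e3 : c * (9 * p.choose (p / 2) / p + (9 / 5) ^ p) =
    c * (9 * p.choose (p / 2) / p) + c * (9 / 5) ^ p := by ring
  rw [e3]
  have : 0 ≤ (n.choose (n / 2) : ℝ) / n := by positivity
  linarith

/-- Almost no matroid has a given separation of small order into two large sets. -/
theorem eventually_ncard_separation_le : ∀ᶠ n : ℕ in atTop, ∀ r, GoodRank n r →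
    ∀ A : Finset (Fin n), 2 * A.card ≤ n → ∀ k a b : ℕ, 510 * (k : ℝ) ≤ √A.card → a ≤ r → b ≤ r →
    a + b < r + k →
    ({M ∈ matroidsOfRank (Fin n) r | RankPair M.FIndep (A, a) ∧ RankPair M.FIndep (Aᶜ, b)}.ncard
      : ℝ) ≤ Real.exp (-(3 * n)) * (matroidsOn n).ncard := by
  obtain ⟨n₂, hn₂⟩ := exists_log_numStable_separatedFamily_le
  filter_upwards [eventually_description, eventually_ge_atTop n₂, eventually_ge_atTop 2,
    eventually_le_rpow 10 (show (0 : ℝ) < 1 / 8 by norm_num), eventually_mul_sq_le_choose_half]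
    with n hdesc hnn₂ hn2 hy10 hmid r hr A hA k a b hk ha hb hab
  obtain ⟨t, m, -, hZ, hcov⟩ := hdesc r hr
  have hn0 : (2 : ℝ) ≤ n := by exact_mod_cast hn2
  have hlog := hn₂ n r hnn₂ A hA k a b hk hb hab
  obtain ⟨S, hS⟩ : ∃ S, S = {M ∈ matroidsOfRank (Fin n) r | RankPair M.FIndep (A, a) ∧
    RankPair M.FIndep (Aᶜ, b)} := ⟨_, rfl⟩
  rw [← hS]
  have hcount := ncard_le_of_isGoodCover (r := r) (t := t) (m := m + 2)
    (U := separatedFamily r A a b) (S := S) (hS ▸ Set.sep_subset _ _)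
    (fun M hM => by
      rw [hS] at hM
      obtain ⟨Z, hZc, hZg⟩ := hZ M hM.1
      -- Recording the two rank bounds of the separation confines the uncovered sets; this uses up
      -- the 2 in m + 2.
      refine ⟨Z ∪ {(A, a), (Aᶜ, b)}, ?_, hZg.union ?_, ?_⟩
      · refine (Finset.card_union_le _ _).trans (Nat.add_le_add hZc Finset.card_le_two)
      · intro p hp
        rw [Finset.mem_insert, Finset.mem_singleton] at hp
        rcases hp with rfl | rfl
        · exact ⟨hM.2.1, ha⟩
        · exact ⟨hM.2.2, hb⟩
      · exact uncovered_subset_separatedFamily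
          (Finset.mem_union_right _ (Finset.mem_insert_self _ _))
          (Finset.mem_union_right _ (Finset.mem_insert_of_mem (Finset.mem_singleton_self _))))
  have hcount' : (S.ncard : ℝ) ≤
      (numCovers (Fin n) r (m + 2) : ℝ) * (2 ^ numSmall (Fin n) t * 2 ^ numSmall (Fin n) t) *
        numStable (separatedFamily r A a b) := by
    rw [mul_assoc]
    exact_mod_cast hcount
  have hm := exp_le_ncard_matroidsOn hn2
  have hNm : (n.choose r : ℝ) ≤ n.choose (n / 2) := by exact_mod_cast Nat.choose_le_middle r n
  obtain ⟨z, hz⟩ : ∃ z : ℝ, z = (n.choose (n / 2) : ℝ) / n := ⟨_, rfl⟩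
  rw [← hz] at hm hlog
  have hzN : (n.choose (n / 2) : ℝ) = z * n := by rw [hz]; field_simp
  have hz1 : 1000 * (n : ℝ) ≤ z := by
    rw [hz, le_div_iff₀ (by linarith)]
    linarith
  have hst : (numStable (separatedFamily r A a b) : ℝ) ≤ Real.exp (z / 5) := by
    rw [← Real.log_le_iff_le_exp (by exact_mod_cast numStable_pos _)]
    exact hlog
  have hloss : n.choose r * (n : ℝ) ^ (-(9 / 8) : ℝ) ≤ z / 10 := by
    have h1 : (n : ℝ) ^ (-(9 / 8) : ℝ) = 1 / (n * (n : ℝ) ^ (1 / 8 : ℝ)) := by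
      rw [Real.rpow_neg (by linarith), one_div,
        ← Real.rpow_one_add' (by linarith) (by norm_num)]
      norm_num
    have h2 : (n : ℝ) ^ (-(9 / 8) : ℝ) ≤ 1 / (n * 10) := by
      rw [h1]
      exact one_div_le_one_div_of_le (by linarith)
        (mul_le_mul_of_nonneg_left hy10 (by linarith))
    calc n.choose r * (n : ℝ) ^ (-(9 / 8) : ℝ) ≤ z * n * (1 / (n * 10)) :=
          mul_le_mul (hNm.trans hzN.le) h2 (by positivity) (by nlinarith)
      _ = z / 10 := by field_simp
  calc (S.ncard : ℝ) ≤ Real.exp (n.choose r * (n : ℝ) ^ (-(9 / 8) : ℝ)) * Real.exp (z / 5) :=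
        hcount'.trans (mul_le_mul hcov hst (Nat.cast_nonneg _) (Real.exp_pos _).le)
    _ ≤ Real.exp (-(3 * n)) * Real.exp (Real.log 2 * z) := by
        rw [← Real.exp_add, ← Real.exp_add]
        refine Real.exp_le_exp.2 ?_
        have h2 := Real.log_two_gt_d9
        have h3 : (1 / 2 : ℝ) * z ≤ Real.log 2 * z :=
          mul_le_mul_of_nonneg_right (by linarith) (by linarith)
        linarith
    _ ≤ _ := mul_le_mul_of_nonneg_left hm (Real.exp_pos _).le

end Separations

/-! ### Passing between counts and asymptotic statements. -/

section AlmostAll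

lemma ncard_matroidsOn_pos (n : ℕ) : 0 < (matroidsOn n).ncard :=
  (Set.ncard_pos (matroidsOn_finite n)).2 ⟨Matroid.freeOn Set.univ, rfl⟩

lemma almostAllMatroids_of_eventually {P : (n : ℕ) → Matroid (Fin n) → Prop}
    (h : ∀ᶠ n : ℕ in atTop, ({M ∈ matroidsOn n | ¬ P n M}.ncard : ℝ) ≤
      1 / n * (matroidsOn n).ncard) : AlmostAllMatroids P := by
  have h1 : Tendsto (fun n : ℕ => 1 - 1 / (n : ℝ)) atTop (𝓝 1) := by
    simpa using (tendsto_const_nhds (x := (1 : ℝ))).sub tendsto_one_div_atTop_nhds_zero_nat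
  refine tendsto_of_tendsto_of_tendsto_of_le_of_le' h1 tendsto_const_nhds ?_ ?_
  · filter_upwards [h] with n hn
    have hpos : (0 : ℝ) < (matroidsOn n).ncard := by exact_mod_cast ncard_matroidsOn_pos n
    rw [le_div_iff₀ hpos]
    have h2 : (matroidsOn n).ncard ≤
        {M ∈ matroidsOn n | P n M}.ncard + {M ∈ matroidsOn n | ¬ P n M}.ncard := by
      refine le_trans (Set.ncard_le_ncard ?_ ?_) (Set.ncard_union_le _ _)
      · intro M hM
        by_cases hP : P n M
        · exact Or.inl ⟨hM, hP⟩
        · exact Or.inr ⟨hM, hP⟩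
      · exact ((matroidsOn_finite n).subset (Set.sep_subset _ _)).union
          ((matroidsOn_finite n).subset (Set.sep_subset _ _))
    have h3 : ((matroidsOn n).ncard : ℝ) ≤
        {M ∈ matroidsOn n | P n M}.ncard + {M ∈ matroidsOn n | ¬ P n M}.ncard := by
      exact_mod_cast h2
    linarith
  · refine Eventually.of_forall fun n => div_le_one_of_le₀ ?_ (Nat.cast_nonneg _)
    exact_mod_cast Set.ncard_le_ncard (Set.sep_subset _ _) (matroidsOn_finite n)

lemma AlmostAllMatroids.mono {P Q : (n : ℕ) → Matroid (Fin n) → Prop} (h : AlmostAllMatroids P)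
    (hPQ : ∀ᶠ n in atTop, ∀ M, P n M → Q n M) : AlmostAllMatroids Q := by
  refine tendsto_of_tendsto_of_tendsto_of_le_of_le' h tendsto_const_nhds ?_ ?_
  · filter_upwards [hPQ] with n hn
    refine div_le_div_of_nonneg_right ?_ (Nat.cast_nonneg _)
    have hsub : {M ∈ matroidsOn n | P n M} ⊆ {M ∈ matroidsOn n | Q n M} :=
      fun M hM => ⟨hM.1, hn M hM.2⟩
    exact_mod_cast Set.ncard_le_ncard hsub ((matroidsOn_finite n).subset (Set.sep_subset _ _))
  · refine Eventually.of_forall fun n => div_le_one_of_le₀ ?_ (Nat.cast_nonneg _)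
    exact_mod_cast Set.ncard_le_ncard (Set.sep_subset _ _) (matroidsOn_finite n)

lemma exists_mem_matroidsOfRank {n : ℕ} {M : Matroid (Fin n)} (hM : M ∈ matroidsOn n) :
    ∃ r ≤ n, M ∈ matroidsOfRank (Fin n) r := by
  have h := M.eRank_le_encard_ground
  rw [show M.E = Set.univ from hM, Set.encard_univ, ENat.card_eq_coe_fintype_card,
    Fintype.card_fin] at h
  obtain ⟨r, hr⟩ := ENat.ne_top_iff_exists.1 (ne_top_of_le_ne_top (ENat.natCast_ne_top n) h)
  rw [← hr] at h
  exact ⟨r, by exact_mod_cast h, hM, hr.symm⟩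

end AlmostAll

/-! ### Connectivity of non-exceptional matroids and the union bound. -/

section Connectivity

lemma Matroid.IsKSeparation.symm {α : Type*} {M : Matroid α} {k : ℕ} {A B : Set α}
    (h : M.IsKSeparation k A B) : M.IsKSeparation k B A := by
  obtain ⟨h1, h2, h3, h4, h5, h6⟩ := h
  exact ⟨h1, Set.union_comm A B ▸ h2, h3.symm, add_comm (M.eRk A) (M.eRk B) ▸ h4, h6, h5⟩

lemma rankPair_of_eRk_le {α : Type*} {M : Matroid α} {A : Finset α} {a : ℕ}
    (h : M.eRk (A : Set α) ≤ a) : RankPair M.FIndep (A, a) := by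
  intro I hI hMI
  have h1 := (Matroid.Indep.encard_le_eRk_of_subset hMI (Finset.coe_subset.2 hI)).trans h
  rw [Set.encard_coe_eq_coe_finsetCard] at h1
  exact_mod_cast h1

/-- The origin of 1/40000: since log n ≥ (1/2) log₂ n, the claim needs 510^2 * 2 * 656 ≤ 40000^2. -/
lemma mul_natCast_le_sqrt {n s j : ℕ} (hn : 1 ≤ n) (hs : Real.log n < 656 * s)
    (hj : (j : ℝ) < 1 / 40000 * √(Real.logb 2 n)) : 510 * (j : ℝ) ≤ √s := by
  refine Real.le_sqrt_of_sq_le ?_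
  have hn0 : (1 : ℝ) ≤ n := by exact_mod_cast hn
  have hl : 0 ≤ Real.logb 2 n := Real.logb_nonneg one_lt_two hn0
  have h1 : (j : ℝ) ^ 2 ≤ (1 / 40000 * √(Real.logb 2 n)) ^ 2 :=
    pow_le_pow_left₀ (Nat.cast_nonneg _) hj.le 2
  rw [mul_pow, Real.sq_sqrt hl] at h1
  have h2 : Real.logb 2 n * Real.log 2 = Real.log n := by
    rw [Real.logb, div_mul_cancel₀]
    exact (Real.log_pos one_lt_two).ne'
  have h3 := Real.log_two_gt_d9
  have h4 : Real.logb 2 n * (1 / 2) ≤ Real.logb 2 n * Real.log 2 :=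
    mul_le_mul_of_nonneg_left (by linarith) hl
  rw [mul_pow]
  linarith

lemma le_of_isKSeparation {n r : ℕ} (hn : 1 ≤ n) {M : Matroid (Fin n)}
    (hM : M ∈ matroidsOfRank (Fin n) r)
    (hdep : ∀ A : Finset (Fin n), 0 < A.card → 656 * (A.card : ℝ) ≤ Real.log n → M.FIndep A)
    (hcodep : ∀ A : Finset (Fin n), 0 < A.card → 656 * (A.card : ℝ) ≤ Real.log n → M✶.FIndep A)
    (hsep : ∀ (A : Finset (Fin n)) (k a b : ℕ), 2 * A.card ≤ n → 510 * (k : ℝ) ≤ √A.card →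
      a ≤ r → b ≤ r → a + b < r + k → RankPair M.FIndep (A, a) → ¬ RankPair M.FIndep (Aᶜ, b))
    {j : ℕ} {X Y : Set (Fin n)} (h : M.IsKSeparation j X Y) :
    1 / 40000 * √(Real.logb 2 n) ≤ j := by
  by_contra! hj
  obtain ⟨A, hA, hAn⟩ : ∃ A : Finset (Fin n), M.IsKSeparation j A (Aᶜ : Finset (Fin n)) ∧
      2 * A.card ≤ n := by
    have hXY : ∀ {X Y : Set (Fin n)}, M.IsKSeparation j X Y → Y = Xᶜ := fun h =>
      (IsCompl.of_eq h.2.2.1.inter_eq (h.2.1.trans hM.1)).compl_eq.symm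
    have hsplit : X.toFinite.toFinset.card + X.toFinite.toFinsetᶜ.card = n := by
      rw [Finset.card_add_card_compl, Fintype.card_fin]
    have hYX := hXY h
    subst hYX
    by_cases hc : 2 * X.toFinite.toFinset.card ≤ n
    · exact ⟨X.toFinite.toFinset, by simpa using h, hc⟩
    · exact ⟨X.toFinite.toFinsetᶜ, by simpa using h.symm, by omega⟩
  obtain ⟨hj1, -, -, hr, hjA, -⟩ := hA
  have hfin : ∀ Z : Set (Fin n), ∃ a : ℕ, M.eRk Z = a ∧ a ≤ r := by
    intro Z
    have h1 := M.eRk_le_eRank Z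
    rw [hM.2] at h1
    obtain ⟨a, ha⟩ := ENat.ne_top_iff_exists.1 (ne_top_of_le_ne_top (ENat.natCast_ne_top r) h1)
    rw [← ha] at h1
    exact ⟨a, ha.symm, by exact_mod_cast h1⟩
  obtain ⟨a, ha, har⟩ := hfin A
  obtain ⟨b, hb, hbr⟩ := hfin (Aᶜ : Finset (Fin n))
  rw [ha, hb, hM.2] at hr
  rw [Set.encard_coe_eq_coe_finsetCard] at hjA
  have hr' : a + b < r + j := by exact_mod_cast hr
  have hjA' : j ≤ A.card := by exact_mod_cast hjA
  by_cases hlog : 656 * (A.card : ℝ) ≤ Real.log n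
  · have h1 := hdep A (by omega) hlog
    have h2 := hcodep A (by omega) hlog
    have ha' : a = A.card := by
      have := Matroid.Indep.eRk_eq_encard h1
      rw [ha, Set.encard_coe_eq_coe_finsetCard] at this
      exact_mod_cast this
    -- A coindependent A misses a basis, so its complement has full rank and the two ranks sum to
    -- |A| + r ≥ j + r.
    obtain ⟨-, B, hB, hdisj⟩ := Matroid.dual_indep_iff_exists'.1 h2
    have hb' : r ≤ b := by
      have h3 : M.eRk B ≤ M.eRk (Aᶜ : Finset (Fin n)) := by
        refine M.eRk_mono ?_
        rw [Finset.coe_compl]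
        exact hdisj.subset_compl_left
      rw [hB.eRk_eq_eRank, hM.2, hb] at h3
      exact_mod_cast h3
    omega
  · push Not at hlog
    exact hsep A j a b hAn (mul_natCast_le_sqrt hn hlog hj) har hbr hr'
      (rankPair_of_eRk_le ha.le) (rankPair_of_eRk_le hb.le)

/-- Here (n+1)^3 2^n counts the tuples (r, A, a, b), and 4 counts the kinds of exceptional matroids.
-/
lemma eventually_union_bound : ∀ᶠ n : ℕ in atTop,
    (4 * ((n : ℝ) + 1) ^ 3 * 2 ^ n) * Real.exp (-(3 * n)) ≤ 1 / n := by
  filter_upwards [eventually_pow_mul_le_pow 4 32 (show (1 : ℝ) < 2 by norm_num),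
    eventually_ge_atTop 1] with n h hn
  have hn0 : (1 : ℝ) ≤ n := by exact_mod_cast hn
  rw [Real.exp_neg, ← div_eq_mul_inv, div_le_div_iff₀ (Real.exp_pos _) (by linarith), one_mul]
  have h1 : (4 : ℝ) ^ n ≤ Real.exp (3 * n) := by
    rw [mul_comm, Real.exp_nat_mul]
    refine pow_le_pow_left₀ (by norm_num) ?_ n
    linarith [Real.add_one_le_exp (3 : ℝ)]
  refine le_trans ?_ h1
  have h2 : (n + 1 : ℝ) ^ 3 ≤ (2 * n) ^ 3 := pow_le_pow_left₀ (by linarith) (by linarith) 3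
  calc 4 * ((n : ℝ) + 1) ^ 3 * 2 ^ n * n ≤ 4 * (2 * (n : ℝ)) ^ 3 * 2 ^ n * n := by gcongr
    _ = 32 * (n : ℝ) ^ 4 * 2 ^ n := by ring
    _ ≤ 2 ^ n * 2 ^ n := by gcongr
    _ = 4 ^ n := by rw [← mul_pow]; norm_num

/-- The exceptional matroids attached to a rank `r`, a set `A` and two bounds `a`, `b`. -/
def exceptionalMatroids (n : ℕ) (i : ℕ × Finset (Fin n) × ℕ × ℕ) : Set (Matroid (Fin n)) :=
  {M ∈ matroidsOfRank (Fin n) i.1 | ¬ GoodRank n i.1} ∪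
  {M ∈ matroidsOfRank (Fin n) i.1 | ¬ M.FIndep i.2.1 ∧ GoodRank n i.1 ∧ 0 < i.2.1.card ∧
    656 * (i.2.1.card : ℝ) ≤ Real.log n} ∪
  {M ∈ matroidsOfRank (Fin n) i.1 | ¬ M✶.FIndep i.2.1 ∧ GoodRank n i.1 ∧ 0 < i.2.1.card ∧
    656 * (i.2.1.card : ℝ) ≤ Real.log n} ∪
  {M ∈ matroidsOfRank (Fin n) i.1 | (RankPair M.FIndep (i.2.1, i.2.2.1) ∧
    RankPair M.FIndep (i.2.1ᶜ, i.2.2.2)) ∧ GoodRank n i.1 ∧ 2 * i.2.1.card ≤ n ∧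
    i.2.2.1 ≤ i.1 ∧ i.2.2.2 ≤ i.1 ∧
    ∃ k : ℕ, 510 * (k : ℝ) ≤ √i.2.1.card ∧ i.2.2.1 + i.2.2.2 < i.1 + k}

lemma ncard_sep_and_le {β : Type*} {S : Set β} {p : β → Prop} {c : Prop} {e : ℝ}
    (he : 0 ≤ e) (h : c → ({x ∈ S | p x}.ncard : ℝ) ≤ e) :
    ({x ∈ S | p x ∧ c}.ncard : ℝ) ≤ e := by
  by_cases hc : c
  · simpa [hc] using h hc
  · simpa [hc] using he

lemma ncard_union_le_add {β : Type*} {S T : Set β} {x y : ℝ} (hS : (S.ncard : ℝ) ≤ x)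
    (hT : (T.ncard : ℝ) ≤ y) : ((S ∪ T).ncard : ℝ) ≤ x + y := by
  have : ((S ∪ T).ncard : ℝ) ≤ S.ncard + T.ncard := by exact_mod_cast Set.ncard_union_le S T
  linarith

lemma eventually_ncard_exceptionalMatroids_le : ∀ᶠ n : ℕ in atTop, ∀ i, i.1 ≤ n →
    ((exceptionalMatroids n i).ncard : ℝ) ≤
      4 * (Real.exp (-(3 * n)) * (matroidsOn n).ncard) := by
  filter_upwards [eventually_ncard_le_of_not_goodRank, eventually_ncard_dep_le,
    eventually_ncard_codep_le, eventually_ncard_separation_le] with n h1 h2 h3 h4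
  rintro ⟨r, A, a, b⟩ hr
  dsimp only at hr
  have he : 0 ≤ Real.exp (-(3 * n)) * (matroidsOn n).ncard := by positivity
  have e1 : ({M ∈ matroidsOfRank (Fin n) r | ¬ GoodRank n r}.ncard : ℝ) ≤
      Real.exp (-(3 * n)) * (matroidsOn n).ncard := by
    simpa using ncard_sep_and_le (p := fun _ => True) he
      (fun hc => by simpa using h1 r hr hc)
  have e2 := ncard_sep_and_le (p := fun M : Matroid (Fin n) => ¬ M.FIndep A) he
    (c := GoodRank n r ∧ 0 < A.card ∧ 656 * (A.card : ℝ) ≤ Real.log n)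
    (fun hc => h2 r hc.1 A hc.2.1 hc.2.2)
  have e3 := ncard_sep_and_le (p := fun M : Matroid (Fin n) => ¬ M✶.FIndep A) he
    (c := GoodRank n r ∧ 0 < A.card ∧ 656 * (A.card : ℝ) ≤ Real.log n)
    (fun hc => h3 r hc.1 A hc.2.1 hc.2.2)
  have e4 := ncard_sep_and_le (p := fun M : Matroid (Fin n) =>
      RankPair M.FIndep (A, a) ∧ RankPair M.FIndep (Aᶜ, b)) he
    (c := GoodRank n r ∧ 2 * A.card ≤ n ∧ a ≤ r ∧ b ≤ r ∧
      ∃ k : ℕ, 510 * (k : ℝ) ≤ √A.card ∧ a + b < r + k)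
    (fun ⟨hc1, hc2, hc3, hc4, k, hc5, hc6⟩ => h4 r hc1 A hc2 k a b hc5 hc3 hc4 hc6)
  exact (ncard_union_le_add (ncard_union_le_add (ncard_union_le_add e1 e2) e3) e4).trans
    (by linarith)

theorem almostAllMatroids_le_of_isKSeparation :
    AlmostAllMatroids (fun n M => ∀ (j : ℕ) (X Y : Set (Fin n)), M.IsKSeparation j X Y →
      1 / 40000 * √(Real.logb 2 n) ≤ j) := by
  refine almostAllMatroids_of_eventually ?_
  filter_upwards [eventually_ncard_exceptionalMatroids_le, eventually_union_bound,
    eventually_ge_atTop 1] with n hexc hbound hn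
  obtain ⟨J, hJ⟩ : ∃ J, J = Finset.range (n + 1) ×ˢ (Finset.univ : Finset (Finset (Fin n))) ×ˢ
    Finset.range (n + 1) ×ˢ Finset.range (n + 1) := ⟨_, rfl⟩
  have hJcard : (J.card : ℝ) = ((n : ℝ) + 1) ^ 3 * 2 ^ n := by
    rw [hJ]
    simp only [Finset.card_product, Finset.card_range, Finset.card_univ, Fintype.card_finset,
      Fintype.card_fin]
    push_cast
    ring
  have hmemJ : ∀ r A a b, r ≤ n → a ≤ n → b ≤ n → (r, A, a, b) ∈ J := by
    intro r A a b h1 h2 h3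
    simp only [hJ, Finset.mem_product, Finset.mem_range, Finset.mem_univ, true_and]
    omega
  -- A matroid in no exceptional class satisfies all hypotheses of `le_of_isKSeparation`; unused
  -- coordinates of the index are filled with ∅ and 0.
  have hsub : {M ∈ matroidsOn n | ¬ ∀ (j : ℕ) (X Y : Set (Fin n)), M.IsKSeparation j X Y →
      1 / 40000 * √(Real.logb 2 n) ≤ j} ⊆ ⋃ i ∈ J, exceptionalMatroids n i := by
    rintro M ⟨hM, hbad⟩
    by_contra hex
    apply hbad
    have hex' : ∀ i ∈ J, M ∉ exceptionalMatroids n i := by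
      intro i hi hMi
      exact hex (Set.mem_biUnion hi hMi)
    obtain ⟨r, hrn, hr⟩ := exists_mem_matroidsOfRank hM
    have hgood : GoodRank n r := by
      by_contra hg
      exact hex' _ (hmemJ r ∅ 0 0 hrn (by omega) (by omega)) (Or.inl (Or.inl (Or.inl ⟨hr, hg⟩)))
    intro j X Y hXY
    refine le_of_isKSeparation hn hr ?_ ?_ ?_ hXY
    · intro A h1 h2
      by_contra h3
      exact hex' _ (hmemJ r A 0 0 hrn (by omega) (by omega))
        (Or.inl (Or.inl (Or.inr ⟨hr, h3, hgood, h1, h2⟩)))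
    · intro A h1 h2
      by_contra h3
      exact hex' _ (hmemJ r A 0 0 hrn (by omega) (by omega))
        (Or.inl (Or.inr ⟨hr, h3, hgood, h1, h2⟩))
    · intro A k a b h1 h2 h3 h4 h5 h6 h7
      exact hex' _ (hmemJ r A a b hrn (by omega) (by omega))
        (Or.inr ⟨hr, ⟨h6, h7⟩, hgood, h1, h3, h4, k, h2, h5⟩)
  have hfin : (⋃ i ∈ J, exceptionalMatroids n i).Finite := by
    refine Set.Finite.subset (matroidsOn_finite n) (Set.iUnion₂_subset fun i _ => ?_)
    rintro M (((h | h) | h) | h) <;> exact h.1.1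
  have hcount : (({M ∈ matroidsOn n | ¬ ∀ (j : ℕ) (X Y : Set (Fin n)), M.IsKSeparation j X Y →
      1 / 40000 * √(Real.logb 2 n) ≤ j}.ncard : ℕ) : ℝ) ≤
      ∑ i ∈ J, ((exceptionalMatroids n i).ncard : ℝ) := by
    exact_mod_cast (Set.ncard_le_ncard hsub hfin).trans (Finset.set_ncard_biUnion_le _ _)
  refine hcount.trans ((Finset.sum_le_card_nsmul J _ _ fun i hi => hexc i ?_).trans ?_)
  · rw [hJ, Finset.mem_product, Finset.mem_range] at hi
    omega
  · rw [nsmul_eq_mul, hJcard]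
    calc ((n : ℝ) + 1) ^ 3 * 2 ^ n * (4 * (Real.exp (-(3 * n)) * (matroidsOn n).ncard)) =
          4 * ((n : ℝ) + 1) ^ 3 * 2 ^ n * Real.exp (-(3 * n)) * (matroidsOn n).ncard := by ring
      _ ≤ _ := mul_le_mul_of_nonneg_right hbound (Nat.cast_nonneg _)

end Connectivity

theorem theorem4p12 :
    (∃ c : ℝ, 0 < c ∧
      AlmostAllMatroids (fun n M =>
        ENNReal.ofReal (c * √(Real.logb 2 (n : ℝ))) ≤ (M.tutteConnectivity : ENNReal))) ∧
    (∀ k : ℕ, AlmostAllMatroids (fun _ M => M.IsKConnected k)) := by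
  refine ⟨⟨1 / 40000, by norm_num, ?_⟩, fun k => ?_⟩
  · refine almostAllMatroids_le_of_isKSeparation.mono (Eventually.of_forall fun n M h => ?_)
    -- Connectivity takes values in ℕ∞, so the real bound is rounded up before the infimum is taken.
    have h1 : ((⌈1 / 40000 * √(Real.logb 2 (n : ℝ))⌉₊ : ℕ) : ℕ∞) ≤ M.tutteConnectivity := by
      refine le_sInf ?_
      rintro _ ⟨j, ⟨X, Y, hXY⟩, rfl⟩
      exact Nat.cast_le.2 (Nat.ceil_le.2 (h j X Y hXY))
    calc ENNReal.ofReal (1 / 40000 * √(Real.logb 2 (n : ℝ)))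
        ≤ ENNReal.ofReal (⌈1 / 40000 * √(Real.logb 2 (n : ℝ))⌉₊ : ℕ) :=
          ENNReal.ofReal_le_ofReal (Nat.le_ceil _)
      _ = (((⌈1 / 40000 * √(Real.logb 2 (n : ℝ))⌉₊ : ℕ) : ℕ∞) : ENNReal) := by
          rw [ENNReal.ofReal_natCast, ENat.toENNReal_coe]
      _ ≤ _ := ENat.toENNReal_mono h1
  -- The connectivity bound tends to infinity, so it eventually exceeds any fixed k.
  · have hlim : Tendsto (fun n : ℕ => 1 / 40000 * √(Real.logb 2 (n : ℝ))) atTop atTop :=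
      (Real.tendsto_sqrt_atTop.comp ((Real.tendsto_logb_atTop one_lt_two).comp
        tendsto_natCast_atTop_atTop)).const_mul_atTop (by norm_num)
    refine almostAllMatroids_le_of_isKSeparation.mono ?_
    filter_upwards [hlim.eventually_ge_atTop (k : ℝ)] with n hn M h j hj X Y hXY
    have : (k : ℝ) ≤ j := hn.trans (h j X Y hXY)
    have : k ≤ j := by exact_mod_cast this
    omega
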